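/- A link in $\mathbb R^3$ is a union of finitely many ($\ge 1$) disjoint smoothly embedded circles. Two links have the same type if some $C^\infty$ diffeomorphism of $\mathbb R^3$ carries one onto the other, and the same oriented type if this diffeomorphism can be chosen orientation preserving (so that a link is then not identified with its mirror image). For integers $(p,q)\ne(0,0)$ let $T(p,q)$ be the torus link of type $(p,q)$ on the standard torus of revolution, that is, the set of all points $$\bigl((2+\cos\varphi)\cos\theta,\ (2+\cos\varphi)\sin\theta,\ \sin\varphi\bigr)\quad\text{with } q\theta\equiv p\varphi \pmod{2\pi}.$$ (It consists of $\gcd(p,q)$ parallel curves. For $pq>0$ it is positive in the sign convention of dynamical systems, which is opposite to the one usual in topology.) The Lorenz template is the branched surface in $\mathbb R^3$ made of a left and a right untwisted band. The left (right) band leaves the left (right) half of a branch line downwards, turns once clockwise (counterclockwise) around the left (right) ear and comes back to the branch line from above, stretched over its whole width; above the branch line the left band passes in front of the right band, and the two bands meet tangentially at the branch line. A Lorenz link is the union of a finite non-empty collection of disjoint smooth simple closed curves carried by the Lorenz template, i.e. lying on it and running everywhere in the direction of its semiflow (turning clockwise around the left ear on the left band and counterclockwise around the right ear on the right band). For $p,q\ge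 1$ the Lorenz braid with the single parameter pair $(p,q)$ is the braid on $p+q$ strands in which the $q$ leftmost strands $i=1,\dots,q$ go from position $i$ to position $i+p$, passing in front of the other $p$ strands, which go from position $q+j$ to position $j$ $(1\le j\le p)$; strands of the same kind do not cross. Theorem. Every torus link is a Lorenz link: 1. For all integers $(p,q)\neq(0,0)$, the torus link $T(p,q)$ has the same type as some Lorenz link. 2. If moreover $pq\ge 0$, then $T(p,q)$ has the same oriented type as some Lorenz link. 3. For all integers $p,q\ge 1$, the closure of the Lorenz braid with the single parameter pair $(p,q)$ has the same oriented type as the torus link $T(p,q)$. -/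

import Mathlib

open Set
open scoped ContDiff Manifold

/-- Euclidean 3-space, with coordinates `x = P 0`, `y = P 1`, `z = P 2`. -/
abbrev E3 : Type := EuclideanSpace ℝ (Fin 3)

/-! ### Link types -/

/-- Two subsets of 3-space (in practice links) have the same type if some `C^∞` diffeomorphism
of 3-space, possibly orientation reversing, takes one onto the other. -/
def SameLinkType (K L : Set E3) : Prop :=
  ∃ f : E3 ≃ₘ[ℝ] E3, f '' K = L

/-- As `SameLinkType`, with an orientation-preserving diffeomorphism (equivalently: the two are
ambient isotopic), so that a link is not identified with its mirror image. -/
def SameOrientedLinkType (K L : Set E3) : Prop :=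
  ∃ f : E3 ≃ₘ[ℝ] E3, (∀ P : E3, 0 < (fderiv ℝ f P).det) ∧ f '' K = L

/-! ### Torus links -/

/-- The standard torus of revolution about the `z`-axis, with radii 2 and 1: `u` is the
longitudinal and `v` the meridional angle. -/
noncomputable def torusPoint (u v : Circle) : E3 :=
  !₂[(2 + (v : ℂ).re) * (u : ℂ).re, (2 + (v : ℂ).re) * (u : ℂ).im, (v : ℂ).im]

/-- The standard torus link of type `(p, q) ≠ (0, 0)`. With `d = gcd p q`, it consists of `d`
parallel curves, each winding `p / d` times longitudinally and `q / d` times meridionally. -/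
def torusLink (p q : ℤ) : Set E3 :=
  {P | ∃ u v : Circle, u ^ q = v ^ p ∧ P = torusPoint u v}

/-! ### The Lorenz template

The template is seen from `y = -∞`, with `x` pointing to the right and `z` upwards. The branch
line is the segment `-1 ≤ x ≤ 1` of the `x`-axis. The left band leaves the left half
`-1 ≤ x ≤ 0` of the branch line downwards, turns clockwise around the left ear (centred at
`x = -2`, `z = 0`) and comes back from above, stretched to the full width of the branch line. The
right band does the same with left and right interchanged. Above the branch line the left band
passes in front of the right band, and the two bands are tangent along the branch line. In the
`xz`-plane the bands are bounded by half circles; `(x - a) * (x - b) + z ^ 2 ≤ 0` describes the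
disc whose diameter is the segment from `a` to `b` of the `x`-axis. -/

/-- The left band of the Lorenz template. The function `expNegInvGlue` is smooth, vanishes on
`(-∞, 0]` and is positive on `(0, ∞)`. -/
def leftBand : Set E3 :=
  {P | P 1 = -expNegInvGlue (P 2) ∧ 0 ≤ (P 0 + 3) * (P 0 + 1) + P 2 ^ 2 ∧
    ((P 2 ≤ 0 ∧ (P 0 + 4) * P 0 + P 2 ^ 2 ≤ 0) ∨
      (0 ≤ P 2 ∧ (P 0 + 4) * (P 0 - 1) + P 2 ^ 2 ≤ 0))}

/-- The right band of the Lorenz template: the left band, rotated by 180 degrees about the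
`z`-axis. -/
def rightBand : Set E3 :=
  {P | P 1 = expNegInvGlue (P 2) ∧ 0 ≤ (P 0 - 3) * (P 0 - 1) + P 2 ^ 2 ∧
    ((P 2 ≤ 0 ∧ (P 0 - 4) * P 0 + P 2 ^ 2 ≤ 0) ∨
      (0 ≤ P 2 ∧ (P 0 - 4) * (P 0 + 1) + P 2 ^ 2 ≤ 0))}

/-- The Lorenz template, a branched surface in 3-space. -/
def lorenzTemplate : Set E3 := leftBand ∪ rightBand

/-- A smooth simple closed curve in 3-space, as a 1-periodic function. -/
structure IsSimpleClosedCurve (γ : ℝ → E3) : Prop where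
  smooth : ContDiff ℝ ∞ γ
  periodic : Function.Periodic γ 1
  injOn : InjOn γ (Ico 0 1)
  immersion : ∀ t, deriv γ t ≠ 0

/-- A curve is carried by the Lorenz template if it lies on the template and always runs in the
direction of the semiflow: on the left band it turns clockwise around the left ear, on the right
band counterclockwise around the right ear (both conditions say "downwards" on the branch line). -/
structure IsCarried (γ : ℝ → E3) : Prop where
  mem : ∀ t, γ t ∈ lorenzTemplate
  left : ∀ t, γ t ∈ leftBand →
    0 < (γ t) 2 * (deriv γ t) 0 - ((γ t) 0 + 2) * (deriv γ t) 2
  right : ∀ t, γ t ∈ rightBand →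
    0 < ((γ t) 0 - 2) * (deriv γ t) 2 - (γ t) 2 * (deriv γ t) 0

/-- A Lorenz link: the union of a finite non-empty collection of disjoint simple closed curves
carried by the Lorenz template. -/
def IsLorenzLink (L : Set E3) : Prop :=
  ∃ (m : ℕ) (γ : Fin m → ℝ → E3), 1 ≤ m ∧
    (∀ i, IsSimpleClosedCurve (γ i) ∧ IsCarried (γ i)) ∧
    (∀ i j, i ≠ j → Disjoint (range (γ i)) (range (γ j))) ∧
    L = ⋃ i, range (γ i)

/-! ### Lorenz braids -/

/-- The braid strand in the slab `-1 ≤ z ≤ 0` from `x = a` at the top to `x = b` at the bottom.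
It runs in front of the `xz`-plane if `ε = -1` and behind it if `ε = 1`. -/
noncomputable def braidStrand (a b : ℕ) (ε : ℝ) : Set E3 :=
  {P | P 2 ∈ Icc (-1 : ℝ) 0 ∧
    P 0 = a + ((b : ℝ) - a) * Real.smoothTransition (-P 2) ∧
    P 1 = ε * Real.smoothTransition (-P 2) * (1 - Real.smoothTransition (-P 2))}

/-- The displacements of the overcrossing strands of the Lorenz braid with parameters
`(p₁, q₁), …, (pₖ, qₖ)`: each `pᵢ` repeated `qᵢ` times. -/
def lorenzDisplacements (c : List (ℕ × ℕ)) : List ℕ :=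
  c.flatMap fun a => List.replicate a.2 a.1

/-- The number of undercrossing strands: the last parameter `pₖ`. -/
def lorenzUnderCount (c : List (ℕ × ℕ)) : ℕ :=
  (c.getLast?.map Prod.fst).getD 0

/-- The bottom position of the `j`-th undercrossing strand (`j = 0, 1, …`): the `j`-th of those
positions `1, 2, …` at which no overcrossing strand ends. -/
noncomputable def lorenzUnderEnd (c : List (ℕ × ℕ)) (j : ℕ) : ℕ :=
  Nat.nth (fun e => 1 ≤ e ∧
    ∀ i : Fin (lorenzDisplacements c).length, e ≠ i + 1 + (lorenzDisplacements c)[i]) j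

/-- The Lorenz braid with parameters `c = ((p₁, q₁), …, (pₖ, qₖ))`, where `p₁ < … < pₖ`. The
overcrossing strands start at the leftmost positions `1, 2, …, m` and are displaced to the right
by the prescribed amounts, the undercrossing strands start at the next `pₖ` positions and go, in
the same order, to the positions that are left over. -/
noncomputable def lorenzBraid (c : List (ℕ × ℕ)) : Set E3 :=
  (⋃ i : Fin (lorenzDisplacements c).length,
    braidStrand (i + 1) (i + 1 + (lorenzDisplacements c)[i]) (-1)) ∪
  ⋃ j : Fin (lorenzUnderCount c),
    braidStrand ((lorenzDisplacements c).length + j + 1) (lorenzUnderEnd c j) 1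

/-- The closure of a braid in the slab `-1 ≤ z ≤ 0`, `x > 0`: the slab is wrapped once around an
axis, by the orientation-preserving map with radius `x`, angle `-2πz` and height `y`, so that top
and bottom are glued by the identity. -/
noncomputable def braidClosure (B : Set E3) : Set E3 :=
  (fun P : E3 =>
    (!₂[P 0 * Real.cos (2 * Real.pi * -P 2), P 0 * Real.sin (2 * Real.pi * -P 2), P 1] : E3)) '' B

/-! ### Diffeomorphisms close to the identity -/

/-! Isotopy extension turns the theorem into the construction of explicit smooth families of
disjoint arcs. If a link moves by a small amount, local left inverses of its parametrization and a
partition of unity yield a smooth displacement field `X` that carries its points along and has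
derivative of norm at most 1/2; then `id + X` is an orientation-preserving diffeomorphism.
Connectedness of the time interval chains these small moves (`StrandIsotopy.sameOrientedLinkType`).
Every link is cut into strands over `0 ≤ τ < 1` that are glued by a permutation. For `T(p, q)` and
for the Lorenz braid with `p, q ≥ 1` it is the same one, `i ↦ i + p` modulo `p + q`.

Torus link and braid. On the torus the sum of both angles serves as time along the strands. The
torus link meets the curve where the sum vanishes in `p + q` points, and the difference of the
angles may be deformed freely as long as the strands keep their order. So `q` strands can be pushed
close to a meridian and `p` strands close to a longitude. The link then lies near the union of these
two circles, and the torus may be moved through maps that are injective and immersive only along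
this union (`TorusFamily.exists_thickening`, `strandLink_unrollTorus`). The final surface has the
sum of the angles as its angle around the `z`-axis, so the thin strands form a closed braid on it.
At each `τ`, radius or height puts any two strands in the same strict order as in a Lorenz braid
whose cross section is turned by a right angle; hence a linear homotopy joins the two
(`thin_closedBraid`, `closedBraid_quarterTurn`).

Braid and template. Strands in front run once around the left ear of the template, the others around
the right ear. Flattening the bands, swinging the right ear behind the branch line onto the left one
and making the loops round leads back to the closed Lorenz braid (`LobeParams.torusLink_strand`).
Each cycle of the permutation gives one closed curve carried by the template.

If one parameter vanishes, the torus link consists of parallel longitudes or meridians, that is, it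
is an unlink, which is realized by concentric circles around the left ear. Changing both signs does
not change the torus link, and a reflection changes one sign. -/

theorem SameOrientedLinkType.sameLinkType {K L : Set E3} (h : SameOrientedLinkType K L) :
    SameLinkType K L :=
  let ⟨f, _, hf⟩ := h
  ⟨f, hf⟩

theorem SameOrientedLinkType.trans {K L M : Set E3} (h : SameOrientedLinkType K L)
    (h' : SameOrientedLinkType L M) : SameOrientedLinkType K M := by
  obtain ⟨f, hf, rfl⟩ := h
  obtain ⟨g, hg, rfl⟩ := h'
  refine ⟨f.trans g, fun P => ?_, ?_⟩
  · have hfd : DifferentiableAt ℝ f P := (f.contDiff.differentiable (by simp)) P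
    have hgd : DifferentiableAt ℝ g (f P) := (g.contDiff.differentiable (by simp)) _
    have : (⇑(f.trans g)) = g ∘ f := rfl
    rw [this, fderiv_comp _ hgd hfd]
    have h2 : ((fderiv ℝ g (f P)).comp (fderiv ℝ f P)).det
        = (fderiv ℝ g (f P)).det * (fderiv ℝ f P).det := by
      simp [ContinuousLinearMap.det, ContinuousLinearMap.toLinearMap_comp, LinearMap.det_comp]
    rw [h2]
    exact mul_pos (hg _) (hf _)
  · have : (⇑(f.trans g)) = g ∘ f := rfl
    rw [this, image_comp]

theorem SameLinkType.trans {K L M : Set E3} (h : SameLinkType K L) (h' : SameLinkType L M) :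
    SameLinkType K M := by
  obtain ⟨f, rfl⟩ := h
  obtain ⟨g, rfl⟩ := h'
  exact ⟨f.trans g, by rw [show (⇑(f.trans g)) = g ∘ f from rfl, image_comp]⟩

theorem SameOrientedLinkType.symm {K L : Set E3} (h : SameOrientedLinkType K L) :
    SameOrientedLinkType L K := by
  obtain ⟨f, hf, rfl⟩ := h
  refine ⟨f.symm, fun P => ?_, ?_⟩
  · have hfd : DifferentiableAt ℝ f (f.symm P) := (f.contDiff.differentiable (by simp)) _
    have hgd : DifferentiableAt ℝ f.symm P := (f.symm.contDiff.differentiable (by simp)) _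
    have h1 : (fderiv ℝ f (f.symm P)).comp (fderiv ℝ f.symm P) = ContinuousLinearMap.id ℝ E3 := by
      rw [← fderiv_comp _ hfd hgd]
      have : f ∘ f.symm = id := by ext1 x; simp
      rw [this, fderiv_id]
    have h2 : (fderiv ℝ f (f.symm P)).det * (fderiv ℝ f.symm P).det = 1 := by
      have := congrArg ContinuousLinearMap.det h1
      simpa [ContinuousLinearMap.det, ContinuousLinearMap.toLinearMap_comp, LinearMap.det_comp]
        using this
    exact pos_of_mul_pos_right (by rw [h2]; exact one_pos) (hf _).le
  · rw [← image_comp]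
    have : f.symm ∘ f = id := by ext1 x; simp
    rw [this, image_id]

/-- The segment from the identity to the given map consists of invertible maps (Neumann series), so
the determinant keeps the sign it has at the identity. -/
theorem det_one_add_pos {A : E3 →L[ℝ] E3} (hA : ‖A‖ ≤ 1 / 2) :
    0 < (ContinuousLinearMap.id ℝ E3 + A).det := by
  have hc : Continuous fun s : ℝ => (ContinuousLinearMap.id ℝ E3 + s • A).det :=
    ContinuousLinearMap.continuous_det.comp (by fun_prop)
  have hne : ∀ s ∈ Icc (0 : ℝ) 1, (ContinuousLinearMap.id ℝ E3 + s • A).det ≠ 0 := by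
    intro s hs h0
    have hn : ‖-(s • A)‖ < 1 := by
      rw [norm_neg, norm_smul, Real.norm_of_nonneg hs.1]
      nlinarith [hs.1, hs.2, norm_nonneg A]
    have hu : IsUnit (ContinuousLinearMap.id ℝ E3 + s • A) := by
      have := isUnit_one_sub_of_norm_lt_one hn
      rwa [sub_neg_eq_add] at this
    have h1 : IsUnit (LinearMap.det (ContinuousLinearMap.id ℝ E3 + s • A : E3 →L[ℝ] E3).toLinearMap) := by
      obtain ⟨u, hu⟩ := hu
      refine IsUnit.of_mul_eq_one (LinearMap.det (u.inv : E3 →L[ℝ] E3).toLinearMap) ?_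
      rw [← hu, ← LinearMap.det_comp, ← ContinuousLinearMap.toLinearMap_comp]
      have : (u.val : E3 →L[ℝ] E3).comp u.inv = ContinuousLinearMap.id ℝ E3 := u.val_inv
      rw [this]
      simp
    exact h1.ne_zero h0
  by_contra hneg
  have h1 : (ContinuousLinearMap.id ℝ E3 + (1 : ℝ) • A).det ≤ 0 := by simpa using hneg
  have h0 : (0 : ℝ) ≤ (ContinuousLinearMap.id ℝ E3 + (0 : ℝ) • A).det := by
    simp [ContinuousLinearMap.det]
  obtain ⟨s, hs, hs0⟩ := intermediate_value_Icc' (zero_le_one) hc.continuousOn ⟨h1, h0⟩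
  exact hne s hs hs0

/-- A 1/2-Lipschitz perturbation of the identity is a homeomorphism; the inverse function theorem
makes its inverse smooth, and `det_one_add_pos` controls the orientation. -/
theorem exists_diffeomorph_id_add {X : E3 → E3} (hX : ContDiff ℝ ∞ X)
    (hX' : ∀ P, ‖fderiv ℝ X P‖ ≤ 1 / 2) :
    ∃ f : E3 ≃ₘ[ℝ] E3, (∀ P, f P = P + X P) ∧ ∀ P, 0 < (fderiv ℝ f P).det := by
  have hXd : Differentiable ℝ X := hX.differentiable (by simp)
  have hlip : LipschitzWith (1 / 2) X := by
    refine lipschitzWith_of_nnnorm_fderiv_le hXd fun P => ?_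
    rw [← NNReal.coe_le_coe]
    simpa using hX' P
  set F : E3 → E3 := fun P => P + X P with hF
  have hFc : ContDiff ℝ ∞ F := contDiff_id.add hX
  have hFd : ∀ P, HasFDerivAt F (ContinuousLinearMap.id ℝ E3 + fderiv ℝ X P) P := fun P =>
    (hasFDerivAt_id P).add (hXd P).hasFDerivAt
  have happ : ApproximatesLinearOn F ((ContinuousLinearEquiv.refl ℝ E3 : E3 ≃L[ℝ] E3) : E3 →L[ℝ] E3)
      univ (1 / 2) := by
    rw [ApproximatesLinearOn.approximatesLinearOn_iff_lipschitzOnWith]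
    have : F - ⇑((ContinuousLinearEquiv.refl ℝ E3 : E3 ≃L[ℝ] E3) : E3 →L[ℝ] E3) = X := by
      ext1 P; simp [hF]
    rw [this]
    exact hlip.lipschitzOnWith
  have hN : Subsingleton E3 ∨ (1 / 2 : NNReal) <
      ‖((ContinuousLinearEquiv.refl ℝ E3 : E3 ≃L[ℝ] E3).symm : E3 →L[ℝ] E3)‖₊⁻¹ := by
    right
    have : ‖((ContinuousLinearEquiv.refl ℝ E3 : E3 ≃L[ℝ] E3).symm : E3 →L[ℝ] E3)‖₊ = 1 := by
      have h : ‖(ContinuousLinearMap.id ℝ E3)‖ = 1 := ContinuousLinearMap.norm_id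
      exact NNReal.eq h
    rw [this, inv_one, ← NNReal.coe_lt_coe]
    norm_num
  let e : E3 ≃ₜ E3 := happ.toHomeomorph F hN
  have he : ∀ P, e P = F P := fun P => rfl
  have hdet : ∀ P, 0 < (ContinuousLinearMap.id ℝ E3 + fderiv ℝ X P).det := fun P =>
    det_one_add_pos (hX' P)
  have hinv : ContDiff ℝ ∞ e.symm := by
    rw [contDiff_iff_contDiffAt]
    intro Q
    have hne : (ContinuousLinearMap.id ℝ E3 + fderiv ℝ X (e.symm Q)).det ≠ 0 := (hdet _).ne'
    refine e.toOpenPartialHomeomorph.contDiffAt_symm (a := Q)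
      (f₀' := ContinuousLinearMap.toContinuousLinearEquivOfDetNeZero _ hne) (mem_univ _) ?_ ?_
    · exact hFd _
    · exact hFc.contDiffAt
  refine ⟨⟨e.toEquiv, hFc.contMDiff, hinv.contMDiff⟩, fun P => rfl, fun P => ?_⟩
  have : fderiv ℝ F P = ContinuousLinearMap.id ℝ E3 + fderiv ℝ X P := (hFd P).fderiv
  change 0 < (fderiv ℝ F P).det
  rw [this]
  exact hdet P

/-! ### Isotopies of links presented by strands -/

/-- A smooth isotopy of links, each of which is cut into finitely many strands: strand `i`, at
time `τ` close to `1`, continues as strand `π i`. -/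
structure StrandIsotopy {ι : Type*} (π : Equiv.Perm ι) (H : ℝ → ι → ℝ → E3) : Prop where
  smooth : ∀ i, ContDiff ℝ ∞ fun z : ℝ × ℝ => H z.1 i z.2
  glue : ∃ c : ℝ, 0 < c ∧ c ≤ 1 ∧ ∀ t ∈ Icc (0 : ℝ) 1, ∀ i, ∀ τ ∈ Icc (1 - c) 1,
    H t i τ = H t (π i) (τ - 1)
  immersion : ∀ t ∈ Icc (0 : ℝ) 1, ∀ i, ∀ τ ∈ Ico (0 : ℝ) 1, deriv (H t i) τ ≠ 0
  inj : ∀ t ∈ Icc (0 : ℝ) 1, ∀ i j, ∀ τ ∈ Ico (0 : ℝ) 1, ∀ τ' ∈ Ico (0 : ℝ) 1,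
    H t i τ = H t j τ' → i = j ∧ τ = τ'

/-- The link that consists of the given strands. -/
def strandLink {ι : Type*} (γ : ι → ℝ → E3) : Set E3 := ⋃ i, γ i '' Ico 0 1

theorem mem_strandLink {ι : Type*} {γ : ι → ℝ → E3} {P : E3} :
    P ∈ strandLink γ ↔ ∃ i, ∃ τ ∈ Ico (0 : ℝ) 1, γ i τ = P := by
  simp [strandLink]

/-- A smooth curve has a smooth local left inverse at a point where it is immersed. -/
theorem exists_smooth_left_inverse {γ : ℝ → E3} (hγ : ContDiff ℝ ∞ γ) {τ₀ : ℝ}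
    (h0 : deriv γ τ₀ ≠ 0) :
    ∃ r > 0, ∃ U : Set E3, IsOpen U ∧ γ τ₀ ∈ U ∧ ∃ σ : E3 → ℝ,
      (∀ P ∈ U, ContDiffAt ℝ ∞ σ P) ∧ ∀ τ, |τ - τ₀| < r → σ (γ τ) = τ := by
  set v := deriv γ τ₀ with hv
  -- The component along the velocity at `τ₀` is a local coordinate on the curve. It is defined on
  -- all of space, so its local inverse extends the curve parameter to a neighbourhood.
  set ℓ : E3 →L[ℝ] ℝ := innerSL ℝ v with hℓ
  set g : ℝ → ℝ := fun τ => ℓ (γ τ) with hg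
  have hgc : ContDiff ℝ ∞ g := ℓ.contDiff.comp hγ
  have hgd : ∀ τ, HasDerivAt g (deriv g τ) τ := fun τ =>
    ((hgc.differentiable (by simp)) τ).hasDerivAt
  have hg0 : deriv g τ₀ ≠ 0 := by
    have h1 : HasDerivAt γ v τ₀ := ((hγ.differentiable (by simp)) τ₀).hasDerivAt
    have h2 : HasDerivAt g (ℓ v) τ₀ := ℓ.hasFDerivAt.comp_hasDerivAt τ₀ h1
    rw [h2.deriv]
    simpa [hℓ] using h0
  have hn : (∞ : WithTop ℕ∞) ≠ 0 := by simp
  set e := (hgc.contDiffAt (x := τ₀)).toOpenPartialHomeomorph g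
    ((hgd τ₀).hasFDerivAt_equiv hg0) hn with he
  have hecoe : ∀ τ, e τ = g τ := fun τ => rfl
  have hsrc : τ₀ ∈ e.source := ContDiffAt.mem_toOpenPartialHomeomorph_source _ _ _
  have hdc : Continuous (deriv g) := hgc.continuous_deriv (by simp)
  have hW : IsOpen {τ | deriv g τ ≠ 0} := isOpen_ne.preimage hdc
  have hU0 : IsOpen (e.target ∩ e.symm ⁻¹' {τ | deriv g τ ≠ 0}) :=
    e.symm.isOpen_inter_preimage hW
  obtain ⟨r, hr, hball⟩ := Metric.isOpen_iff.1 e.open_source τ₀ hsrc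
  refine ⟨r, hr, ℓ ⁻¹' (e.target ∩ e.symm ⁻¹' {τ | deriv g τ ≠ 0}), hU0.preimage ℓ.continuous,
    ⟨e.map_source hsrc, ?_⟩, fun P => e.symm (ℓ P), ?_, ?_⟩
  · have : e.symm (ℓ (γ τ₀)) = τ₀ := e.left_inv hsrc
    simp only [mem_preimage, mem_ofPred_eq]
    rw [this]
    exact hg0
  · rintro P ⟨hP1, hP2⟩
    have := e.contDiffAt_symm_deriv (n := ∞) hP2 hP1 (hgd _) hgc.contDiffAt
    exact this.comp P ℓ.contDiff.contDiffAt
  · intro τ hτ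
    exact e.left_inv (hball (by simpa [Real.dist_eq] using hτ))

/-! ### Isotopy extension for strand isotopies. -/

section
variable {ι : Type*} {π : Equiv.Perm ι} {H : ℝ → ι → ℝ → E3}

theorem StrandIsotopy.smooth_strand (h : StrandIsotopy π H) (t : ℝ) (i : ι) :
    ContDiff ℝ ∞ (H t i) := (h.smooth i).comp (by fun_prop : ContDiff ℝ ∞ fun τ : ℝ => (t, τ))

/-- In a small enough neighbourhood of a point, only the part of the link next to that point is met.
There `σ` recovers the parameter, so the motion of all points of the link is given by one smooth
formula in the point. -/
theorem StrandIsotopy.exists_local_param [Finite ι] (h : StrandIsotopy π H) {t₀ : ℝ} (ht₀ : t₀ ∈ Icc (0 : ℝ) 1)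
    (i : ι) {τ₀ : ℝ} (hτ₀ : τ₀ ∈ Ico (0 : ℝ) 1) :
    ∃ U : Set E3, IsOpen U ∧ H t₀ i τ₀ ∈ U ∧ Bornology.IsBounded U ∧ ∃ σ : E3 → ℝ,
      (∀ P ∈ U, ContDiffAt ℝ ∞ σ P) ∧ ∀ j, ∀ τ ∈ Ico (0 : ℝ) 1, H t₀ j τ ∈ U →
        ∀ t ∈ Icc (0 : ℝ) 1, H t j τ = H t i (σ (H t₀ j τ)) := by
  obtain ⟨c, hc0, hc1, hglue⟩ := h.glue
  obtain ⟨r, hr, U, hU, hPU, σ, hσ, hinv⟩ := exists_smooth_left_inverse (h.smooth_strand t₀ i)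
    (h.immersion t₀ ht₀ i τ₀ hτ₀)
  -- All parameters except those that represent points of the arc through `H t₀ i τ₀`. Such a point
  -- may also be given by the end of the preceding strand, hence the second exception. The closed
  -- interval makes `C j` compact; its extra endpoint 1 is treated by gluing.
  let C : ι → Set ℝ := fun j => {τ | τ ∈ Icc (0 : ℝ) 1 ∧ ¬ (j = i ∧ |τ - τ₀| < r) ∧
    ¬ (π j = i ∧ 1 - c < τ ∧ |τ - 1 - τ₀| < r)}
  have hC : ∀ j, IsCompact (C j) := by
    intro j
    have hcl : IsClosed (C j) := by
      refine isClosed_Icc.and (IsClosed.and ?_ ?_)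
      · rw [← isOpen_compl_iff]
        have : ({τ | ¬ (j = i ∧ |τ - τ₀| < r)}ᶜ : Set ℝ) = {τ | j = i ∧ |τ - τ₀| < r} := by
          ext; simp
        rw [this]
        exact isOpen_const.and (isOpen_lt (by fun_prop) (by fun_prop))
      · rw [← isOpen_compl_iff]
        have : ({τ | ¬ (π j = i ∧ 1 - c < τ ∧ |τ - 1 - τ₀| < r)}ᶜ : Set ℝ) =
            {τ | π j = i ∧ 1 - c < τ ∧ |τ - 1 - τ₀| < r} := by
          ext; simp
        rw [this]
        exact isOpen_const.and ((isOpen_lt (by fun_prop) (by fun_prop)).and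
          (isOpen_lt (by fun_prop) (by fun_prop)))
    exact isCompact_Icc.of_isClosed_subset hcl fun τ hτ => hτ.1
  have hne : ∀ j, H t₀ i τ₀ ∉ H t₀ j '' C j := by
    rintro j ⟨τ, ⟨hτ, h1, h2⟩, heq⟩
    rcases hτ.2.lt_or_eq with hlt | rfl
    · obtain ⟨rfl, rfl⟩ := h.inj t₀ ht₀ j i τ ⟨hτ.1, hlt⟩ τ₀ hτ₀ heq
      exact h1 ⟨rfl, by simpa using hr⟩
    · rw [hglue t₀ ht₀ j 1 ⟨by linarith, le_rfl⟩] at heq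
      obtain ⟨h3, h4⟩ := h.inj t₀ ht₀ (π j) i (1 - 1) (by norm_num) τ₀ hτ₀ heq
      exact h2 ⟨h3, by linarith, by rw [← h4]; simpa using hr⟩
  have hK : IsClosed (⋃ j, H t₀ j '' C j) :=
    isClosed_iUnion_of_finite fun j => ((hC j).image (h.smooth_strand t₀ j).continuous).isClosed
  refine ⟨(U ∩ (⋃ j, H t₀ j '' C j)ᶜ) ∩ Metric.ball (H t₀ i τ₀) 1,
    (hU.inter hK.isOpen_compl).inter Metric.isOpen_ball, ⟨⟨hPU, ?_⟩, Metric.mem_ball_self one_pos⟩,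
    Metric.isBounded_ball.subset inter_subset_right, σ, fun P hP => hσ P hP.1.1, ?_⟩
  · simpa using hne
  · rintro j τ hτ ⟨⟨_, hV⟩, _⟩ t ht
    have hτC : τ ∉ C j := fun hτC => hV (mem_iUnion.2 ⟨j, τ, hτC, rfl⟩)
    by_cases h1 : j = i ∧ |τ - τ₀| < r
    · obtain ⟨rfl, h1⟩ := h1
      rw [hinv τ h1]
    · obtain ⟨rfl, h3, h4⟩ : π j = i ∧ 1 - c < τ ∧ |τ - 1 - τ₀| < r := by
        by_contra h2
        exact hτC ⟨⟨hτ.1, hτ.2.le⟩, h1, h2⟩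
      rw [hglue t₀ ht₀ j τ ⟨h3.le, hτ.2.le⟩, hinv _ h4, hglue t ht j τ ⟨h3.le, hτ.2.le⟩]

theorem StrandIsotopy.isCompact_strandLink [Finite ι] (h : StrandIsotopy π H) {t : ℝ}
    (ht : t ∈ Icc (0 : ℝ) 1) : IsCompact (strandLink (H t)) := by
  have : strandLink (H t) = ⋃ i, H t i '' Icc 0 1 := by
    refine (iUnion_mono fun i => image_mono Ico_subset_Icc_self).antisymm ?_
    refine iUnion_subset fun i => ?_
    rintro _ ⟨τ, hτ, rfl⟩
    refine mem_strandLink.2 ?_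
    rcases hτ.2.lt_or_eq with hlt | rfl
    · exact ⟨i, τ, ⟨hτ.1, hlt⟩, rfl⟩
    · obtain ⟨c, hc0, hc1, hglue⟩ := h.glue
      refine ⟨π i, 0, by norm_num, ?_⟩
      rw [hglue t ht i 1 ⟨by linarith, le_rfl⟩]
      norm_num
  rw [this]
  exact isCompact_iUnion fun i => isCompact_Icc.image (h.smooth_strand t i).continuous

/-- The displacements prescribed by the local parametrizations are averaged by a partition of unity.
On the link they all agree, so the average still moves each point to its place at time `t`. The
field vanishes at `t = t₀` and outside a fixed compact set, hence its derivative is uniformly small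
for `t` near `t₀`. -/
theorem StrandIsotopy.eventually [Finite ι] (h : StrandIsotopy π H) {t₀ : ℝ} (ht₀ : t₀ ∈ Icc (0 : ℝ) 1) :
    ∀ᶠ t in nhdsWithin t₀ (Icc 0 1),
      SameOrientedLinkType (strandLink (H t₀)) (strandLink (H t)) := by
  have hloc : ∀ P : strandLink (H t₀), ∃ U : Set E3, IsOpen U ∧ P.1 ∈ U ∧ Bornology.IsBounded U ∧
      ∃ (i : ι) (σ : E3 → ℝ), (∀ P ∈ U, ContDiffAt ℝ ∞ σ P) ∧ ∀ j, ∀ τ ∈ Ico (0 : ℝ) 1,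
        H t₀ j τ ∈ U → ∀ t ∈ Icc (0 : ℝ) 1, H t j τ = H t i (σ (H t₀ j τ)) := by
    rintro ⟨P, hP⟩
    obtain ⟨i, τ, hτ, rfl⟩ := mem_strandLink.1 hP
    obtain ⟨U, h1, h2, h3, σ, h4, h5⟩ := h.exists_local_param ht₀ i hτ
    exact ⟨U, h1, h2, h3, i, σ, h4, h5⟩
  choose U hUo hPU hUb idx σ hσ hpar using hloc
  have hK := h.isCompact_strandLink ht₀
  obtain ⟨T, hT⟩ := hK.elim_finite_subcover U hUo fun P hP => mem_iUnion.2 ⟨⟨P, hP⟩, hPU ⟨P, hP⟩⟩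
  obtain ⟨ρ, hρ⟩ := SmoothPartitionOfUnity.exists_isSubordinate 𝓘(ℝ, E3) hK.isClosed
    (fun k : T => U k.1) (fun k => hUo k.1) (by
      intro P hP
      obtain ⟨k, hk, hPk⟩ := mem_iUnion₂.1 (hT hP)
      exact mem_iUnion.2 ⟨⟨k, hk⟩, hPk⟩)
  -- the displacement field
  let Y : ℝ × E3 → E3 := fun z => ∑ k : T,
    ρ k z.2 • (H z.1 (idx k.1) (σ k.1 z.2) - H t₀ (idx k.1) (σ k.1 z.2))
  have hY : ContDiff ℝ ∞ Y := by
    refine ContDiff.sum fun k _ => ?_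
    rw [contDiff_iff_contDiffAt]
    rintro ⟨t, P⟩
    by_cases hP : P ∈ tsupport (ρ k)
    · have h1 : ContDiffAt ℝ ∞ (σ k.1) P := hσ k.1 P (hρ k hP)
      have h2 : ContDiffAt ℝ ∞ (fun z : ℝ × E3 => σ k.1 z.2) (t, P) :=
        ContDiffAt.comp (t, P) (g := σ k.1) (f := Prod.snd) h1 contDiffAt_snd
      have h3 : ContDiffAt ℝ ∞ (fun z : ℝ × E3 => ρ k z.2) (t, P) :=
        ContDiffAt.comp (t, P) (g := ρ k) (f := Prod.snd)
          (contMDiff_iff_contDiff.1 (ρ k).contMDiff).contDiffAt contDiffAt_snd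
      refine h3.smul (ContDiffAt.sub ?_ ?_)
      · exact ContDiffAt.comp (t, P) (g := fun z : ℝ × ℝ => H z.1 (idx k.1) z.2)
          (f := fun z : ℝ × E3 => (z.1, σ k.1 z.2)) (h.smooth _).contDiffAt
          (contDiffAt_fst.prodMk h2)
      · exact ContDiffAt.comp (t, P) (g := H t₀ (idx k.1)) (h.smooth_strand t₀ _).contDiffAt h2
    · have hev : ∀ᶠ z in nhds (t, P), ρ k z.2 = 0 := by
        have h1 : ∀ᶠ Q in nhds P, ρ k Q = 0 := by
          have := notMem_tsupport_iff_eventuallyEq.1 hP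
          exact this
        exact (continuous_snd.tendsto (t, P)).eventually h1
      refine (contDiffAt_const (c := (0 : E3))).congr_of_eventuallyEq ?_
      filter_upwards [hev] with z hz
      simp [hz]
  have hY0 : ∀ P, Y (t₀, P) = 0 := fun P => by simp [Y]
  -- smallness of the derivative
  let C : Set E3 := ⋃ k : T, tsupport (ρ k)
  have hC : IsCompact C := isCompact_iUnion fun k =>
    Metric.isCompact_of_isClosed_isBounded (isClosed_tsupport _) ((hUb k.1).subset (hρ k))
  have hfd : ∀ t P, fderiv ℝ (fun Q => Y (t, Q)) P =
      (fderiv ℝ Y (t, P)).comp (ContinuousLinearMap.inr ℝ ℝ E3) := by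
    intro t P
    have h1 : HasFDerivAt (fun Q : E3 => ((t, Q) : ℝ × E3)) (ContinuousLinearMap.inr ℝ ℝ E3) P :=
      hasFDerivAt_prodMk_right t P
    exact (((hY.differentiable (by simp)) (t, P)).hasFDerivAt.comp P h1).fderiv
  have hfc : Continuous fun z : ℝ × E3 => ‖fderiv ℝ (fun Q => Y (z.1, Q)) z.2‖ := by
    simp only [hfd]
    have := hY.continuous_fderiv (by simp)
    exact ((ContinuousLinearMap.compL ℝ E3 (ℝ × E3) E3).flip
      (ContinuousLinearMap.inr ℝ ℝ E3)).continuous.comp this |>.norm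
  have hsmall : ∀ᶠ t in nhds t₀, ∀ P, ‖fderiv ℝ (fun Q => Y (t, Q)) P‖ ≤ 1 / 2 := by
    have h1 : ∀ᶠ t in nhds t₀, ∀ P ∈ C, ‖fderiv ℝ (fun Q => Y (t, Q)) P‖ < 1 / 2 := by
      refine hC.eventually_forall_of_forall_eventually fun P _ => ?_
      refine (hfc.tendsto (t₀, P)).eventually_lt_const ?_
      have : (fun Q => Y (t₀, Q)) = fun _ => 0 := funext hY0
      simp only [this]
      simp
    filter_upwards [h1] with t ht P
    by_cases hP : P ∈ C
    · exact (ht P hP).le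
    · have hcl : IsClosed C := hC.isClosed
      have : (fun Q => Y (t, Q)) =ᶠ[nhds P] fun _ => 0 := by
        filter_upwards [hcl.isOpen_compl.mem_nhds hP] with Q hQ
        refine Finset.sum_eq_zero fun k _ => ?_
        have : ρ k Q = 0 := by
          by_contra hne
          exact hQ (mem_iUnion.2 ⟨k, subset_tsupport _ hne⟩)
        simp [this]
      rw [this.fderiv_eq]
      simp
  filter_upwards [nhdsWithin_le_nhds hsmall, self_mem_nhdsWithin] with t ht htI
  obtain ⟨f, hf, hdet⟩ := exists_diffeomorph_id_add (X := fun P => Y (t, P))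
    (hY.comp (by fun_prop : ContDiff ℝ ∞ fun P : E3 => (t, P))) ht
  refine ⟨f, hdet, ?_⟩
  have hmove : ∀ j, ∀ τ ∈ Ico (0 : ℝ) 1, f (H t₀ j τ) = H t j τ := by
    intro j τ hτ
    rw [hf]
    have hsum : Y (t, H t₀ j τ) = ∑ k : T, ρ k (H t₀ j τ) • (H t j τ - H t₀ j τ) := by
      refine Finset.sum_congr rfl fun k _ => ?_
      by_cases h0 : ρ k (H t₀ j τ) = 0
      · simp [h0]
      · have hmem : H t₀ j τ ∈ U k.1 := hρ k (subset_tsupport _ h0)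
        simp only
        rw [← hpar k.1 j τ hτ hmem t htI, ← hpar k.1 j τ hτ hmem t₀ ht₀]
    have hone : ∑ k : T, ρ k (H t₀ j τ) = 1 := by
      rw [← finsum_eq_sum_of_fintype]
      exact ρ.sum_eq_one (mem_strandLink.2 ⟨j, τ, hτ, rfl⟩)
    rw [hsum, ← Finset.sum_smul, hone, one_smul]
    abel
  rw [strandLink, strandLink, image_iUnion]
  refine iUnion_congr fun j => ?_
  rw [image_image]
  exact image_congr fun τ hτ => hmove j τ hτ

/-- Isotopy extension: the links at both ends of a smooth isotopy have the same oriented type. -/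
theorem StrandIsotopy.sameOrientedLinkType [Finite ι] (h : StrandIsotopy π H) :
    SameOrientedLinkType (strandLink (H 0)) (strandLink (H 1)) := by
  -- A transitive relation that holds in both directions between each time and the nearby ones holds
  -- throughout a connected set of times.
  refine isPreconnected_Icc.induction₂' (s := Icc (0 : ℝ) 1)
    (fun s t => SameOrientedLinkType (strandLink (H s)) (strandLink (H t))) (fun t ht => ?_)
    (fun x y z _ _ _ h1 h2 => h1.trans h2) (by simp) (by simp)
  filter_upwards [h.eventually ht] with s hs
  exact ⟨hs, hs.symm⟩

end

/-! ### Coordinates -/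

theorem ContDiff.vec3 {F : Type*} [NormedAddCommGroup F] [NormedSpace ℝ F] {n : WithTop ℕ∞}
    {f g h : F → ℝ} (hf : ContDiff ℝ n f) (hg : ContDiff ℝ n g) (hh : ContDiff ℝ n h) :
    ContDiff ℝ n fun z => (!₂[f z, g z, h z] : E3) := by
  rw [contDiff_euclidean]
  intro i
  fin_cases i
  exacts [hf, hg, hh]

theorem vec3_inj {a b c a' b' c' : ℝ} :
    (!₂[a, b, c] : E3) = !₂[a', b', c'] ↔ a = a' ∧ b = b' ∧ c = c' := by
  constructor
  · intro h
    exact ⟨congrArg (fun P : E3 => P 0) h, congrArg (fun P : E3 => P 1) h,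
      congrArg (fun P : E3 => P 2) h⟩
  · rintro ⟨rfl, rfl, rfl⟩
    rfl

theorem HasDerivAt.coord {γ : ℝ → E3} {v : E3} {τ : ℝ} (h : HasDerivAt γ v τ) (k : Fin 3) :
    HasDerivAt (fun t => γ t k) (v k) τ :=
  (EuclideanSpace.proj (𝕜 := ℝ) k).hasFDerivAt.comp_hasDerivAt τ h

theorem HasDerivAt.vec3 {f g h : ℝ → ℝ} {a b c τ : ℝ} (hf : HasDerivAt f a τ)
    (hg : HasDerivAt g b τ) (hh : HasDerivAt h c τ) :
    HasDerivAt (fun t => (!₂[f t, g t, h t] : E3)) !₂[a, b, c] τ := by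
  have hd : DifferentiableAt ℝ (fun t => (!₂[f t, g t, h t] : E3)) τ := by
    rw [differentiableAt_euclidean]
    intro i
    fin_cases i
    exacts [hf.differentiableAt, hg.differentiableAt, hh.differentiableAt]
  have h1 := hd.hasDerivAt
  have h2 : _root_.deriv (fun t => (!₂[f t, g t, h t] : E3)) τ = !₂[a, b, c] := by
    ext i
    fin_cases i
    exacts [(h1.coord 0).unique hf, (h1.coord 1).unique hg, (h1.coord 2).unique hh]
  rwa [h2] at h1

theorem two_pi_injOn {τ τ' : ℝ} (hτ : τ ∈ Ico (0 : ℝ) 1) (hτ' : τ' ∈ Ico (0 : ℝ) 1)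
    (hc : Real.cos (2 * Real.pi * τ) = Real.cos (2 * Real.pi * τ'))
    (hs : Real.sin (2 * Real.pi * τ) = Real.sin (2 * Real.pi * τ')) : τ = τ' := by
  have h := Real.Angle.cos_sin_inj hc hs
  rw [Real.Angle.angle_eq_iff_two_pi_dvd_sub] at h
  obtain ⟨k, hk⟩ := h
  have hk' : τ - τ' = k := by
    have : 2 * Real.pi ≠ 0 := by positivity
    apply mul_left_cancel₀ this
    linarith
  have h1 : (k : ℝ) < 1 := by rw [← hk']; linarith [hτ.2, hτ'.1]
  have h2 : (-1 : ℝ) < k := by rw [← hk']; linarith [hτ.1, hτ'.2]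
  have h3 : k = 0 := by
    have h1' : k < 1 := by exact_mod_cast h1
    have h2' : -1 < k := by exact_mod_cast h2
    omega
  rw [h3] at hk'
  push_cast at hk'
  linarith

/-- Two positive multiples of unit vectors agree only if both factors do. -/
theorem polar_inj {r r' c s c' s' : ℝ} (hr : 0 < r) (hr' : 0 < r') (h1 : c ^ 2 + s ^ 2 = 1)
    (h2 : c' ^ 2 + s' ^ 2 = 1) (hx : r * c = r' * c') (hy : r * s = r' * s') :
    r = r' ∧ c = c' ∧ s = s' := by
  have h : r ^ 2 = r' ^ 2 := by
    calc r ^ 2 = (r * c) ^ 2 + (r * s) ^ 2 := by linear_combination -r ^ 2 * h1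
      _ = (r' * c') ^ 2 + (r' * s') ^ 2 := by rw [hx, hy]
      _ = r' ^ 2 := by linear_combination r' ^ 2 * h2
  have hrr : r = r' := by
    rw [← abs_of_pos hr, ← abs_of_pos hr']
    exact (sq_eq_sq_iff_abs_eq_abs r r').1 h
  subst hrr
  exact ⟨rfl, mul_left_cancel₀ hr.ne' hx, mul_left_cancel₀ hr.ne' hy⟩

/-! ### Strands over a circle -/

/-- The point with cylindrical coordinates `(r, 2πτ, h)`. -/
noncomputable def cylPoint (r τ h : ℝ) : E3 :=
  !₂[r * Real.cos (2 * Real.pi * τ), r * Real.sin (2 * Real.pi * τ), h]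

theorem cylPoint_add_int (r τ h : ℝ) (k : ℤ) : cylPoint r (τ + k) h = cylPoint r τ h := by
  have : 2 * Real.pi * (τ + k) = 2 * Real.pi * τ + k * (2 * Real.pi) := by ring
  simp only [cylPoint, this, Real.cos_add_int_mul_two_pi, Real.sin_add_int_mul_two_pi]

theorem cylPoint_inj {r τ h r' τ' h' : ℝ} (hr : 0 < r) (hr' : 0 < r') (hτ : τ ∈ Ico (0 : ℝ) 1)
    (hτ' : τ' ∈ Ico (0 : ℝ) 1) (heq : cylPoint r τ h = cylPoint r' τ' h') :
    r = r' ∧ τ = τ' ∧ h = h' := by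
  obtain ⟨h1, h2, h3⟩ := vec3_inj.1 heq
  obtain ⟨h4, h5, h6⟩ := polar_inj hr hr' (Real.cos_sq_add_sin_sq _) (Real.cos_sq_add_sin_sq _)
    h1 h2
  exact ⟨h4, two_pi_injOn hτ hτ' h5 h6, h3⟩

theorem ContDiff.cylPoint {F : Type*} [NormedAddCommGroup F] [NormedSpace ℝ F] {n : WithTop ℕ∞}
    {f g h : F → ℝ} (hf : ContDiff ℝ n f) (hg : ContDiff ℝ n g) (hh : ContDiff ℝ n h) :
    ContDiff ℝ n fun z => cylPoint (f z) (g z) (h z) :=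
  ((hf.mul (Real.contDiff_cos.comp (contDiff_const.mul hg))).vec3
    (hf.mul (Real.contDiff_sin.comp (contDiff_const.mul hg))) hh)

/-- The angular component of the velocity is `2π` times the radius. -/
theorem deriv_cylPoint_ne_zero {r h : ℝ → ℝ} {τ : ℝ} (hr : DifferentiableAt ℝ r τ)
    (hh : DifferentiableAt ℝ h τ) (h0 : 0 < r τ) :
    deriv (fun t => cylPoint (r t) t (h t)) τ ≠ 0 := by
  have hω : HasDerivAt (fun t : ℝ => 2 * Real.pi * t) (2 * Real.pi) τ := by
    simpa using (hasDerivAt_id τ).const_mul (2 * Real.pi)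
  have h1 := (hr.hasDerivAt.mul hω.cos).vec3 (hr.hasDerivAt.mul hω.sin) hh.hasDerivAt
  intro hd
  have h2 : deriv (fun t => _root_.cylPoint (r t) t (h t)) τ = _ := h1.deriv
  rw [h2] at hd
  have hx := congrArg (fun P : E3 => P 0) hd
  have hy := congrArg (fun P : E3 => P 1) hd
  simp at hx hy
  have hcs := Real.cos_sq_add_sin_sq (2 * Real.pi * τ)
  have : r τ * (2 * Real.pi) = 0 := by
    linear_combination -Real.sin (2 * Real.pi * τ) * hx + Real.cos (2 * Real.pi * τ) * hy
      - r τ * (2 * Real.pi) * hcs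
  have hpos : 0 < r τ * (2 * Real.pi) := by positivity
  exact hpos.ne' this

/-- Isotopy of closed braids. -/
theorem closedBraid_isotopy {ι : Type*} [Finite ι] (π : Equiv.Perm ι) (R h : ℝ → ι → ℝ → ℝ)
    (hR : ∀ i, ContDiff ℝ ∞ fun z : ℝ × ℝ => R z.1 i z.2)
    (hh : ∀ i, ContDiff ℝ ∞ fun z : ℝ × ℝ => h z.1 i z.2)
    (hglue : ∃ c : ℝ, 0 < c ∧ c ≤ 1 ∧ ∀ t ∈ Icc (0 : ℝ) 1, ∀ i, ∀ τ ∈ Icc (1 - c) 1,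
      R t i τ = R t (π i) (τ - 1) ∧ h t i τ = h t (π i) (τ - 1))
    (hpos : ∀ t ∈ Icc (0 : ℝ) 1, ∀ i, ∀ τ ∈ Ico (0 : ℝ) 1, 0 < R t i τ)
    (hne : ∀ t ∈ Icc (0 : ℝ) 1, ∀ τ ∈ Ico (0 : ℝ) 1, ∀ i j, R t i τ = R t j τ →
      h t i τ = h t j τ → i = j) :
    SameOrientedLinkType (strandLink fun i τ => cylPoint (R 0 i τ) τ (h 0 i τ))
      (strandLink fun i τ => cylPoint (R 1 i τ) τ (h 1 i τ)) := by
  have hsec : ∀ t : ℝ, ContDiff ℝ ∞ fun τ : ℝ => (t, τ) := fun t => by fun_prop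
  refine StrandIsotopy.sameOrientedLinkType (π := π)
    (H := fun t i τ => cylPoint (R t i τ) τ (h t i τ)) ⟨fun i => ?_, ?_, ?_, ?_⟩
  · exact (hR i).cylPoint contDiff_snd (hh i)
  · obtain ⟨c, hc0, hc1, hg⟩ := hglue
    refine ⟨c, hc0, hc1, fun t ht i τ hτ => ?_⟩
    obtain ⟨h1, h2⟩ := hg t ht i τ hτ
    have := cylPoint_add_int (R t i τ) τ (h t i τ) (-1)
    rw [← this, h1, h2]
    push_cast
    rfl
  · intro t ht i τ hτ
    exact deriv_cylPoint_ne_zero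
      ((((hR i).comp (hsec t)).differentiable (by simp)) τ)
      ((((hh i).comp (hsec t)).differentiable (by simp)) τ) (hpos t ht i τ hτ)
  · intro t ht i j τ hτ τ' hτ' heq
    obtain ⟨h1, rfl, h3⟩ := cylPoint_inj (hpos t ht i τ hτ) (hpos t ht j τ' hτ') hτ hτ' heq
    exact ⟨hne t ht τ hτ i j h1 h3, rfl⟩

/-! ### Continuing strands beyond their ends -/

/-- The function `f i` on `[0, 1]`, continued to the left by its predecessor, up to a constant. -/
def contLeft {ι : Type*} (π : Equiv.Perm ι) (f : ι → ℝ → ℝ) (i : ι) (τ : ℝ) : ℝ :=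
  f i τ + f (π.symm i) (τ + 1) - f (π.symm i) 1

theorem ContDiff.contLeft {ι : Type*} {π : Equiv.Perm ι} {f : ι → ℝ → ℝ} {n : WithTop ℕ∞}
    (hf : ∀ i, ContDiff ℝ n (f i)) (i : ι) : ContDiff ℝ n (contLeft π f i) :=
  ((hf i).add ((hf _).comp (contDiff_id.add contDiff_const))).sub contDiff_const

/-- The predecessor is constant beyond 1, so its contribution cancels for nonnegative `τ`. -/
theorem contLeft_eq {ι : Type*} {π : Equiv.Perm ι} {f : ι → ℝ → ℝ}
    (h1 : ∀ i, ∀ τ, 1 ≤ τ → f i τ = f i 1) (i : ι) {τ : ℝ} (hτ : 0 ≤ τ) :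
    contLeft π f i τ = f i τ := by
  rw [contLeft, h1 _ (τ + 1) (by linarith)]
  ring

/-- Since every `f i` is constant before 0 and after 1, at negative times the successor shows just
the motion of its predecessor. The constant that remains is the mismatch of the end values, which is
absorbed where it is a full turn or zero. -/
theorem contLeft_glue {ι : Type*} {π : Equiv.Perm ι} {f : ι → ℝ → ℝ}
    (h0 : ∀ i, ∀ τ, τ ≤ 0 → f i τ = f i 0) (h1 : ∀ i, ∀ τ, 1 ≤ τ → f i τ = f i 1) (i : ι) {τ : ℝ}
    (hτ : τ ∈ Icc (0 : ℝ) 1) :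
    contLeft π f i τ = contLeft π f (π i) (τ - 1) + (f i 1 - f (π i) 0) := by
  rw [contLeft_eq h1 i hτ.1, contLeft, Equiv.symm_apply_apply, h0 _ (τ - 1) (by linarith [hτ.2])]
  ring_nf

/-! ### The Lorenz braid with a single parameter pair -/

/-- The permutation of the Lorenz braid with parameter pair `(p, q)`, on positions `0, 1, …`. -/
def lorenzPerm (p q : ℕ) : Equiv.Perm (Fin (p + q)) where
  toFun i := if h : (i : ℕ) < q then ⟨i + p, by omega⟩ else ⟨i - q, by omega⟩
  invFun i := if h : (i : ℕ) < p then ⟨i + q, by omega⟩ else ⟨i - p, by omega⟩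
  left_inv i := by
    ext
    by_cases h : (i : ℕ) < q
    · simp [h]
    · have h1 : (i : ℕ) - q < p := by omega
      simp only [h, dif_neg, not_false_eq_true, h1, dif_pos]
      omega
  right_inv i := by
    ext
    by_cases h : (i : ℕ) < p
    · simp [h]
    · have h1 : (i : ℕ) - p < q := by omega
      simp only [h, dif_neg, not_false_eq_true, h1, dif_pos]
      omega

theorem lorenzPerm_val {p q : ℕ} (i : Fin (p + q)) :
    (lorenzPerm p q i : ℕ) = if (i : ℕ) < q then (i : ℕ) + p else (i : ℕ) - q := by
  by_cases h : (i : ℕ) < q <;> simp [lorenzPerm, h]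

/-- The displacement of the strand that starts at position `i`. -/
def lorenzShift (p q : ℕ) (i : Fin (p + q)) : ℝ := if (i : ℕ) < q then p else -q

/-- The side on which a strand passes: `-1` for the strands in front, `1` for the others. -/
def lorenzSide (p q : ℕ) (i : Fin (p + q)) : ℝ := if (i : ℕ) < q then -1 else 1

theorem lorenzPerm_cast {p q : ℕ} (i : Fin (p + q)) :
    ((lorenzPerm p q i : ℕ) : ℝ) = i + lorenzShift p q i := by
  rw [lorenzPerm_val, lorenzShift]
  split_ifs with h
  · push_cast; ring
  · push Not at h
    push_cast [Nat.cast_sub h]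
    ring

theorem lorenzDisplacements_singleton (p q : ℕ) :
    lorenzDisplacements [(p, q)] = List.replicate q p := by
  simp [lorenzDisplacements]

theorem lorenzUnderCount_singleton (p q : ℕ) : lorenzUnderCount [(p, q)] = p := by
  simp [lorenzUnderCount]

/-- All overcrossing strands end to the right of position `p`, so the positions `1, …, p` are free.
`Nat.nth` counts from 0 and position 0 is excluded, whence the shift by one. -/
theorem lorenzUnderEnd_singleton {p q j : ℕ} (hj : j < p) :
    lorenzUnderEnd [(p, q)] j = j + 1 := by
  classical
  set P : ℕ → Prop := fun e => 1 ≤ e ∧ ∀ i : Fin (lorenzDisplacements [(p, q)]).length,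
    e ≠ i + 1 + (lorenzDisplacements [(p, q)])[i] with hP
  have hPe : ∀ e, 1 ≤ e → e ≤ p → P e := by
    intro e h1 h2
    refine ⟨h1, fun i => ?_⟩
    have : (lorenzDisplacements [(p, q)])[i] = p := by
      simp [lorenzDisplacements_singleton]
    omega
  have hP0 : ¬ P 0 := fun h => absurd h.1 (by norm_num)
  have hcount : ∀ k, k ≤ p → Nat.count P (k + 1) = k := by
    intro k
    induction k with
    | zero => intro _; simp [Nat.count_succ, hP0]
    | succ k ih =>
      intro hk
      rw [Nat.count_succ, ih (by omega), if_pos (hPe _ (by omega) hk)]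
  have h := Nat.nth_count (hPe (j + 1) (by omega) (by omega))
  rwa [hcount j (by omega)] at h

theorem lorenzBraid_singleton (p q : ℕ) :
    lorenzBraid [(p, q)] = ⋃ i : Fin (p + q),
      braidStrand (i + 1) (lorenzPerm p q i + 1) (lorenzSide p q i) := by
  have hlen : (lorenzDisplacements [(p, q)]).length = q := by
    simp [lorenzDisplacements_singleton]
  have hget : ∀ i : Fin (lorenzDisplacements [(p, q)]).length,
      (lorenzDisplacements [(p, q)])[i] = p := by
    intro i; simp [lorenzDisplacements_singleton]
  ext P
  simp only [lorenzBraid, mem_union, mem_iUnion]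
  constructor
  · rintro (⟨i, hi⟩ | ⟨j, hj⟩)
    · have hiq : (i : ℕ) < q := by have := i.2; omega
      refine ⟨⟨i, by omega⟩, ?_⟩
      rw [hget] at hi
      rw [lorenzPerm_val, lorenzSide]
      simp only [hiq, if_true]
      convert hi using 1
      congr 1
      omega
    · have hjp : (j : ℕ) < p := j.2.trans_eq (lorenzUnderCount_singleton p q)
      refine ⟨⟨q + j, by omega⟩, ?_⟩
      rw [lorenzPerm_val, lorenzSide]
      rw [hlen, lorenzUnderEnd_singleton hjp] at hj
      have : ¬ (q + (j : ℕ) < q) := by omega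
      simp only [this, if_false]
      convert hj using 2
      omega
  · rintro ⟨i, hi⟩
    rw [lorenzPerm_val, lorenzSide] at hi
    by_cases h : (i : ℕ) < q
    · left
      refine ⟨⟨i, by omega⟩, ?_⟩
      rw [hget]
      simp only [h, if_true] at hi
      convert hi using 1
      congr 1
      simp only
      omega
    · right
      have hjp : (i : ℕ) - q < p := by omega
      refine ⟨⟨i - q, by rw [lorenzUnderCount_singleton]; omega⟩, ?_⟩
      rw [hlen]
      simp only
      rw [lorenzUnderEnd_singleton hjp]
      simp only [h, if_false] at hi
      convert hi using 1
      congr 1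
      omega

/-- Distance of a strand of the closed Lorenz braid from the axis. -/
noncomputable def lorenzRadius (p q : ℕ) (i : Fin (p + q)) (τ : ℝ) : ℝ :=
  i + 1 + lorenzShift p q i * Real.smoothTransition τ

/-- Height of a strand of the closed Lorenz braid. -/
noncomputable def lorenzHeight (p q : ℕ) (i : Fin (p + q)) (τ : ℝ) : ℝ :=
  lorenzSide p q i * Real.smoothTransition τ * (1 - Real.smoothTransition τ)

theorem lorenzRadius_one {p q : ℕ} (i : Fin (p + q)) :
    lorenzRadius p q i 1 = lorenzRadius p q (lorenzPerm p q i) 0 := by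
  simp only [lorenzRadius, Real.smoothTransition.one, Real.smoothTransition.zero, lorenzPerm_cast]
  ring

theorem lorenzHeight_one {p q : ℕ} (i : Fin (p + q)) :
    lorenzHeight p q i 1 = lorenzHeight p q (lorenzPerm p q i) 0 := by
  simp [lorenzHeight]

theorem braidClosure_lorenzBraid_singleton (p q : ℕ) :
    braidClosure (lorenzBraid [(p, q)]) =
      strandLink fun i τ => cylPoint (lorenzRadius p q i τ) τ (lorenzHeight p q i τ) := by
  rw [lorenzBraid_singleton]
  have key : ∀ (i : Fin (p + q)) (τ : ℝ),
      ((i + 1 : ℕ) : ℝ) + (((lorenzPerm p q i + 1 : ℕ) : ℝ) - ((i + 1 : ℕ) : ℝ)) *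
        Real.smoothTransition τ = lorenzRadius p q i τ := by
    intro i τ
    push_cast
    rw [lorenzPerm_cast, lorenzRadius]
    ring
  ext Q
  rw [mem_strandLink]
  constructor
  · rintro ⟨P, hP, rfl⟩
    obtain ⟨i, hz, hx, hy⟩ := mem_iUnion.1 hP
    rw [key] at hx
    have hQ : (!₂[P 0 * Real.cos (2 * Real.pi * -P 2), P 0 * Real.sin (2 * Real.pi * -P 2), P 1]
        : E3) = cylPoint (lorenzRadius p q i (-P 2)) (-P 2) (lorenzHeight p q i (-P 2)) := by
      rw [cylPoint, ← hx, lorenzHeight, ← hy]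
    simp only [hQ]
    -- The bottom of a strand has `τ = 1`, outside the half-open parameter interval; it is the top
    -- of the next strand.
    rcases hz.1.eq_or_lt with h1 | h1
    · refine ⟨lorenzPerm p q i, 0, by norm_num, ?_⟩
      rw [← h1, neg_neg, lorenzRadius_one, lorenzHeight_one]
      have := cylPoint_add_int (lorenzRadius p q (lorenzPerm p q i) 0) 0
        (lorenzHeight p q (lorenzPerm p q i) 0) 1
      rw [← this]
      norm_num
    · exact ⟨i, -P 2, ⟨by linarith [hz.2], by linarith⟩, rfl⟩
  · rintro ⟨i, τ, hτ, rfl⟩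
    refine ⟨!₂[lorenzRadius p q i τ, lorenzHeight p q i τ, -τ], mem_iUnion.2 ⟨i, ?_, ?_, ?_⟩, ?_⟩
    · exact ⟨by simpa using hτ.2.le, by simpa using hτ.1⟩
    · rw [key]; simp
    · simp [lorenzHeight]
    · simp [cylPoint]

/-! ### Strands on a torus -/

theorem strandLink_congr {ι : Type*} {γ γ' : ι → ℝ → E3}
    (h : ∀ i, ∀ τ ∈ Ico (0 : ℝ) 1, γ i τ = γ' i τ) : strandLink γ = strandLink γ' :=
  iUnion_congr fun i => image_congr (h i)

theorem Circle.exp_two_pi_add_int (x : ℝ) (k : ℤ) :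
    Circle.exp (2 * Real.pi * (x + k)) = Circle.exp (2 * Real.pi * x) := by
  have : 2 * Real.pi * (x + k) = 2 * Real.pi * x + k * (2 * Real.pi) := by ring
  rw [this, Circle.exp_eq_exp]
  exact ⟨k, rfl⟩

theorem Circle.exp_two_pi_inj {x y : ℝ}
    (h : Circle.exp (2 * Real.pi * x) = Circle.exp (2 * Real.pi * y)) : ∃ k : ℤ, x = y + k := by
  obtain ⟨k, hk⟩ := Circle.exp_eq_exp.1 h
  refine ⟨k, ?_⟩
  have : 2 * Real.pi ≠ 0 := by positivity
  apply mul_left_cancel₀ this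
  linarith

theorem Circle.exp_re (a : ℝ) : (Circle.exp a : ℂ).re = Real.cos a := by
  rw [Circle.coe_exp, Complex.exp_ofReal_mul_I_re]

theorem Circle.exp_im (a : ℝ) : (Circle.exp a : ℂ).im = Real.sin a := by
  rw [Circle.coe_exp, Complex.exp_ofReal_mul_I_im]

theorem Circle.re_sq_add_im_sq (u : Circle) : (u : ℂ).re ^ 2 + (u : ℂ).im ^ 2 = 1 := by
  have := Circle.normSq_coe u
  rw [Complex.normSq_apply] at this
  linarith

theorem Circle.ext_re_im {u v : Circle} (h1 : (u : ℂ).re = (v : ℂ).re)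
    (h2 : (u : ℂ).im = (v : ℂ).im) : u = v :=
  Circle.ext (Complex.ext h1 h2)

/-- A smooth family of maps from the torus to 3-space, with its partial derivatives. -/
structure TorusFamily (Ψ Pa Pb : ℝ → Circle → Circle → E3) : Prop where
  smooth : ContDiff ℝ ∞ fun z : ℝ × ℝ × ℝ => Ψ z.1 (Circle.exp z.2.1) (Circle.exp z.2.2)
  hasDerivAt : ∀ (t : ℝ) (a b : ℝ → ℝ) (a' b' τ : ℝ), HasDerivAt a a' τ → HasDerivAt b b' τ →
    HasDerivAt (fun s => Ψ t (Circle.exp (a s)) (Circle.exp (b s)))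
      (a' • Pa t (Circle.exp (a τ)) (Circle.exp (b τ)) +
        b' • Pb t (Circle.exp (a τ)) (Circle.exp (b τ))) τ

/-- The point of the torus with sum of angles `2πτ` and difference of angles `2πd`. -/
noncomputable def diagPoint (Ψ : Circle → Circle → E3) (d τ : ℝ) : E3 :=
  Ψ (Circle.exp (2 * Real.pi * ((τ + d) / 2))) (Circle.exp (2 * Real.pi * ((τ - d) / 2)))

theorem lorenzSide_cases {p q : ℕ} (i : Fin (p + q)) :
    lorenzSide p q i = -1 ∨ lorenzSide p q i = 1 := by
  rw [lorenzSide]; split_ifs <;> simp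

/-- Isotopy of links on moving tori, all of whose strands run across the torus in such a way that
the sum of both angles increases steadily. -/
theorem TorusFamily.isotopy {Ψ Pa Pb : ℝ → Circle → Circle → E3} (hΨ : TorusFamily Ψ Pa Pb)
    {p q : ℕ} (D : ℝ → Fin (p + q) → ℝ → ℝ)
    (hD : ∀ i, ContDiff ℝ ∞ fun z : ℝ × ℝ => D z.1 i z.2)
    (hglue : ∀ t i, ∀ τ ∈ Icc (0 : ℝ) 1,
      D t i τ = D t (lorenzPerm p q i) (τ - 1) + lorenzSide p q i)
    (hord : ∀ t ∈ Icc (0 : ℝ) 1, ∀ τ ∈ Ico (0 : ℝ) 1, ∀ i j, i < j →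
      D t i τ < D t j τ ∧ D t j τ < D t i τ + 2)
    (himm : ∀ t ∈ Icc (0 : ℝ) 1, ∀ i, ∀ τ ∈ Ico (0 : ℝ) 1, ∀ x y : ℝ,
      x • diagPoint (Pa t) (D t i τ) τ + y • diagPoint (Pb t) (D t i τ) τ = 0 → x = 0 ∧ y = 0)
    (hinj : ∀ t ∈ Icc (0 : ℝ) 1, ∀ i j, ∀ τ ∈ Ico (0 : ℝ) 1, ∀ τ' ∈ Ico (0 : ℝ) 1,
      diagPoint (Ψ t) (D t i τ) τ = diagPoint (Ψ t) (D t j τ') τ' →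
      Circle.exp (2 * Real.pi * ((τ + D t i τ) / 2)) =
        Circle.exp (2 * Real.pi * ((τ' + D t j τ') / 2)) ∧
      Circle.exp (2 * Real.pi * ((τ - D t i τ) / 2)) =
        Circle.exp (2 * Real.pi * ((τ' - D t j τ') / 2))) :
    SameOrientedLinkType (strandLink fun i τ => diagPoint (Ψ 0) (D 0 i τ) τ)
      (strandLink fun i τ => diagPoint (Ψ 1) (D 1 i τ) τ) := by
  refine StrandIsotopy.sameOrientedLinkType (π := lorenzPerm p q)
    (H := fun t i τ => diagPoint (Ψ t) (D t i τ) τ) ⟨fun i => ?_, ⟨1, one_pos, le_rfl, ?_⟩, ?_, ?_⟩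
  · refine hΨ.smooth.comp (g := fun z : ℝ × ℝ × ℝ =>
      Ψ z.1 (Circle.exp z.2.1) (Circle.exp z.2.2)) (f := fun z : ℝ × ℝ =>
        (z.1, 2 * Real.pi * ((z.2 + D z.1 i z.2) / 2), 2 * Real.pi * ((z.2 - D z.1 i z.2) / 2))) ?_
    refine contDiff_fst.prodMk ((contDiff_const.mul ?_).prodMk (contDiff_const.mul ?_))
    · exact (contDiff_snd.add (hD i)).div_const 2
    · exact (contDiff_snd.sub (hD i)).div_const 2
  · intro t _ i τ hτ
    rw [sub_self] at hτ
    simp only [diagPoint]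
    rw [hglue t i τ hτ]
    set d := D t (lorenzPerm p q i) (τ - 1)
    -- During one unit of time a strand in front gains a full turn in the second angle relative to
    -- its successor, the other strands gain one in the first angle.
    rcases lorenzSide_cases i with h | h <;> rw [h]
    · have h1 := Circle.exp_two_pi_add_int ((τ - 1 - d) / 2) 1
      rw [← h1]
      congr 3
      · ring
      · push_cast; ring
    · have h1 := Circle.exp_two_pi_add_int ((τ - 1 + d) / 2) 1
      rw [← h1]
      congr 3
      · push_cast; ring
      · ring
  · intro t ht i τ hτ h0
    have hDd : HasDerivAt (D t i) (deriv (D t i) τ) τ := by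
      have : ContDiff ℝ ∞ (D t i) := (hD i).comp (by fun_prop : ContDiff ℝ ∞ fun τ : ℝ => (t, τ))
      exact ((this.differentiable (by simp)) τ).hasDerivAt
    have ha : HasDerivAt (fun s => 2 * Real.pi * ((s + D t i s) / 2))
        (2 * Real.pi * ((1 + deriv (D t i) τ) / 2)) τ :=
      (((hasDerivAt_id τ).add hDd).div_const 2).const_mul _
    have hb : HasDerivAt (fun s => 2 * Real.pi * ((s - D t i s) / 2))
        (2 * Real.pi * ((1 - deriv (D t i) τ) / 2)) τ :=
      (((hasDerivAt_id τ).sub hDd).div_const 2).const_mul _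
    have h1 := (hΨ.hasDerivAt t _ _ _ _ τ ha hb).deriv
    have h2 := h1.symm.trans h0
    obtain ⟨h3, h4⟩ := himm t ht i τ hτ _ _ h2
    -- The two coefficients are the speeds of the two angles; their sum is `2π` and cannot vanish.
    have : 2 * Real.pi = 0 := by linear_combination h3 + h4
    exact absurd this (by positivity)
  · intro t ht i j τ hτ τ' hτ' heq
    obtain ⟨h1, h2⟩ := hinj t ht i j τ hτ τ' hτ' heq
    obtain ⟨k, hk⟩ := Circle.exp_two_pi_inj h1
    obtain ⟨l, hl⟩ := Circle.exp_two_pi_inj h2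
    -- The sum of the angles determines `τ` modulo 1.
    have hττ : τ = τ' := by
      have h3 : τ - τ' = ((k + l : ℤ) : ℝ) := by push_cast; linarith
      have h4 : ((k + l : ℤ) : ℝ) < 1 := by rw [← h3]; linarith [hτ.2, hτ'.1]
      have h5 : (-1 : ℝ) < ((k + l : ℤ) : ℝ) := by rw [← h3]; linarith [hτ.1, hτ'.2]
      have h6 : k + l = 0 := by
        have h4' : k + l < 1 := by exact_mod_cast h4
        have h5' : -1 < k + l := by exact_mod_cast h5
        omega
      rw [h6] at h3
      push_cast at h3
      linarith
    subst hττ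
    refine ⟨?_, rfl⟩
    -- With equal sums, both angles agree modulo full turns only if the differences agree modulo 2.
    -- The window of length 2 in `hord` leaves only `k = 0`.
    have hd : D t i τ = D t j τ + 2 * k := by linarith
    rcases lt_trichotomy i j with hij | hij | hij
    · exfalso
      obtain ⟨h3, h4⟩ := hord t ht τ hτ i j hij
      have h5 : (k : ℝ) < 0 := by linarith
      have h6 : (-1 : ℝ) < k := by linarith
      have h5' : k < 0 := by exact_mod_cast h5
      have h6' : -1 < k := by exact_mod_cast h6
      omega
    · exact hij
    · exfalso
      obtain ⟨h3, h4⟩ := hord t ht τ hτ j i hij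
      have h5 : (0 : ℝ) < k := by linarith
      have h6 : (k : ℝ) < 1 := by linarith
      have h5' : 0 < k := by exact_mod_cast h5
      have h6' : k < 1 := by exact_mod_cast h6
      omega

/-! ### Straight strands and strands close to a meridian and a longitude -/

/-- The difference of angles along the `i`-th strand of the torus link. -/
noncomputable def straightDiff (p q : ℕ) (i : Fin (p + q)) (τ : ℝ) : ℝ :=
  (2 * i + ((p : ℝ) - q) * τ) / (p + q)

theorem straightDiff_glue {p q : ℕ} (hp : 1 ≤ p) (i : Fin (p + q)) (τ : ℝ) :
    straightDiff p q i τ = straightDiff p q (lorenzPerm p q i) (τ - 1) + lorenzSide p q i := by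
  have hn : (p : ℝ) + q ≠ 0 := by positivity
  rw [straightDiff, straightDiff, lorenzPerm_cast, lorenzShift, lorenzSide]
  split_ifs <;> field_simp <;> ring

/-- A smooth function that is close to the identity on `[0, 1]` and constant elsewhere. -/
noncomputable def flatStep (ε τ : ℝ) : ℝ :=
  1 - Real.smoothTransition ((1 - τ) / ε) +
    τ * Real.smoothTransition (τ / ε) * Real.smoothTransition ((1 - τ) / ε)

theorem flatStep_of_nonpos {ε τ : ℝ} (hε : 0 < ε) (hε1 : ε ≤ 1) (hτ : τ ≤ 0) :
    flatStep ε τ = 0 := by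
  rw [flatStep, Real.smoothTransition.one_of_one_le, Real.smoothTransition.zero_of_nonpos]
  · ring
  · exact div_nonpos_of_nonpos_of_nonneg hτ hε.le
  · rw [le_div_iff₀ hε]; linarith

theorem flatStep_of_one_le {ε τ : ℝ} (hε : 0 < ε) (hτ : 1 ≤ τ) : flatStep ε τ = 1 := by
  rw [flatStep, Real.smoothTransition.zero_of_nonpos (x := (1 - τ) / ε)]
  · ring
  · exact div_nonpos_of_nonpos_of_nonneg (by linarith) hε.le

theorem flatStep_mem {ε τ : ℝ} (hτ : τ ∈ Icc (0 : ℝ) 1) : flatStep ε τ ∈ Icc (0 : ℝ) 1 := by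
  have h1 := Real.smoothTransition.nonneg (τ / ε)
  have h2 := Real.smoothTransition.le_one (τ / ε)
  have h3 := Real.smoothTransition.nonneg ((1 - τ) / ε)
  have h4 := Real.smoothTransition.le_one ((1 - τ) / ε)
  have h5 : 0 ≤ τ * Real.smoothTransition (τ / ε) := mul_nonneg hτ.1 h1
  have h6 : τ * Real.smoothTransition (τ / ε) ≤ 1 := mul_le_one₀ hτ.2 h1 h2
  have h7 := mul_nonneg h5 h3
  have h8 : τ * Real.smoothTransition (τ / ε) * Real.smoothTransition ((1 - τ) / ε) ≤
    Real.smoothTransition ((1 - τ) / ε) := mul_le_of_le_one_left h3 h6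
  constructor <;> rw [flatStep] <;> linarith

/-- The error splits into two nonnegative terms with opposite signs. Each cutoff differs from 1 only
within `ε` of its end of the interval, and there the other factor is at most `ε`. -/
theorem abs_flatStep_sub_le {ε τ : ℝ} (hε : 0 < ε) (hτ : τ ∈ Icc (0 : ℝ) 1) :
    |flatStep ε τ - τ| ≤ ε := by
  set x := Real.smoothTransition (τ / ε) with hx
  set y := Real.smoothTransition ((1 - τ) / ε) with hy
  have hx0 : 0 ≤ x := Real.smoothTransition.nonneg _
  have hx1 : x ≤ 1 := Real.smoothTransition.le_one _
  have hy0 : 0 ≤ y := Real.smoothTransition.nonneg _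
  have hy1 : y ≤ 1 := Real.smoothTransition.le_one _
  have e1 : flatStep ε τ - τ = (1 - y) * (1 - τ) - τ * (1 - x) * y := by
    rw [flatStep, ← hx, ← hy]; ring
  have a1 : (1 - y) * (1 - τ) ≤ ε := by
    rcases le_total ε (1 - τ) with h | h
    · have : y = 1 := Real.smoothTransition.one_of_one_le (by rw [le_div_iff₀ hε]; linarith)
      rw [this]; linarith
    · calc (1 - y) * (1 - τ) ≤ 1 * (1 - τ) := by
            apply mul_le_mul_of_nonneg_right <;> linarith [hτ.2]
        _ ≤ ε := by linarith
  have a2 : τ * (1 - x) * y ≤ ε := by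
    rcases le_total ε τ with h | h
    · have : x = 1 := Real.smoothTransition.one_of_one_le (by rw [le_div_iff₀ hε]; linarith)
      rw [this]; linarith
    · calc τ * (1 - x) * y ≤ τ * 1 * 1 := by
            apply mul_le_mul _ hy1 hy0 (by linarith [hτ.1])
            apply mul_le_mul_of_nonneg_left (by linarith) hτ.1
        _ ≤ ε := by linarith
  have a3 : 0 ≤ (1 - y) * (1 - τ) := mul_nonneg (by linarith) (by linarith [hτ.2])
  have a4 : 0 ≤ τ * (1 - x) * y := mul_nonneg (mul_nonneg hτ.1 (by linarith)) hy0
  rw [e1, abs_le]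
  constructor <;> linarith

theorem contDiff_flatStep (ε : ℝ) : ContDiff ℝ ∞ (flatStep ε) := by
  have hS : ContDiff ℝ ∞ Real.smoothTransition := Real.smoothTransition.contDiff
  have h1 : ContDiff ℝ ∞ fun τ : ℝ => Real.smoothTransition ((1 - τ) / ε) :=
    hS.comp ((contDiff_const.sub contDiff_id).div_const ε)
  have h2 : ContDiff ℝ ∞ fun τ : ℝ => Real.smoothTransition (τ / ε) :=
    hS.comp (contDiff_id.div_const ε)
  exact (contDiff_const.sub h1).add ((contDiff_id.mul h2).mul h1)

/-- The difference of angles along a strand that runs close to a meridian (if it passes in front)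
or close to a longitude (otherwise). -/
noncomputable def thinStep (p q : ℕ) (ε : ℝ) (i : Fin (p + q)) (τ : ℝ) : ℝ :=
  ε * i + (lorenzSide p q i + ε * lorenzShift p q i) * flatStep ε τ

/-- The continuation of `thinStep` to the left. -/
noncomputable def thinDiff (p q : ℕ) (ε : ℝ) : Fin (p + q) → ℝ → ℝ :=
  contLeft (lorenzPerm p q) (thinStep p q ε)

theorem thinDiff_eq {p q : ℕ} {ε τ : ℝ} (hε : 0 < ε) (i : Fin (p + q)) (hτ : 0 ≤ τ) :
    thinDiff p q ε i τ = thinStep p q ε i τ := by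
  refine contLeft_eq (fun j σ hσ => ?_) i hτ
  rw [thinStep, thinStep, flatStep_of_one_le hε hσ, flatStep_of_one_le hε le_rfl]

theorem thinDiff_glue {p q : ℕ} {ε τ : ℝ} (hε : 0 < ε) (hε1 : ε ≤ 1) (i : Fin (p + q))
    (hτ : τ ∈ Icc (0 : ℝ) 1) :
    thinDiff p q ε i τ = thinDiff p q ε (lorenzPerm p q i) (τ - 1) + lorenzSide p q i := by
  rw [thinDiff, contLeft_glue _ _ i hτ]
  · rw [thinStep, thinStep, flatStep_of_one_le hε le_rfl, flatStep_of_nonpos hε hε1 le_rfl,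
      lorenzPerm_cast]
    ring
  · intro j σ hσ
    rw [thinStep, thinStep, flatStep_of_nonpos hε hε1 hσ, flatStep_of_nonpos hε hε1 le_rfl]
  · intro j σ hσ
    rw [thinStep, thinStep, flatStep_of_one_le hε hσ, flatStep_of_one_le hε le_rfl]

theorem contDiff_thinDiff (p q : ℕ) (ε : ℝ) (i : Fin (p + q)) :
    ContDiff ℝ ∞ (thinDiff p q ε i) :=
  ContDiff.contLeft (fun _ => contDiff_const.add (contDiff_const.mul (contDiff_flatStep ε))) i

theorem straightDiff_order {p q : ℕ} {i j : Fin (p + q)} (hij : i < j) (τ : ℝ) :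
    straightDiff p q i τ < straightDiff p q j τ ∧
      straightDiff p q j τ < straightDiff p q i τ + 2 := by
  have h1 : (i : ℝ) + 1 ≤ j := by exact_mod_cast hij
  have h2 : (j : ℝ) + 1 ≤ p + q := by exact_mod_cast j.2
  have h3 : (0 : ℝ) ≤ i := by positivity
  have hn : (0 : ℝ) < p + q := by linarith
  constructor
  · rw [straightDiff, straightDiff]
    exact div_lt_div_of_pos_right (by linarith) hn
  · have : straightDiff p q i τ + 2 = (2 * (i + (p + q)) + ((p : ℝ) - q) * τ) / (p + q) := by
      rw [straightDiff]; field_simp; ring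
    rw [this, straightDiff]
    exact div_lt_div_of_pos_right (by linarith) hn

/-- Strands of the same kind keep the distance `ε (j - i)`. For strands of different kinds the gap
is `ε (j - i) + (2 - ε (p + q)) s`, with `s` in `[0, 1]`, and since `j - i < p + q` it stays below
2. -/
theorem thinStep_order {p q : ℕ} {ε τ : ℝ} (hε : 0 < ε) (hεn : ε * (p + q) ≤ 1)
    {i j : Fin (p + q)} (hij : i < j) (hτ : τ ∈ Icc (0 : ℝ) 1) :
    thinStep p q ε i τ < thinStep p q ε j τ ∧ thinStep p q ε j τ < thinStep p q ε i τ + 2 := by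
  have h1 : (i : ℝ) + 1 ≤ j := by exact_mod_cast hij
  have h2 : (j : ℝ) + 1 ≤ p + q := by exact_mod_cast j.2
  have h3 : (0 : ℝ) ≤ i := by positivity
  obtain ⟨s0, s1⟩ := flatStep_mem (ε := ε) hτ
  set s := flatStep ε τ
  have e1 : ε * ((j : ℝ) - i) ≤ ε * (p + q) - ε := by nlinarith
  have e2 : ε ≤ ε * ((j : ℝ) - i) := by nlinarith
  simp only [thinStep, lorenzSide, lorenzShift]
  have hij' : (i : ℕ) < j := hij
  split_ifs with hi hj hj
  · constructor <;> nlinarith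
  · have h4 : 0 ≤ s * (2 - ε * (p + q)) := mul_nonneg s0 (by linarith)
    have h5 : s * (2 - ε * (p + q)) ≤ 2 - ε * (p + q) := by nlinarith
    constructor <;> nlinarith
  · omega
  · constructor <;> nlinarith

/-! ### From the torus link to thin strands on a sheared torus -/

/-- The standard torus, moved by shears. -/
noncomputable def shearTorus (t : ℝ) (u v : Circle) : E3 :=
  !₂[(2 + (v : ℂ).re) * (u : ℂ).re - 2 * t, (2 + (v : ℂ).re) * (u : ℂ).im + t * (v : ℂ).im,
    (v : ℂ).im - t * ((2 + (v : ℂ).re) * (u : ℂ).im / 3)]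

theorem shearTorus_family : TorusFamily shearTorus
    (fun t u v => !₂[-((2 + (v : ℂ).re) * (u : ℂ).im), (2 + (v : ℂ).re) * (u : ℂ).re,
      -(t * ((2 + (v : ℂ).re) * (u : ℂ).re / 3))])
    (fun t u v => !₂[-((v : ℂ).im * (u : ℂ).re), -((v : ℂ).im * (u : ℂ).im) + t * (v : ℂ).re,
      (v : ℂ).re + t * ((v : ℂ).im * (u : ℂ).im / 3)]) where
  smooth := by
    simp only [shearTorus, Circle.exp_re, Circle.exp_im]
    refine ContDiff.vec3 ?_ ?_ ?_ <;> fun_prop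
  hasDerivAt := by
    intro t a b a' b' τ ha hb
    simp only [shearTorus, Circle.exp_re, Circle.exp_im]
    have h1 := (((hb.cos.const_add 2).mul ha.cos).sub_const (2 * t)).vec3
      (((hb.cos.const_add 2).mul ha.sin).add (hb.sin.const_mul t))
      (hb.sin.sub ((((hb.cos.const_add 2).mul ha.sin).div_const 3).const_mul t))
    refine h1.congr_deriv ?_
    ext k
    fin_cases k <;> simp <;> ring

/-- The torus is moved by affine maps whose linear part has determinant `1 + t² / 3`, so one can
solve for the original coordinates and read off the two angles. -/
theorem shearTorus_inj {t : ℝ} {u v u' v' : Circle} (h : shearTorus t u v = shearTorus t u' v') :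
    u = u' ∧ v = v' := by
  obtain ⟨h1, h2, h3⟩ := vec3_inj.1 h
  have ht : 1 + t ^ 2 / 3 ≠ 0 := by positivity
  have h4 : (v : ℂ).im = (v' : ℂ).im := by
    apply mul_left_cancel₀ ht
    linear_combination h3 + t / 3 * h2
  have h5 : (2 + (v : ℂ).re) * (u : ℂ).im = (2 + (v' : ℂ).re) * (u' : ℂ).im := by
    linear_combination h2 - t * h4
  have h6 : (2 + (v : ℂ).re) * (u : ℂ).re = (2 + (v' : ℂ).re) * (u' : ℂ).re := by
    linear_combination h1
  have hpos : ∀ w : Circle, 0 < 2 + (w : ℂ).re := by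
    intro w
    nlinarith [Circle.re_sq_add_im_sq w, sq_nonneg ((w : ℂ).im)]
  obtain ⟨h7, h8, h9⟩ := polar_inj (hpos v) (hpos v') (Circle.re_sq_add_im_sq u)
    (Circle.re_sq_add_im_sq u') h6 h5
  exact ⟨Circle.ext_re_im h8 h9, Circle.ext_re_im (by linarith) h4⟩

theorem shearTorus_immersion {t x y : ℝ} {u v : Circle}
    (h : x • (!₂[-((2 + (v : ℂ).re) * (u : ℂ).im), (2 + (v : ℂ).re) * (u : ℂ).re,
      -(t * ((2 + (v : ℂ).re) * (u : ℂ).re / 3))] : E3) +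
      y • (!₂[-((v : ℂ).im * (u : ℂ).re), -((v : ℂ).im * (u : ℂ).im) + t * (v : ℂ).re,
      (v : ℂ).re + t * ((v : ℂ).im * (u : ℂ).im / 3)] : E3) = 0) : x = 0 ∧ y = 0 := by
  have h1 := congrArg (fun P : E3 => P 0) h
  have h2 := congrArg (fun P : E3 => P 1) h
  have h3 := congrArg (fun P : E3 => P 2) h
  simp at h1 h2 h3
  have hu := Circle.re_sq_add_im_sq u
  have hv := Circle.re_sq_add_im_sq v
  have hpos : 0 < 2 + (v : ℂ).re := by nlinarith [sq_nonneg ((v : ℂ).im)]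
  set c := (u : ℂ).re
  set s := (u : ℂ).im
  set c' := (v : ℂ).re
  set s' := (v : ℂ).im
  have ht : 1 + t ^ 2 / 3 ≠ 0 := by positivity
  have h4 : y * c' = 0 := by
    apply mul_left_cancel₀ ht
    linear_combination h3 + t / 3 * h2
  have h5 : x * (2 + c') * c - y * s' * s = 0 := by linear_combination h2 - t * h4
  have hx : x = 0 := by
    apply mul_left_cancel₀ hpos.ne'
    linear_combination c * h5 - s * h1 - x * (2 + c') * hu
  refine ⟨hx, ?_⟩
  rw [hx] at h1 h5
  have h6 : y * s' = 0 := by linear_combination -c * h1 - s * h5 - y * s' * hu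
  linear_combination s' * h6 + c' * h4 - y * hv

theorem Circle.exp_two_pi_zpow (x : ℝ) (m : ℤ) :
    (Circle.exp (2 * Real.pi * x)) ^ m = Circle.exp (2 * Real.pi * (m * x)) := by
  refine Circle.ext ?_
  rw [Circle.coe_zpow, Circle.coe_exp, Circle.coe_exp, ← Complex.exp_int_mul]
  congr 1
  push_cast
  ring

theorem Circle.exists_exp_two_pi (u : Circle) :
    ∃ x ∈ Ico (0 : ℝ) 1, Circle.exp (2 * Real.pi * x) = u := by
  refine ⟨Int.fract (Complex.arg u / (2 * Real.pi)), ⟨Int.fract_nonneg _, Int.fract_lt_one _⟩, ?_⟩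
  rw [← Circle.exp_two_pi_add_int _ ⌊Complex.arg u / (2 * Real.pi)⌋, Int.fract_add_floor,
    mul_div_cancel₀ _ (by positivity)]
  exact Circle.exp_arg u

/-- The strand `i` has first angle `(i + pτ) / (p + q)` and second angle `(qτ - i) / (p + q)`, in
full turns. These are the segments into which the curve where the sum of the angles vanishes cuts
the link. -/
theorem torusLink_eq_strandLink (p q : ℕ) (hp : 1 ≤ p) :
    torusLink p q = strandLink fun i τ => diagPoint (shearTorus 0) (straightDiff p q i τ) τ := by
  have hn : (0 : ℝ) < p + q := by positivity
  have hsh : ∀ u v, shearTorus 0 u v = torusPoint u v := by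
    intro u v; simp [shearTorus, torusPoint]
  have hA : ∀ (i : Fin (p + q)) (τ : ℝ), (τ + straightDiff p q i τ) / 2 = (i + p * τ) / (p + q) := by
    intro i τ; rw [straightDiff]; field_simp; ring
  have hB : ∀ (i : Fin (p + q)) (τ : ℝ), (τ - straightDiff p q i τ) / 2 = (q * τ - i) / (p + q) := by
    intro i τ; rw [straightDiff]; field_simp; ring
  ext P
  rw [mem_strandLink]
  simp only [diagPoint, hsh, hA, hB]
  constructor
  · rintro ⟨u, v, huv, rfl⟩
    obtain ⟨θ, -, rfl⟩ := Circle.exists_exp_two_pi u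
    obtain ⟨φ, -, rfl⟩ := Circle.exists_exp_two_pi v
    rw [Circle.exp_two_pi_zpow, Circle.exp_two_pi_zpow] at huv
    obtain ⟨k, hk⟩ := Circle.exp_two_pi_inj huv
    push_cast at hk
    -- move the pair of angles into a fundamental domain
    set m : ℤ := ⌊θ + φ⌋ with hm
    set k' : ℤ := k - q * m with hk'
    have hnz : ((p : ℤ) + q) ≠ 0 := by positivity
    -- Subtracting `m` from the first angle brings the sum into `[0, 1)` and changes `k` to `k'`.
    -- Opposite full turns in the two angles keep the sum and change `k'` by a multiple of `p + q`,
    -- so the residue of `k'` is the number of the strand.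
    set r : ℤ := k' % (p + q) with hr
    set l : ℤ := k' / (p + q) with hl
    have hrl : r + (p + q) * l = k' := Int.emod_add_mul_ediv k' (p + q)
    have hr0 : 0 ≤ r := Int.emod_nonneg _ hnz
    have hr1 : r < p + q := Int.emod_lt_of_pos _ (by positivity)
    have hrl' : (r : ℝ) + (p + q) * l = k - q * m := by
      have := congrArg (Int.cast : ℤ → ℝ) (hrl.trans hk')
      push_cast at this
      exact this
    have hrN : ((r.toNat : ℕ) : ℝ) = r := by
      have : ((r.toNat : ℕ) : ℤ) = r := Int.toNat_of_nonneg hr0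
      exact_mod_cast this
    refine ⟨⟨r.toNat, by omega⟩, θ + φ - m, ⟨?_, ?_⟩, ?_⟩
    · linarith [Int.floor_le (θ + φ)]
    · linarith [Int.lt_floor_add_one (θ + φ)]
    · simp only [hrN]
      have h1 : (r + p * (θ + φ - m)) / ((p : ℝ) + q) = θ + ((-m - l : ℤ) : ℝ) := by
        rw [div_eq_iff hn.ne']
        push_cast
        linear_combination hrl' - hk
      have h2 : (q * (θ + φ - m) - r) / ((p : ℝ) + q) = φ + ((l : ℤ) : ℝ) := by
        rw [div_eq_iff hn.ne']
        linear_combination hk - hrl'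
      rw [h1, h2, Circle.exp_two_pi_add_int, Circle.exp_two_pi_add_int]
  · rintro ⟨i, τ, hτ, rfl⟩
    refine ⟨_, _, ?_, rfl⟩
    rw [Circle.exp_two_pi_zpow, Circle.exp_two_pi_zpow]
    have := Circle.exp_two_pi_add_int ((p : ℤ) * ((q * τ - i) / ((p : ℝ) + q))) i
    rw [← this]
    congr 2
    push_cast
    field_simp
    ring

/-- The differences of angles are interpolated linearly, which respects the order of the strands,
while the torus itself is sheared. No intermediate shape of the torus matters beyond its being
embedded. -/
theorem torusLink_thin {p q : ℕ} (hp : 1 ≤ p) {ε : ℝ} (hε : 0 < ε) (hεn : ε * (p + q) ≤ 1) :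
    SameOrientedLinkType (torusLink p q)
      (strandLink fun i τ => diagPoint (shearTorus 1) (thinDiff p q ε i τ) τ) := by
  rw [torusLink_eq_strandLink p q hp]
  have hε1 : ε ≤ 1 := by
    have : (1 : ℝ) ≤ p := by exact_mod_cast hp
    nlinarith [(Nat.cast_nonneg q : (0 : ℝ) ≤ q)]
  have h := shearTorus_family.isotopy (p := p) (q := q)
    (fun t i τ => (1 - t) * straightDiff p q i τ + t * thinDiff p q ε i τ) (fun i => ?_)
    (fun t i τ hτ => ?_) (fun t ht τ hτ i j hij => ?_) (fun t ht i τ hτ x y h => ?_)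
    (fun t ht i j τ hτ τ' hτ' h => ?_)
  · simpa using h
  · have h1 : ContDiff ℝ ∞ fun z : ℝ × ℝ => thinDiff p q ε i z.2 :=
      (contDiff_thinDiff p q ε i).comp contDiff_snd
    have h2 : ContDiff ℝ ∞ fun z : ℝ × ℝ => straightDiff p q i z.2 :=
      ((contDiff_const.add (contDiff_const.mul contDiff_snd)).div_const _)
    exact ((contDiff_const.sub contDiff_fst).mul h2).add (contDiff_fst.mul h1)
  · rw [straightDiff_glue hp, thinDiff_glue hε hε1 i hτ]
    ring
  · obtain ⟨h1, h2⟩ := straightDiff_order hij τ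
    obtain ⟨h3, h4⟩ := thinStep_order hε hεn hij ⟨hτ.1, hτ.2.le⟩
    rw [thinDiff_eq hε i hτ.1, thinDiff_eq hε j hτ.1]
    rcases ht.1.eq_or_lt with rfl | h0
    · constructor <;> linarith
    · have e1 := mul_lt_mul_of_pos_left h3 h0
      have e2 := mul_lt_mul_of_pos_left h4 h0
      have e3 := mul_le_mul_of_nonneg_left h1.le (sub_nonneg.2 ht.2)
      have e4 := mul_le_mul_of_nonneg_left h2.le (sub_nonneg.2 ht.2)
      constructor <;> linarith
  · exact shearTorus_immersion h
  · exact shearTorus_inj h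

/-! ### From the sheared torus to a surface over a circle -/

/-- The linear homotopy from the sheared torus (`t = 0`) to a map with cylindrical coordinates
`r = 3 - 2 cos a`, angle `a + b` and `h = sin b + (sin b cos b) / 2 - sin a` (`t = 1`). -/
noncomputable def unrollTorus (t : ℝ) (u v : Circle) : E3 :=
  !₂[(1 - t) * ((2 + (v : ℂ).re) * (u : ℂ).re - 2) +
      t * ((3 - 2 * (u : ℂ).re) * ((u : ℂ).re * (v : ℂ).re - (u : ℂ).im * (v : ℂ).im)),
    (1 - t) * ((2 + (v : ℂ).re) * (u : ℂ).im + (v : ℂ).im) +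
      t * ((3 - 2 * (u : ℂ).re) * ((u : ℂ).re * (v : ℂ).im + (u : ℂ).im * (v : ℂ).re)),
    (1 - t) * ((v : ℂ).im - (2 + (v : ℂ).re) * (u : ℂ).im / 3) +
      t * ((v : ℂ).im + (v : ℂ).im * (v : ℂ).re / 2 - (u : ℂ).im)]

/-- The derivative of `unrollTorus` in the first angle. -/
noncomputable def unrollTorusFst (t : ℝ) (u v : Circle) : E3 :=
  !₂[(1 - t) * -((2 + (v : ℂ).re) * (u : ℂ).im) +
      t * (2 * (u : ℂ).im * ((u : ℂ).re * (v : ℂ).re - (u : ℂ).im * (v : ℂ).im) -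
        (3 - 2 * (u : ℂ).re) * ((u : ℂ).im * (v : ℂ).re + (u : ℂ).re * (v : ℂ).im)),
    (1 - t) * ((2 + (v : ℂ).re) * (u : ℂ).re) +
      t * (2 * (u : ℂ).im * ((u : ℂ).re * (v : ℂ).im + (u : ℂ).im * (v : ℂ).re) +
        (3 - 2 * (u : ℂ).re) * ((u : ℂ).re * (v : ℂ).re - (u : ℂ).im * (v : ℂ).im)),
    (1 - t) * -((2 + (v : ℂ).re) * (u : ℂ).re / 3) - t * (u : ℂ).re]

/-- The derivative of `unrollTorus` in the second angle. -/
noncomputable def unrollTorusSnd (t : ℝ) (u v : Circle) : E3 :=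
  !₂[(1 - t) * -((v : ℂ).im * (u : ℂ).re) -
      t * ((3 - 2 * (u : ℂ).re) * ((u : ℂ).re * (v : ℂ).im + (u : ℂ).im * (v : ℂ).re)),
    (1 - t) * (-((v : ℂ).im * (u : ℂ).im) + (v : ℂ).re) +
      t * ((3 - 2 * (u : ℂ).re) * ((u : ℂ).re * (v : ℂ).re - (u : ℂ).im * (v : ℂ).im)),
    (1 - t) * ((v : ℂ).re + (v : ℂ).im * (u : ℂ).im / 3) +
      t * ((v : ℂ).re + ((v : ℂ).re ^ 2 - (v : ℂ).im ^ 2) / 2)]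

theorem unrollTorus_family : TorusFamily unrollTorus unrollTorusFst unrollTorusSnd where
  smooth := by
    simp only [unrollTorus, Circle.exp_re, Circle.exp_im]
    refine ContDiff.vec3 ?_ ?_ ?_ <;> fun_prop
  hasDerivAt := by
    intro t a b a' b' τ ha hb
    simp only [unrollTorus, unrollTorusFst, unrollTorusSnd, Circle.exp_re, Circle.exp_im]
    have hr := (ha.cos.const_mul 2).const_sub 3
    have h1 := HasDerivAt.vec3
      (((((hb.cos.const_add 2).mul ha.cos).sub_const 2).const_mul (1 - t)).add
        ((hr.mul ((ha.cos.mul hb.cos).sub (ha.sin.mul hb.sin))).const_mul t))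
      (((((hb.cos.const_add 2).mul ha.sin).add hb.sin).const_mul (1 - t)).add
        ((hr.mul ((ha.cos.mul hb.sin).add (ha.sin.mul hb.cos))).const_mul t))
      (((hb.sin.sub (((hb.cos.const_add 2).mul ha.sin).div_const 3)).const_mul (1 - t)).add
        (((hb.sin.add ((hb.sin.mul hb.cos).div_const 2)).sub ha.sin).const_mul t))
    refine h1.congr_deriv ?_
    ext k
    fin_cases k <;> simp <;> ring

theorem unrollTorus_zero (u v : Circle) : unrollTorus 0 u v = shearTorus 1 u v := by
  simp only [unrollTorus, shearTorus, vec3_inj]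
  refine ⟨?_, ?_, ?_⟩ <;> ring

/-- Along the longitude the third coordinate is minus the sine of the angle at all times; this is
what the factor 1/3 in the shear is for. Points with equal sine and opposite cosine are separated by
the first coordinate, with difference `6c`. -/
theorem unrollTorus_inj_of_left {t : ℝ} {u u' : Circle}
    (h : unrollTorus t u 1 = unrollTorus t u' 1) : u = u' := by
  obtain ⟨h1, -, h3⟩ := vec3_inj.1 h
  simp at h1 h3
  have hu := Circle.re_sq_add_im_sq u
  have hu' := Circle.re_sq_add_im_sq u'
  set c := (u : ℂ).re
  set c' := (u' : ℂ).re
  have hs : (u : ℂ).im = (u' : ℂ).im := by linear_combination -h3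
  have hc : (c - c') * (c + c') = 0 := by
    rw [hs] at hu; linear_combination hu - hu'
  refine Circle.ext_re_im ?_ hs
  rcases mul_eq_zero.1 hc with h | h
  · linarith
  · have h4 : c' = -c := by linarith
    rw [h4] at h1
    have : c = 0 := by linear_combination h1 / 6
    change c = c'
    rw [h4, this, neg_zero]

/-- The meridian always projects to the unit circle. The projection of the longitude has squared
distance `(3 - 2c)² + 4(1 - t)² s²` from the axis, which equals 1 only at the common point. -/
theorem unrollTorus_cross {t : ℝ} {u v : Circle}
    (h : unrollTorus t u 1 = unrollTorus t 1 v) : u = 1 := by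
  obtain ⟨h1, h2, -⟩ := vec3_inj.1 h
  simp at h1 h2
  have hu := Circle.re_sq_add_im_sq u
  have hv := Circle.re_sq_add_im_sq v
  set c := (u : ℂ).re
  set s := (u : ℂ).im
  set c' := (v : ℂ).re
  set s' := (v : ℂ).im
  have hx : (3 - 2 * c) * c - 2 * (1 - t) * s ^ 2 = c' := by
    linear_combination h1 - 2 * (1 - t) * hu
  have hy : (3 - 2 * c) * s + 2 * (1 - t) * (s * c) = s' := by linear_combination h2
  have key : (3 - 2 * c) ^ 2 + 4 * (1 - t) ^ 2 * s ^ 2 = 1 := by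
    linear_combination hv + ((3 - 2 * c) * c - 2 * (1 - t) * s ^ 2 + c') * hx +
      ((3 - 2 * c) * s + 2 * (1 - t) * (s * c) + s') * hy -
      ((3 - 2 * c) ^ 2 + 4 * (1 - t) ^ 2 * s ^ 2) * hu
  have hc : c = 1 := by nlinarith [sq_nonneg s, sq_nonneg ((1 - t) * s)]
  have hs : s = 0 := by
    have : s ^ 2 = 0 := by rw [hc] at hu; linarith
    exact pow_eq_zero_iff (two_ne_zero) |>.1 this
  exact Circle.ext_re_im (by simpa using hc) (by simpa using hs)

/-- Along the meridian the first two coordinates are those of the point of the circle, at all times: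
translation and shear were chosen for this. -/
theorem unrollTorus_inj_of_right {t : ℝ} {v v' : Circle}
    (h : unrollTorus t 1 v = unrollTorus t 1 v') : v = v' := by
  obtain ⟨h1, h2, -⟩ := vec3_inj.1 h
  simp at h1 h2
  exact Circle.ext_re_im (by linear_combination h1) (by linear_combination h2)

/-- The first two coordinates force `y = -t x` unless the meridian angle has sine 0, and then `t =
1` or `x = 0`. At `t = 1` the third coordinate is decisive: owing to the term `(sin b cos b) / 2`
the factor of `x` is `(c + 1/2)² + 1/4`, where it would be `1 + c` otherwise. The two points with
sine 0 are checked directly. -/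
theorem unrollTorus_immersion_left {t x y : ℝ} (ht : t ∈ Icc (0 : ℝ) 1) {v : Circle}
    (h : x • unrollTorusFst t 1 v + y • unrollTorusSnd t 1 v = 0) : x = 0 ∧ y = 0 := by
  have h1 := congrArg (fun P : E3 => P 0) h
  have h2 := congrArg (fun P : E3 => P 1) h
  have h3 := congrArg (fun P : E3 => P 2) h
  simp [unrollTorusFst, unrollTorusSnd] at h1 h2 h3
  have hv := Circle.re_sq_add_im_sq v
  obtain ⟨t0, t1⟩ := ht
  set c := (v : ℂ).re
  set s := (v : ℂ).im
  have hc : 0 < 2 + c := by nlinarith [sq_nonneg s]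
  have e1 : s * (t * x + y) = 0 := by linear_combination -h1
  have e2 : x * ((1 - t) * (2 + c)) + c * (t * x + y) = 0 := by linear_combination h2
  have e3 : x * (-((1 - t) * (2 + c) / 3) - t) + y * (c + t * (c ^ 2 - s ^ 2) / 2) = 0 := by
    linear_combination h3
  rcases eq_or_ne s 0 with hs | hs
  · have hcc : (c - 1) * (c + 1) = 0 := by rw [hs] at hv; linear_combination hv
    rw [hs] at e3
    rcases mul_eq_zero.1 hcc with hc1 | hc1
    · have hc1 : c = 1 := by linarith
      rw [hc1] at e2 e3
      have hy : y = -(x * (3 - 2 * t)) := by linear_combination e2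
      rw [hy] at e3
      have hx : x * (1 + (3 - 2 * t) * (1 + t / 2)) = 0 := by linear_combination -e3
      have hpos : 0 < 1 + (3 - 2 * t) * (1 + t / 2) := by nlinarith
      have hx0 : x = 0 := (mul_eq_zero.1 hx).resolve_right hpos.ne'
      exact ⟨hx0, by rw [hy, hx0]; ring⟩
    · have hc1 : c = -1 := by linarith
      rw [hc1] at e2 e3
      have hy : y = x * (1 - 2 * t) := by linear_combination -e2
      rw [hy] at e3
      have hx : x * (t ^ 2 - 11 / 6 * t + 4 / 3) = 0 := by linear_combination -e3
      have hpos : 0 < t ^ 2 - 11 / 6 * t + 4 / 3 := by nlinarith [sq_nonneg (t - 11 / 12)]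
      have hx0 : x = 0 := (mul_eq_zero.1 hx).resolve_right hpos.ne'
      exact ⟨hx0, by rw [hy, hx0]; ring⟩
  · have e4 : t * x + y = 0 := (mul_eq_zero.1 e1).resolve_left hs
    have e5 : x * (1 - t) = 0 := by
      rw [e4] at e2
      have : x * (1 - t) * (2 + c) = 0 := by linear_combination e2
      exact (mul_eq_zero.1 this).resolve_right hc.ne'
    rcases mul_eq_zero.1 e5 with hx | ht1
    · exact ⟨hx, by rw [hx] at e4; linarith⟩
    · have ht1 : t = 1 := by linarith
      rw [ht1] at e3 e4
      have hy : y = -x := by linarith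
      rw [hy] at e3
      have hx : x * ((c + 1 / 2) ^ 2 + 1 / 4) = 0 := by linear_combination -e3 + x / 2 * hv
      have hx0 : x = 0 := (mul_eq_zero.1 hx).resolve_right (by positivity)
      exact ⟨hx0, by rw [hy, hx0]; ring⟩

/-- Combining the first two rows with weights `-s` and `c` gives the component orthogonal to the
direction of `u`; together with the third row this is a 2 by 2 system in `x` and `y` whose
determinant is positive. -/
theorem unrollTorus_immersion_right {t x y : ℝ} (ht : t ∈ Icc (0 : ℝ) 1) {u : Circle}
    (h : x • unrollTorusFst t u 1 + y • unrollTorusSnd t u 1 = 0) : x = 0 ∧ y = 0 := by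
  have h1 := congrArg (fun P : E3 => P 0) h
  have h2 := congrArg (fun P : E3 => P 1) h
  have h3 := congrArg (fun P : E3 => P 2) h
  simp [unrollTorusFst, unrollTorusSnd] at h1 h2 h3
  have hu := Circle.re_sq_add_im_sq u
  obtain ⟨t0, t1⟩ := ht
  set c := (u : ℂ).re
  set s := (u : ℂ).im
  have hc1 : c ≤ 1 := by nlinarith [sq_nonneg s]
  have hc2 : -1 ≤ c := by nlinarith [sq_nonneg s]
  have e3 : y * (1 + t / 2) = x * c := by linear_combination h3
  have e4 : x * (3 - 2 * t * c) + y * ((1 - t) * c + t * (3 - 2 * c)) = 0 := by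
    linear_combination -s * h1 + c * h2 -
      (x * (3 * (1 - t) + t * (3 - 2 * c)) + y * t * (3 - 2 * c)) * hu
  have e5 : x * ((1 + t / 2) * (3 - 2 * t * c) + c * ((1 - t) * c + t * (3 - 2 * c))) = 0 := by
    linear_combination (1 + t / 2) * e4 - ((1 - t) * c + t * (3 - 2 * c)) * e3
  have hpos : 0 < (1 + t / 2) * (3 - 2 * t * c) + c * ((1 - t) * c + t * (3 - 2 * c)) := by
    have e6 : 0 ≤ t * (1 - t) * (1 + c) :=
      mul_nonneg (mul_nonneg t0 (by linarith)) (by linarith)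
    have e7 : t * c ^ 2 ≤ t := by nlinarith
    nlinarith [sq_nonneg c]
  have hx0 : x = 0 := (mul_eq_zero.1 e5).resolve_right hpos.ne'
  refine ⟨hx0, ?_⟩
  rw [hx0, zero_mul] at e3
  exact (mul_eq_zero.1 e3).resolve_right (by positivity)

/-! ### Thin strands on a moving torus -/

/-- Composing with a linear left inverse of the derivative gives a map with derivative the identity,
to which the inverse function theorem applies. -/
theorem HasStrictFDerivAt.exists_injOn_of_injective {E F : Type*} [NormedAddCommGroup E]
    [NormedSpace ℝ E] [FiniteDimensional ℝ E] [NormedAddCommGroup F] [NormedSpace ℝ F]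
    [FiniteDimensional ℝ F] {f : E → F} {f' : E →L[ℝ] F} {x : E} (hf : HasStrictFDerivAt f f' x)
    (hinj : Function.Injective f') : ∃ U ∈ nhds x, InjOn f U := by
  obtain ⟨g, hg⟩ := LinearMap.exists_leftInverse_of_injective (f' : E →ₗ[ℝ] F)
    (LinearMap.ker_eq_bot.2 hinj)
  have h1 : HasStrictFDerivAt (fun y => LinearMap.toContinuousLinearMap g (f y))
      ((ContinuousLinearEquiv.refl ℝ E : E ≃L[ℝ] E) : E →L[ℝ] E) x := by
    have h2 := (LinearMap.toContinuousLinearMap g).hasStrictFDerivAt.comp x hf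
    convert h2 using 1
    ext y
    exact (LinearMap.congr_fun hg y).symm
  refine ⟨(h1.toOpenPartialHomeomorph _).source,
    (h1.toOpenPartialHomeomorph _).open_source.mem_nhds h1.mem_toOpenPartialHomeomorph_source,
    fun y hy z hz hyz => (h1.toOpenPartialHomeomorph _).injOn hy hz ?_⟩
  simp [hyz]

/-- The universal cover of `ℝ × torus`. -/
noncomputable def torusCover (z : ℝ × ℝ × ℝ) : ℝ × Circle × Circle :=
  (z.1, Circle.exp z.2.1, Circle.exp z.2.2)

theorem isOpenMap_torusCover : IsOpenMap torusCover :=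
  IsOpenMap.id.prodMap
    (isLocalHomeomorph_circleExp.isOpenMap.prodMap isLocalHomeomorph_circleExp.isOpenMap)

theorem torusCover_surjective : Function.Surjective torusCover := by
  rintro ⟨t, u, v⟩
  exact ⟨(t, Complex.arg u, Complex.arg v), by simp [torusCover, Circle.exp_arg]⟩

namespace TorusFamily

variable {Ψ Pa Pb : ℝ → Circle → Circle → E3}

theorem hasStrictFDerivAt (hΨ : TorusFamily Ψ Pa Pb) (x : ℝ × ℝ × ℝ) :
    HasStrictFDerivAt (fun z : ℝ × ℝ × ℝ => (z.1, Ψ z.1 (Circle.exp z.2.1) (Circle.exp z.2.2)))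
      ((ContinuousLinearMap.fst ℝ ℝ (ℝ × ℝ)).prod
        (fderiv ℝ (fun z : ℝ × ℝ × ℝ => Ψ z.1 (Circle.exp z.2.1) (Circle.exp z.2.2)) x)) x :=
  hasStrictFDerivAt_fst.prodMk (hΨ.smooth.contDiffAt.hasStrictFDerivAt (by simp))

theorem fderiv_apply (hΨ : TorusFamily Ψ Pa Pb) (z : ℝ × ℝ × ℝ) (x y : ℝ) :
    fderiv ℝ (fun z : ℝ × ℝ × ℝ => Ψ z.1 (Circle.exp z.2.1) (Circle.exp z.2.2)) z (0, x, y) =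
      x • Pa z.1 (Circle.exp z.2.1) (Circle.exp z.2.2) +
        y • Pb z.1 (Circle.exp z.2.1) (Circle.exp z.2.2) := by
  have h1 : HasDerivAt (fun s : ℝ => z + s • ((0, x, y) : ℝ × ℝ × ℝ)) (0, x, y) 0 := by
    simpa using ((hasDerivAt_id (0 : ℝ)).smul_const ((0, x, y) : ℝ × ℝ × ℝ)).const_add z
  have h2 : HasFDerivAt (fun z : ℝ × ℝ × ℝ => Ψ z.1 (Circle.exp z.2.1) (Circle.exp z.2.2))
      (fderiv ℝ (fun z : ℝ × ℝ × ℝ => Ψ z.1 (Circle.exp z.2.1) (Circle.exp z.2.2)) z)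
      (z + (0 : ℝ) • ((0, x, y) : ℝ × ℝ × ℝ)) := by
    rw [zero_smul, add_zero]
    exact (hΨ.smooth.differentiable (by simp) z).hasFDerivAt
  have h3 := h2.comp_hasDerivAt (0 : ℝ) h1
  have h4 : HasDerivAt (fun s : ℝ => z.2.1 + s * x) x 0 := by
    simpa using ((hasDerivAt_id (0 : ℝ)).mul_const x).const_add z.2.1
  have h5 : HasDerivAt (fun s : ℝ => z.2.2 + s * y) y 0 := by
    simpa using ((hasDerivAt_id (0 : ℝ)).mul_const y).const_add z.2.2
  have h6 := hΨ.hasDerivAt z.1 _ _ _ _ 0 h4 h5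
  simp only [zero_mul, add_zero] at h6
  refine h3.unique ?_
  simpa [Function.comp_def] using h6

/-- Smoothness is known only in terms of angles; continuity descends because the covering is open
and surjective. -/
theorem continuousAt (hΨ : TorusFamily Ψ Pa Pb) (z : ℝ × Circle × Circle) :
    ContinuousAt (fun z : ℝ × Circle × Circle => (z.1, Ψ z.1 z.2.1 z.2.2)) z := by
  obtain ⟨x, rfl⟩ := torusCover_surjective z
  refine Filter.Tendsto.mono_left ?_ (isOpenMap_torusCover.nhds_le x)
  rw [Filter.tendsto_map'_iff]
  exact (continuous_fst.prodMk hΨ.smooth.continuous).continuousAt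

theorem injective_prod_fderiv_iff (hΨ : TorusFamily Ψ Pa Pb) (z : ℝ × ℝ × ℝ) :
    Function.Injective ((ContinuousLinearMap.fst ℝ ℝ (ℝ × ℝ)).prod
        (fderiv ℝ (fun z : ℝ × ℝ × ℝ => Ψ z.1 (Circle.exp z.2.1) (Circle.exp z.2.2)) z)) ↔
      ∀ x y : ℝ, x • Pa z.1 (Circle.exp z.2.1) (Circle.exp z.2.2) +
        y • Pb z.1 (Circle.exp z.2.1) (Circle.exp z.2.2) = 0 → x = 0 ∧ y = 0 := by
  rw [injective_iff_map_eq_zero]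
  constructor
  · intro h x y hxy
    have h1 := h (0, x, y) (by
      rw [ContinuousLinearMap.prod_apply, hΨ.fderiv_apply, hxy]; simp)
    simpa using h1
  · rintro h ⟨w, x, y⟩ hw
    rw [ContinuousLinearMap.prod_apply, Prod.mk_eq_zero] at hw
    obtain ⟨h1, h2⟩ := hw
    have h1 : w = 0 := h1
    subst h1
    rw [hΨ.fderiv_apply] at h2
    obtain ⟨rfl, rfl⟩ := h x y h2
    rfl

/-- If a family of maps from the torus is injective and immersive on a compact set, then it is so
in a neighbourhood. -/
theorem exists_thickening (hΨ : TorusFamily Ψ Pa Pb) {s : Set (ℝ × Circle × Circle)}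
    (hs : IsCompact s)
    (hinj : InjOn (fun z : ℝ × Circle × Circle => (z.1, Ψ z.1 z.2.1 z.2.2)) s)
    (himm : ∀ z ∈ s, ∀ x y : ℝ, x • Pa z.1 z.2.1 z.2.2 + y • Pb z.1 z.2.1 z.2.2 = 0 →
      x = 0 ∧ y = 0) :
    ∃ δ > 0, InjOn (fun z : ℝ × Circle × Circle => (z.1, Ψ z.1 z.2.1 z.2.2))
        (Metric.thickening δ s) ∧
      ∀ z ∈ Metric.thickening δ s, ∀ x y : ℝ,
        x • Pa z.1 z.2.1 z.2.2 + y • Pb z.1 z.2.1 z.2.2 = 0 → x = 0 ∧ y = 0 := by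
  -- A continuous map that is injective on a compact set and locally injective at its points is
  -- injective near it. Time is kept as a coordinate, so one neighbourhood serves all times.
  obtain ⟨N, hN, hNinj⟩ := hinj.exists_mem_nhdsSet hs (fun z _ => hΨ.continuousAt z) (by
    intro z hz
    obtain ⟨x, rfl⟩ := torusCover_surjective z
    obtain ⟨U, hU, hUinj⟩ := (hΨ.hasStrictFDerivAt x).exists_injOn_of_injective
      ((hΨ.injective_prod_fderiv_iff x).2 (himm _ hz))
    refine ⟨torusCover '' U, isOpenMap_torusCover.image_mem_nhds hU, ?_⟩
    rintro _ ⟨y, hy, rfl⟩ _ ⟨y', hy', rfl⟩ h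
    rw [hUinj hy hy' h])
  -- Immersivity is injectivity of the derivative, an open condition; it is stated on the cover and
  -- pushed down.
  set O : Set (ℝ × ℝ × ℝ) := {z | Function.Injective ((ContinuousLinearMap.fst ℝ ℝ (ℝ × ℝ)).prod
        (fderiv ℝ (fun z : ℝ × ℝ × ℝ => Ψ z.1 (Circle.exp z.2.1) (Circle.exp z.2.2)) z))} with hOdef
  have hO : IsOpen O := by
    refine ContinuousLinearMap.isOpen_injective.preimage (f := fun z =>
      (ContinuousLinearMap.fst ℝ ℝ (ℝ × ℝ)).prod
        (fderiv ℝ (fun z : ℝ × ℝ × ℝ => Ψ z.1 (Circle.exp z.2.1) (Circle.exp z.2.2)) z)) ?_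
    have h1 := hΨ.smooth.continuous_fderiv (by simp)
    exact (ContinuousLinearMap.prodₗᵢ ℝ (𝕜 := ℝ) (E := ℝ × ℝ × ℝ) (F := ℝ)
      (G := E3)).continuous.comp (continuous_const.prodMk h1)
  have hsO : s ⊆ torusCover '' O := by
    intro z hz
    obtain ⟨x, rfl⟩ := torusCover_surjective z
    exact ⟨x, (hΨ.injective_prod_fderiv_iff x).2 (himm _ hz), rfl⟩
  obtain ⟨V, hVo, hsV, hVN⟩ := mem_nhdsSet_iff_exists.1 hN
  obtain ⟨δ, hδ, hδV⟩ := hs.exists_thickening_subset_open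
    (hVo.inter (isOpenMap_torusCover O hO)) (subset_inter hsV hsO)
  refine ⟨δ, hδ, hNinj.mono fun z hz => hVN (hδV hz).1, fun z hz => ?_⟩
  obtain ⟨x, hx, rfl⟩ := (hδV hz).2
  exact (hΨ.injective_prod_fderiv_iff x).1 hx

end TorusFamily

/-- `flatStep` follows `τ` up to `ε`, so in `τ + D` for a strand in front, and in `τ - D` for the
others, the unit slopes cancel and only terms of order `ε (p + q)` remain. -/
theorem thinDiff_near {p q : ℕ} {ε τ : ℝ} (hε : 0 < ε) (i : Fin (p + q))
    (hτ : τ ∈ Icc (0 : ℝ) 1) :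
    (i < q → |(τ + thinDiff p q ε i τ) / 2| ≤ ε * (p + q)) ∧
      (¬ i < q → |(τ - thinDiff p q ε i τ) / 2| ≤ ε * (p + q)) := by
  rw [thinDiff_eq hε i hτ.1, thinStep, lorenzSide, lorenzShift]
  obtain ⟨s0, s1⟩ := flatStep_mem (ε := ε) hτ
  have h1 := abs_le.1 (abs_flatStep_sub_le hε hτ)
  have hi : (i : ℝ) + 1 ≤ p + q := by exact_mod_cast i.2
  have hi0 : (0 : ℝ) ≤ i := by positivity
  set s := flatStep ε τ
  have hp : (0 : ℝ) ≤ p := by positivity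
  have hq : (0 : ℝ) ≤ q := by positivity
  have h2 : 0 ≤ p * s := mul_nonneg hp s0
  have h3 : p * s ≤ p := by nlinarith
  have h4 : 0 ≤ q * s := mul_nonneg hq s0
  have h5 : q * s ≤ q := by nlinarith
  constructor <;> intro h <;> simp only [h, if_true, if_false] <;> rw [abs_le]
  · constructor <;> nlinarith
  · constructor <;> nlinarith

/-- The intermediate surfaces need not be embedded tori. It suffices that the family is injective
and immersive along meridian and longitude, hence in a `δ`-neighbourhood, and that for small `ε` all
thin strands lie there. -/
theorem strandLink_unrollTorus (p q : ℕ) : ∃ ε₀ : ℝ, 0 < ε₀ ∧ ∀ ε, 0 < ε → ε ≤ ε₀ →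
    ε * (p + q) ≤ 1 → ε ≤ 1 →
    SameOrientedLinkType
      (strandLink fun (i : Fin (p + q)) τ => diagPoint (unrollTorus 0) (thinDiff p q ε i τ) τ)
      (strandLink fun (i : Fin (p + q)) τ => diagPoint (unrollTorus 1) (thinDiff p q ε i τ) τ) := by
  set s : Set (ℝ × Circle × Circle) :=
    Icc 0 1 ×ˢ (({1} : Set Circle) ×ˢ univ ∪ univ ×ˢ ({1} : Set Circle)) with hs
  have hsc : IsCompact s := isCompact_Icc.prod
    ((isCompact_singleton.prod isCompact_univ).union (isCompact_univ.prod isCompact_singleton))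
  obtain ⟨δ, hδ, hinj, himm⟩ := unrollTorus_family.exists_thickening hsc
    (by
      rintro ⟨t, u, v⟩ ⟨ht, huv⟩ ⟨t', u', v'⟩ ⟨-, huv'⟩ h
      obtain ⟨h1, h2⟩ := Prod.mk.inj h
      dsimp only at h1 h2 huv huv' ht
      subst h1
      simp only [mem_union, mem_prod, mem_singleton_iff, mem_univ, and_true, true_and] at huv huv'
      rcases huv with rfl | rfl <;> rcases huv' with rfl | rfl
      · rw [unrollTorus_inj_of_right h2]
      · have := unrollTorus_cross h2.symm
        subst this
        rw [unrollTorus_inj_of_right h2]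
      · have := unrollTorus_cross h2
        subst this
        rw [unrollTorus_inj_of_right h2]
      · rw [unrollTorus_inj_of_left h2])
    (by
      rintro ⟨t, u, v⟩ ⟨ht, huv⟩ x y h
      simp only [mem_union, mem_prod, mem_singleton_iff, mem_univ, and_true, true_and] at huv
      rcases huv with rfl | rfl
      · exact unrollTorus_immersion_left ht h
      · exact unrollTorus_immersion_right ht h)
  have hcont : Filter.Tendsto (fun x : ℝ => Circle.exp (2 * Real.pi * x)) (nhds 0) (nhds 1) := by
    have : Continuous fun x : ℝ => Circle.exp (2 * Real.pi * x) := by fun_prop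
    simpa using this.tendsto 0
  obtain ⟨η, hη, hηδ⟩ := Metric.eventually_nhds_iff.1 (hcont.eventually (Metric.ball_mem_nhds 1 hδ))
  have hn : (0 : ℝ) ≤ p + q := by positivity
  refine ⟨η / (p + q + 1), by positivity, fun ε hε hεη hεn hε1 => ?_⟩
  have hε2 : ε * (p + q) < η := by
    rw [le_div_iff₀ (by positivity)] at hεη
    nlinarith
  have hmem : ∀ t ∈ Icc (0 : ℝ) 1, ∀ i : Fin (p + q), ∀ τ ∈ Ico (0 : ℝ) 1,
      (t, Circle.exp (2 * Real.pi * ((τ + thinDiff p q ε i τ) / 2)),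
        Circle.exp (2 * Real.pi * ((τ - thinDiff p q ε i τ) / 2))) ∈ Metric.thickening δ s := by
    intro t ht i τ hτ
    rw [Metric.mem_thickening_iff]
    obtain ⟨h1, h2⟩ := thinDiff_near hε i ⟨hτ.1, hτ.2.le⟩
    by_cases hi : (i : ℕ) < q
    · refine ⟨(t, 1, Circle.exp (2 * Real.pi * ((τ - thinDiff p q ε i τ) / 2))),
        ⟨ht, Or.inl ⟨rfl, trivial⟩⟩, ?_⟩
      have := @hηδ ((τ + thinDiff p q ε i τ) / 2) (by
        rw [Real.dist_eq, sub_zero]; exact (h1 hi).trans_lt hε2)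
      simpa [Prod.dist_eq, hδ] using this
    · refine ⟨(t, Circle.exp (2 * Real.pi * ((τ + thinDiff p q ε i τ) / 2)), 1),
        ⟨ht, Or.inr ⟨trivial, rfl⟩⟩, ?_⟩
      have := @hηδ ((τ - thinDiff p q ε i τ) / 2) (by
        rw [Real.dist_eq, sub_zero]; exact (h2 hi).trans_lt hε2)
      simpa [Prod.dist_eq, hδ] using this
  refine unrollTorus_family.isotopy (p := p) (q := q) (fun _ i τ => thinDiff p q ε i τ)
    (fun i => ?_) (fun t i τ hτ => ?_) (fun t ht τ hτ i j hij => ?_) (fun t ht i τ hτ x y h => ?_)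
    (fun t ht i j τ hτ τ' hτ' h => ?_)
  · exact (contDiff_thinDiff p q ε i).comp contDiff_snd
  · exact thinDiff_glue hε hε1 i hτ
  · rw [thinDiff_eq hε i hτ.1, thinDiff_eq hε j hτ.1]
    exact thinStep_order hε hεn hij ⟨hτ.1, hτ.2.le⟩
  · exact himm _ (hmem t ht i τ hτ) x y h
  · have := hinj (hmem t ht i τ hτ) (hmem t ht j τ' hτ') (Prod.ext rfl h)
    simpa using this

/-! ### The Lorenz braid as a closed braid with smooth strands -/

/-- The radius along the `i`-th strand, continued smoothly to the left. -/
noncomputable def braidRadius (p q : ℕ) : Fin (p + q) → ℝ → ℝ :=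
  contLeft (lorenzPerm p q) (lorenzRadius p q)

/-- The height along the `i`-th strand, continued smoothly to the left. -/
noncomputable def braidHeight (p q : ℕ) : Fin (p + q) → ℝ → ℝ :=
  contLeft (lorenzPerm p q) (lorenzHeight p q)

theorem lorenzRadius_of_one_le {p q : ℕ} (i : Fin (p + q)) {τ : ℝ} (hτ : 1 ≤ τ) :
    lorenzRadius p q i τ = lorenzRadius p q i 1 := by
  rw [lorenzRadius, lorenzRadius, Real.smoothTransition.one_of_one_le hτ,
    Real.smoothTransition.one]

theorem lorenzHeight_of_one_le {p q : ℕ} (i : Fin (p + q)) {τ : ℝ} (hτ : 1 ≤ τ) :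
    lorenzHeight p q i τ = lorenzHeight p q i 1 := by
  rw [lorenzHeight, lorenzHeight, Real.smoothTransition.one_of_one_le hτ,
    Real.smoothTransition.one]

theorem lorenzRadius_of_nonpos {p q : ℕ} (i : Fin (p + q)) {τ : ℝ} (hτ : τ ≤ 0) :
    lorenzRadius p q i τ = lorenzRadius p q i 0 := by
  rw [lorenzRadius, lorenzRadius, Real.smoothTransition.zero_of_nonpos hτ,
    Real.smoothTransition.zero]

theorem lorenzHeight_of_nonpos {p q : ℕ} (i : Fin (p + q)) {τ : ℝ} (hτ : τ ≤ 0) :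
    lorenzHeight p q i τ = lorenzHeight p q i 0 := by
  rw [lorenzHeight, lorenzHeight, Real.smoothTransition.zero_of_nonpos hτ,
    Real.smoothTransition.zero]

theorem braidRadius_eq {p q : ℕ} (i : Fin (p + q)) {τ : ℝ} (hτ : 0 ≤ τ) :
    braidRadius p q i τ = lorenzRadius p q i τ :=
  contLeft_eq (f := lorenzRadius p q) (fun j _ h => lorenzRadius_of_one_le j h) i hτ

theorem braidHeight_eq {p q : ℕ} (i : Fin (p + q)) {τ : ℝ} (hτ : 0 ≤ τ) :
    braidHeight p q i τ = lorenzHeight p q i τ :=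
  contLeft_eq (f := lorenzHeight p q) (fun j _ h => lorenzHeight_of_one_le j h) i hτ

theorem braidRadius_glue {p q : ℕ} (i : Fin (p + q)) {τ : ℝ} (hτ : τ ∈ Icc (0 : ℝ) 1) :
    braidRadius p q i τ = braidRadius p q (lorenzPerm p q i) (τ - 1) := by
  rw [braidRadius, contLeft_glue (f := lorenzRadius p q) (fun j _ h => lorenzRadius_of_nonpos j h)
    (fun j _ h => lorenzRadius_of_one_le j h) i hτ, lorenzRadius_one, lorenzRadius,
    Real.smoothTransition.zero]
  ring

theorem braidHeight_glue {p q : ℕ} (i : Fin (p + q)) {τ : ℝ} (hτ : τ ∈ Icc (0 : ℝ) 1) :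
    braidHeight p q i τ = braidHeight p q (lorenzPerm p q i) (τ - 1) := by
  rw [braidHeight, contLeft_glue (f := lorenzHeight p q) (fun j _ h => lorenzHeight_of_nonpos j h)
    (fun j _ h => lorenzHeight_of_one_le j h) i hτ, lorenzHeight_one, lorenzHeight,
    Real.smoothTransition.zero]
  ring

theorem contDiff_braidRadius (p q : ℕ) (i : Fin (p + q)) : ContDiff ℝ ∞ (braidRadius p q i) := by
  have hS : ContDiff ℝ ∞ Real.smoothTransition := Real.smoothTransition.contDiff
  exact ContDiff.contLeft (fun _ => contDiff_const.add (contDiff_const.mul hS)) i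

theorem contDiff_braidHeight (p q : ℕ) (i : Fin (p + q)) : ContDiff ℝ ∞ (braidHeight p q i) := by
  have hS : ContDiff ℝ ∞ Real.smoothTransition := Real.smoothTransition.contDiff
  exact ContDiff.contLeft (fun _ => (contDiff_const.mul hS).mul (contDiff_const.sub hS)) i

theorem lorenzRadius_pos {p q : ℕ} (i : Fin (p + q)) (τ : ℝ) : 0 < lorenzRadius p q i τ := by
  have h0 := Real.smoothTransition.nonneg τ
  have h1 := Real.smoothTransition.le_one τ
  have h2 : (0 : ℝ) ≤ i := by positivity
  have h3 : (0 : ℝ) ≤ p := by positivity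
  rw [lorenzRadius, lorenzShift]
  split_ifs with h
  · positivity
  · push Not at h
    have h4 : (q : ℝ) ≤ i := by exact_mod_cast h
    have h5 : (0 : ℝ) ≤ q := by positivity
    nlinarith

theorem abs_lorenzHeight_le {p q : ℕ} (i : Fin (p + q)) (τ : ℝ) :
    |lorenzHeight p q i τ| ≤ 1 := by
  have h0 := Real.smoothTransition.nonneg τ
  have h1 := Real.smoothTransition.le_one τ
  rw [lorenzHeight, abs_le]
  rcases lorenzSide_cases i with h | h <;> rw [h] <;> constructor <;> nlinarith

/-- Strands of the same kind move in parallel. Strands of different kinds have heights of opposite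
sign, except when the transition has not begun, and then they are in different starting positions.
-/
theorem lorenz_position_inj {p q : ℕ} {i j : Fin (p + q)} {τ : ℝ} (hτ : τ < 1)
    (hr : lorenzRadius p q i τ = lorenzRadius p q j τ)
    (hh : lorenzHeight p q i τ = lorenzHeight p q j τ) : i = j := by
  have h1 := Real.smoothTransition.lt_one_of_lt_one hτ
  rw [lorenzRadius, lorenzRadius, lorenzShift, lorenzShift] at hr
  rw [lorenzHeight, lorenzHeight, lorenzSide, lorenzSide] at hh
  set S := Real.smoothTransition τ
  have hS : S = 0 → i = j := by
    intro h
    rw [h] at hr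
    ext
    have : (i : ℝ) = j := by linarith
    exact_mod_cast this
  by_cases hi : (i : ℕ) < q <;> by_cases hj : (j : ℕ) < q <;>
    simp only [hi, hj, if_true, if_false] at hr hh
  · ext
    have : (i : ℝ) = j := by linarith
    exact_mod_cast this
  · have : S * (1 - S) = 0 := by linarith
    exact hS ((mul_eq_zero.1 this).resolve_right (by linarith))
  · have : S * (1 - S) = 0 := by linarith
    exact hS ((mul_eq_zero.1 this).resolve_right (by linarith))
  · ext
    have : (i : ℝ) = j := by linarith
    exact_mod_cast this

/-- Turning the cross section of a closed braid by a right angle. -/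
theorem closedBraid_quarterTurn (p q : ℕ) :
    SameOrientedLinkType
      (strandLink fun (i : Fin (p + q)) τ =>
        cylPoint (2 + braidHeight p q i τ) τ (-braidRadius p q i τ))
      (strandLink fun (i : Fin (p + q)) τ =>
        cylPoint (braidRadius p q i τ) τ (braidHeight p q i τ)) := by
  have hc : ContDiff ℝ ∞ fun z : ℝ × ℝ => Real.cos ((1 - z.1) * (Real.pi / 2)) := by fun_prop
  have hs : ContDiff ℝ ∞ fun z : ℝ × ℝ => Real.sin ((1 - z.1) * (Real.pi / 2)) := by fun_prop
  have hr : ∀ i, ContDiff ℝ ∞ fun z : ℝ × ℝ => braidRadius p q i z.2 :=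
    fun i => (contDiff_braidRadius p q i).comp contDiff_snd
  have hh : ∀ i, ContDiff ℝ ∞ fun z : ℝ × ℝ => braidHeight p q i z.2 :=
    fun i => (contDiff_braidHeight p q i).comp contDiff_snd
  -- Up to a vertical translation, the vector with coordinates `r` and `2 + h` is rotated through a
  -- right angle. Since `|h| ≤ 1`, both its coordinates are positive, so the distance from the axis
  -- stays positive.
  have := closedBraid_isotopy (lorenzPerm p q)
    (fun t i τ => Real.cos ((1 - t) * (Real.pi / 2)) * braidRadius p q i τ +
      Real.sin ((1 - t) * (Real.pi / 2)) * (2 + braidHeight p q i τ))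
    (fun t i τ => Real.cos ((1 - t) * (Real.pi / 2)) * braidHeight p q i τ -
      Real.sin ((1 - t) * (Real.pi / 2)) * braidRadius p q i τ)
    (fun i => (hc.mul (hr i)).add (hs.mul (contDiff_const.add (hh i))))
    (fun i => (hc.mul (hh i)).sub (hs.mul (hr i)))
    ⟨1, one_pos, le_rfl, fun t _ i τ hτ => ?_⟩ (fun t ht i τ hτ => ?_)
    (fun t ht τ hτ i j h1 h2 => ?_)
  · simpa using this
  · rw [sub_self] at hτ
    rw [braidRadius_glue i hτ, braidHeight_glue i hτ]
    exact ⟨rfl, rfl⟩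
  · rw [braidRadius_eq i hτ.1, braidHeight_eq i hτ.1]
    have hr := lorenzRadius_pos i τ
    have hy := (abs_le.1 (abs_lorenzHeight_le i τ)).1
    have h1 : 0 ≤ (1 - t) * (Real.pi / 2) :=
      mul_nonneg (sub_nonneg.2 ht.2) (by positivity)
    have h2 : (1 - t) * (Real.pi / 2) ≤ Real.pi / 2 :=
      mul_le_of_le_one_left (by positivity) (by linarith [ht.1])
    set θ := (1 - t) * (Real.pi / 2)
    have hc0 : 0 ≤ Real.cos θ := Real.cos_nonneg_of_neg_pi_div_two_le_of_le (by linarith) h2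
    have hs0 : 0 ≤ Real.sin θ := Real.sin_nonneg_of_nonneg_of_le_pi h1 (by linarith)
    have hcs := Real.cos_sq_add_sin_sq θ
    rcases hc0.eq_or_lt with h | h
    · have : 0 < Real.sin θ := by
        rcases hs0.eq_or_lt with h' | h'
        · rw [← h, ← h'] at hcs; norm_num at hcs
        · exact h'
      rw [← h]
      nlinarith
    · have e1 := mul_pos h hr
      have e2 : 0 ≤ Real.sin θ * (2 + lorenzHeight p q i τ) := mul_nonneg hs0 (by linarith)
      linarith
  · rw [braidRadius_eq i hτ.1, braidHeight_eq i hτ.1, braidRadius_eq j hτ.1,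
      braidHeight_eq j hτ.1] at h1 h2
    set θ := (1 - t) * (Real.pi / 2)
    have hcs := Real.cos_sq_add_sin_sq θ
    refine lorenz_position_inj hτ.2 ?_ ?_
    · linear_combination Real.cos θ * h1 - Real.sin θ * h2 -
        (lorenzRadius p q i τ - lorenzRadius p q j τ) * hcs
    · linear_combination Real.sin θ * h1 + Real.cos θ * h2 -
        (lorenzHeight p q i τ - lorenzHeight p q j τ) * hcs

/-! ### From thin strands to the Lorenz braid -/

/-- The height of the point with angles `a` and `b` of the surface `unrollTorus 1`. -/
noncomputable def unrollHeight (a b : ℝ) : ℝ :=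
  Real.sin b + Real.sin b * Real.cos b / 2 - Real.sin a

theorem unrollTorus_one (A B : ℝ) :
    unrollTorus 1 (Circle.exp (2 * Real.pi * A)) (Circle.exp (2 * Real.pi * B)) =
      cylPoint (3 - 2 * Real.cos (2 * Real.pi * A)) (A + B)
        (unrollHeight (2 * Real.pi * A) (2 * Real.pi * B)) := by
  have : 2 * Real.pi * (A + B) = 2 * Real.pi * A + 2 * Real.pi * B := by ring
  simp only [unrollTorus, cylPoint, vec3_inj, Circle.exp_re, Circle.exp_im, this, Real.cos_add,
    Real.sin_add, unrollHeight]
  refine ⟨?_, ?_, ?_⟩ <;> ring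

theorem seven_eighths_le_cos {x : ℝ} (hx : |x| ≤ 1 / 2) : 7 / 8 ≤ Real.cos x := by
  have h := Real.one_sub_sq_div_two_le_cos (x := x)
  have h1 : x ^ 2 ≤ (1 / 2) ^ 2 := sq_le_sq' (abs_le.1 hx).1 (abs_le.1 hx).2
  linarith

/-- Along a path with constant sum of angles the height decreases at the rate `cos b + cos (2b) / 2
+ cos a`. This is positive when one of the angles is small, whatever the other one; for small `a`
the second term is indispensable, since `cos b` may be -1. -/
theorem unrollHeight_lt {a b δ : ℝ} (hδ : 0 < δ)
    (h : (|a| ≤ 1 / 2 ∧ |a + δ| ≤ 1 / 2) ∨ (|b| ≤ 1 / 2 ∧ |b - δ| ≤ 1 / 2)) :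
    unrollHeight (a + δ) (b - δ) < unrollHeight a b := by
  have hd : ∀ x, HasDerivAt (fun x => unrollHeight (a + x) (b - x))
      (-(Real.cos (b - x) + (Real.cos (b - x) ^ 2 - Real.sin (b - x) ^ 2) / 2 +
        Real.cos (a + x))) x := by
    intro x
    have h1 : HasDerivAt (fun x => b - x) (-1) x := by
      simpa using (hasDerivAt_id x).const_sub b
    have h2 : HasDerivAt (fun x => a + x) 1 x := by
      simpa using (hasDerivAt_id x).const_add a
    refine ((h1.sin.add ((h1.sin.mul h1.cos).div_const 2)).sub h2.sin).congr_deriv ?_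
    ring
  have hanti : StrictAntiOn (fun x => unrollHeight (a + x) (b - x)) (Icc 0 δ) := by
    refine strictAntiOn_of_deriv_neg (convex_Icc 0 δ)
      (fun x _ => (hd x).continuousAt.continuousWithinAt) (fun x hx => ?_)
    rw [(hd x).deriv, neg_lt_zero]
    rw [interior_Icc] at hx
    have hcs := Real.cos_sq_add_sin_sq (b - x)
    rcases h with ⟨h1, h2⟩ | ⟨h1, h2⟩
    · have h3 := seven_eighths_le_cos (x := a + x) (by
        rw [abs_le] at *; constructor <;> linarith [hx.1, hx.2])
      -- The terms in the second angle add up to a square minus 3/4, and the cosine of the first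
      -- angle is at least 7/8.
      nlinarith [sq_nonneg (Real.cos (b - x) + 1 / 2)]
    · have h3 := seven_eighths_le_cos (x := b - x) (by
        rw [abs_le] at *; constructor <;> linarith [hx.1, hx.2])
      nlinarith [Real.neg_one_le_cos (a + x)]
  have := hanti (left_mem_Icc.2 hδ.le) (right_mem_Icc.2 hδ.le) hδ
  simpa using this

theorem unrollHeight_sub_two_pi (a b : ℝ) :
    unrollHeight (a - 2 * Real.pi) b = unrollHeight a b := by
  rw [unrollHeight, unrollHeight, Real.sin_sub_two_pi]

theorem unrollHeight_sub_two_pi' (a b : ℝ) :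
    unrollHeight a (b - 2 * Real.pi) = unrollHeight a b := by
  rw [unrollHeight, unrollHeight, Real.sin_sub_two_pi, Real.cos_sub_two_pi]

/-- The first angle along a thin strand. -/
noncomputable def thinFst (p q : ℕ) (ε : ℝ) (i : Fin (p + q)) (τ : ℝ) : ℝ :=
  2 * Real.pi * ((τ + thinDiff p q ε i τ) / 2)

/-- The second angle along a thin strand. -/
noncomputable def thinSnd (p q : ℕ) (ε : ℝ) (i : Fin (p + q)) (τ : ℝ) : ℝ :=
  2 * Real.pi * ((τ - thinDiff p q ε i τ) / 2)

theorem thinFst_add_thinSnd (p q : ℕ) (ε : ℝ) (i : Fin (p + q)) (τ : ℝ) :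
    thinFst p q ε i τ + thinSnd p q ε i τ = 2 * Real.pi * τ := by
  rw [thinFst, thinSnd]; ring

theorem thinFst_sub_thinFst {p q : ℕ} {ε τ : ℝ} (hε : 0 < ε) (i j : Fin (p + q)) (hτ : 0 ≤ τ) :
    thinFst p q ε j τ - thinFst p q ε i τ = Real.pi * (ε * ((j : ℝ) - i) +
      (lorenzSide p q j - lorenzSide p q i + ε * (lorenzShift p q j - lorenzShift p q i)) *
        flatStep ε τ) := by
  rw [thinFst, thinFst, thinDiff_eq hε i hτ, thinDiff_eq hε j hτ, thinStep, thinStep]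
  ring

theorem combo_pos {t x y : ℝ} (ht : t ∈ Icc (0 : ℝ) 1) (hx : 0 < x) (hy : 0 < y) :
    0 < (1 - t) * x + t * y := by
  rcases ht.1.eq_or_lt with rfl | h
  · linarith
  · have := mul_pos h hy
    have := mul_nonneg (sub_nonneg.2 ht.2) hx.le
    linarith

theorem exists_smoothTransition_lt {η : ℝ} (hη : 0 < η) : ∃ σ : ℝ, 0 < σ ∧
    (∀ τ, τ ≤ σ → Real.smoothTransition τ < η) ∧
    (∀ τ, 1 - σ ≤ τ → 1 - η < Real.smoothTransition τ) := by
  have h0 := (Real.smoothTransition.continuous.tendsto 0).eventually_lt_const (u := η)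
    (by simpa using hη)
  have h1 := (Real.smoothTransition.continuous.tendsto 1).eventually_const_lt (u := 1 - η)
    (by simpa using hη)
  obtain ⟨a, ha, h0⟩ := Metric.eventually_nhds_iff.1 h0
  obtain ⟨b, hb, h1⟩ := Metric.eventually_nhds_iff.1 h1
  have hmin : 0 < min a b := lt_min ha hb
  refine ⟨min a b / 2, by positivity, fun τ hτ => ?_, fun τ hτ => ?_⟩
  · refine (Real.smoothTransition.monotone hτ).trans_lt (h0 ?_)
    rw [Real.dist_eq, sub_zero, abs_of_pos (by positivity)]
    linarith [min_le_left a b]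
  · refine lt_of_lt_of_le (h1 ?_) (Real.smoothTransition.monotone hτ)
    rw [Real.dist_eq, abs_lt]
    constructor <;> linarith [min_le_right a b]

theorem cos_lt_cos_of_abs_lt {x y : ℝ} (h1 : |x| < y) (h2 : y < 2 * Real.pi - |x|) :
    Real.cos y < Real.cos x := by
  rw [← Real.cos_abs x]
  rcases le_total y Real.pi with h | h
  · exact Real.cos_lt_cos_of_nonneg_of_le_pi (abs_nonneg x) h h1
  · rw [← Real.cos_two_pi_sub y]
    exact Real.cos_lt_cos_of_nonneg_of_le_pi (abs_nonneg x) (by linarith) (by linarith)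

/-! ### Relative position of two thin strands at the same time. -/

section

variable {p q : ℕ} {ε σ τ : ℝ} {i j : Fin (p + q)}

/-- Two strands of the same kind differ in height. -/
theorem thin_height_lt_of_same (hε : 0 < ε) (hσ : σ ≤ 1 / 40) (hεσ : ε * (p + q) ≤ σ / 3)
    (hij : i < j) (hτ : τ ∈ Ico (0 : ℝ) 1) (h : (i : ℕ) < q ↔ (j : ℕ) < q) :
    unrollHeight (thinFst p q ε j τ) (thinSnd p q ε j τ) <
        unrollHeight (thinFst p q ε i τ) (thinSnd p q ε i τ) ∧
      lorenzRadius p q i τ < lorenzRadius p q j τ := by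
  have hji : (i : ℝ) < j := by exact_mod_cast hij
  have hsum := thinFst_add_thinSnd p q ε
  have hdiff := thinFst_sub_thinFst hε i j hτ.1
  have hn1 := thinDiff_near hε i ⟨hτ.1, hτ.2.le⟩
  have hn2 := thinDiff_near hε j ⟨hτ.1, hτ.2.le⟩
  have hs : lorenzShift p q j = lorenzShift p q i := by simp only [lorenzShift, h]
  have hs' : lorenzSide p q j = lorenzSide p q i := by simp only [lorenzSide, h]
  rw [hs, hs', sub_self, sub_self, mul_zero, add_zero, zero_mul, add_zero] at hdiff
  have hsm : ∀ x : ℝ, |x| ≤ ε * (p + q) → |2 * Real.pi * x| ≤ 1 / 2 := by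
    intro x hx
    rw [abs_mul, abs_of_pos (by positivity)]
    have := Real.pi_lt_d2
    nlinarith [abs_nonneg x, Real.pi_pos]
  refine ⟨?_, by rw [lorenzRadius, lorenzRadius, hs]; linarith⟩
  have hδ : 0 < Real.pi * (ε * ((j : ℝ) - i)) :=
    mul_pos Real.pi_pos (mul_pos hε (by linarith))
  have e1 : thinFst p q ε i τ + Real.pi * (ε * ((j : ℝ) - i)) = thinFst p q ε j τ := by linarith
  have e2 : thinSnd p q ε i τ - Real.pi * (ε * ((j : ℝ) - i)) = thinSnd p q ε j τ := by
    linarith [hsum i τ, hsum j τ]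
  have := unrollHeight_lt (a := thinFst p q ε i τ) (b := thinSnd p q ε i τ) hδ
  rw [e1, e2] at this
  refine this ?_
  by_cases hi : (i : ℕ) < q
  · exact Or.inl ⟨hsm _ (hn1.1 hi), hsm _ (hn2.1 (h.1 hi))⟩
  · exact Or.inr ⟨hsm _ (hn1.2 hi), hsm _ (hn2.2 (fun h' => hi (h.2 h')))⟩

theorem lorenzShift_of_lt (h : (i : ℕ) < q) : lorenzShift p q i = p := if_pos h

theorem lorenzShift_of_not_lt (h : ¬ (i : ℕ) < q) : lorenzShift p q i = -q := if_neg h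

theorem lorenzSide_of_lt (h : (i : ℕ) < q) : lorenzSide p q i = -1 := if_pos h

theorem lorenzSide_of_not_lt (h : ¬ (i : ℕ) < q) : lorenzSide p q i = 1 := if_neg h

theorem thinFst_near (hε : 0 < ε) (hεσ : ε * (p + q) ≤ σ / 3) (hi : (i : ℕ) < q)
    (hτ : τ ∈ Icc (0 : ℝ) 1) : |thinFst p q ε i τ| ≤ Real.pi * (2 * σ / 3) := by
  rw [thinFst, abs_mul, abs_of_pos Real.two_pi_pos]
  have := (thinDiff_near hε i hτ).1 hi
  nlinarith [Real.pi_pos]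

theorem thinSnd_near (hε : 0 < ε) (hεσ : ε * (p + q) ≤ σ / 3) (hi : ¬ (i : ℕ) < q)
    (hτ : τ ∈ Icc (0 : ℝ) 1) : |thinSnd p q ε i τ| ≤ Real.pi * (2 * σ / 3) := by
  rw [thinSnd, abs_mul, abs_of_pos Real.two_pi_pos]
  have := (thinDiff_near hε i hτ).2 hi
  nlinarith [Real.pi_pos]

/-- At the beginning, a strand in front is higher than a strand behind. -/
theorem thin_height_lt_near_zero (hε : 0 < ε) (hσ : σ ≤ 1 / 40)
    (hεσ : ε * (p + q) ≤ σ / 3) (hn : (2 : ℝ) ≤ p + q) (hi : (i : ℕ) < q) (hj : ¬ (j : ℕ) < q)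
    (hτ : τ ∈ Ico (0 : ℝ) 1) (hτσ : τ ≤ σ) :
    unrollHeight (thinFst p q ε j τ) (thinSnd p q ε j τ) <
      unrollHeight (thinFst p q ε i τ) (thinSnd p q ε i τ) := by
  have hτ' : τ ∈ Icc (0 : ℝ) 1 := ⟨hτ.1, hτ.2.le⟩
  have hsum := thinFst_add_thinSnd p q ε
  have hdiff := thinFst_sub_thinFst hε i j hτ.1
  rw [lorenzShift_of_lt hi, lorenzShift_of_not_lt hj, lorenzSide_of_lt hi,
    lorenzSide_of_not_lt hj] at hdiff
  obtain ⟨s0, s1⟩ := flatStep_mem (ε := ε) hτ'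
  have hs := (abs_le.1 (abs_flatStep_sub_le hε hτ')).2
  have hij : (i : ℝ) + 1 ≤ j := by
    have : (i : ℕ) + 1 ≤ j := by omega
    exact_mod_cast this
  have hjn : (j : ℝ) + 1 ≤ p + q := by exact_mod_cast j.2
  have hi0 : (0 : ℝ) ≤ i := by positivity
  have hni := abs_le.1 (thinFst_near hε hεσ hi hτ')
  set s := flatStep ε τ
  set a := thinFst p q ε i τ
  set b := thinSnd p q ε i τ
  set d := ε * ((j : ℝ) - i) + (1 - -1 + ε * (-(q : ℝ) - p)) * s with hd
  have hd0 : 0 < d := by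
    have h1 : 0 < ε * ((j : ℝ) - i) := mul_pos hε (by linarith)
    have h2 : 0 ≤ (1 - -1 + ε * (-(q : ℝ) - p)) * s := mul_nonneg (by linarith) s0
    linarith
  have hd1 : d ≤ 8 / 3 * σ := by
    have h1 : ε * ((j : ℝ) - i) ≤ ε * (p + q) := by nlinarith
    have h2 : (1 - -1 + ε * (-(q : ℝ) - p)) * s ≤ 2 * s :=
      mul_le_mul_of_nonneg_right (by nlinarith) s0
    have h3 : ε ≤ σ / 6 := by nlinarith
    linarith
  have hδ : 0 < Real.pi * d := mul_pos Real.pi_pos hd0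
  have hδ1 : Real.pi * d ≤ Real.pi * (8 / 3 * σ) :=
    mul_le_mul_of_nonneg_left hd1 Real.pi_pos.le
  have hb : Real.pi * σ ≤ 3.15 * (1 / 40) := by
    have := Real.pi_lt_d2
    have hσ0 : 0 ≤ σ := by nlinarith
    nlinarith
  have e1 : a + Real.pi * d = thinFst p q ε j τ := by linarith
  have e2 : b - Real.pi * d = thinSnd p q ε j τ := by linarith [hsum i τ, hsum j τ]
  rw [← e1, ← e2]
  refine unrollHeight_lt hδ (Or.inl ?_)
  rw [abs_le, abs_le]
  refine ⟨⟨?_, ?_⟩, ?_, ?_⟩ <;> linarith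

/-- At the end, a strand in front is lower than a strand behind. -/
theorem thin_height_lt_near_one (hε : 0 < ε) (hσ : σ ≤ 1 / 40)
    (hεσ : ε * (p + q) ≤ σ / 3) (hn : (2 : ℝ) ≤ p + q) (hi : (i : ℕ) < q) (hj : ¬ (j : ℕ) < q)
    (hτ : τ ∈ Ico (0 : ℝ) 1) (hτσ : 1 - τ ≤ σ) :
    unrollHeight (thinFst p q ε i τ) (thinSnd p q ε i τ) <
      unrollHeight (thinFst p q ε j τ) (thinSnd p q ε j τ) := by
  have hτ' : τ ∈ Icc (0 : ℝ) 1 := ⟨hτ.1, hτ.2.le⟩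
  have hsum := thinFst_add_thinSnd p q ε
  have hdiff := thinFst_sub_thinFst hε i j hτ.1
  rw [lorenzShift_of_lt hi, lorenzShift_of_not_lt hj, lorenzSide_of_lt hi,
    lorenzSide_of_not_lt hj] at hdiff
  obtain ⟨s0, s1⟩ := flatStep_mem (ε := ε) hτ'
  have hs := (abs_le.1 (abs_flatStep_sub_le hε hτ')).1
  have hij : (i : ℝ) + 1 ≤ j := by
    have : (i : ℕ) + 1 ≤ j := by omega
    exact_mod_cast this
  have hjn : (j : ℝ) + 1 ≤ p + q := by exact_mod_cast j.2
  have hi0 : (0 : ℝ) ≤ i := by positivity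
  have hni := abs_le.1 (thinFst_near hε hεσ hi hτ')
  set s := flatStep ε τ
  set a := thinFst p q ε i τ
  set b := thinSnd p q ε i τ
  -- The gap measured around the end of the time interval: from the strand behind, whose first angle
  -- has nearly completed a turn, on to the strand in front.
  set d := ε * ((p : ℝ) + q - (j - i)) + (1 - -1 + ε * (-(q : ℝ) - p)) * (1 - s) with hd
  have hd0 : 0 < d := by
    have h1 : 0 < ε * ((p : ℝ) + q - (j - i)) := mul_pos hε (by linarith)
    have h2 : 0 ≤ (1 - -1 + ε * (-(q : ℝ) - p)) * (1 - s) :=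
      mul_nonneg (by linarith) (by linarith)
    linarith
  have hd1 : d ≤ 8 / 3 * σ := by
    have h1 : ε * ((p : ℝ) + q - (j - i)) ≤ ε * (p + q) := by nlinarith
    have h2 : (1 - -1 + ε * (-(q : ℝ) - p)) * (1 - s) ≤ 2 * (1 - s) :=
      mul_le_mul_of_nonneg_right (by nlinarith) (by linarith)
    have h3 : ε ≤ σ / 6 := by nlinarith
    linarith
  have hδ : 0 < Real.pi * d := mul_pos Real.pi_pos hd0
  have hδ1 : Real.pi * d ≤ Real.pi * (8 / 3 * σ) :=
    mul_le_mul_of_nonneg_left hd1 Real.pi_pos.le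
  have hb : Real.pi * σ ≤ 3.15 * (1 / 40) := by
    have := Real.pi_lt_d2
    have hσ0 : 0 ≤ σ := by nlinarith
    nlinarith
  have e1 : thinFst p q ε j τ - 2 * Real.pi + Real.pi * d = a := by
    rw [hd]; linarith
  have e2 : thinSnd p q ε j τ - Real.pi * d = b - 2 * Real.pi := by
    linarith [hsum i τ, hsum j τ]
  -- Taking off the completed turns, the second angle of `i` and the first angle of `j`, brings both
  -- first angles near 0 without changing the heights.
  rw [← unrollHeight_sub_two_pi' a b, ← unrollHeight_sub_two_pi (thinFst p q ε j τ), ← e2]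
  nth_rewrite 1 [← e1]
  refine unrollHeight_lt hδ (Or.inl ?_)
  rw [abs_le, abs_le]
  refine ⟨⟨?_, ?_⟩, ?_, ?_⟩ <;> linarith

/-- In the middle, a strand in front has smaller radius than a strand behind. -/
theorem thin_radius_lt (hε : 0 < ε) (hσ0 : 0 < σ)
    (hεσ : ε * (p + q) ≤ σ / 3) (hi : (i : ℕ) < q) (hj : ¬ (j : ℕ) < q)
    (hτ : τ ∈ Ico (0 : ℝ) 1) (h1 : σ < τ) (h2 : σ < 1 - τ) :
    3 - 2 * Real.cos (thinFst p q ε i τ) < 3 - 2 * Real.cos (thinFst p q ε j τ) := by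
  have hτ' : τ ∈ Icc (0 : ℝ) 1 := ⟨hτ.1, hτ.2.le⟩
  have e1 := thinFst_near hε hεσ hi hτ'
  have e2 := abs_le.1 (thinSnd_near hε hεσ hj hτ')
  have e3 := thinFst_add_thinSnd p q ε j τ
  have e4 : Real.pi * σ < Real.pi * τ := mul_lt_mul_of_pos_left h1 Real.pi_pos
  have e5 : Real.pi * σ < Real.pi * (1 - τ) := mul_lt_mul_of_pos_left h2 Real.pi_pos
  have e6 : 0 < Real.pi * σ := mul_pos Real.pi_pos hσ0
  -- The first angle is near 0 on the strand in front and near `2πτ` on the strand behind; away from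
  -- the ends of the time interval the latter is farther from the multiples of `2π`.
  have := cos_lt_cos_of_abs_lt (x := thinFst p q ε i τ) (y := thinFst p q ε j τ)
    (by linarith) (by linarith)
  linarith

end

theorem diagPoint_unrollTorus_one (p q : ℕ) (ε : ℝ) (i : Fin (p + q)) (τ : ℝ) :
    diagPoint (unrollTorus 1) (thinDiff p q ε i τ) τ =
      cylPoint (3 - 2 * Real.cos (thinFst p q ε i τ)) τ
        (unrollHeight (thinFst p q ε i τ) (thinSnd p q ε i τ)) := by
  rw [diagPoint, unrollTorus_one, thinFst, thinSnd]
  congr 1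
  ring

theorem thin_glue {p q : ℕ} {ε τ : ℝ} (hε : 0 < ε) (hε1 : ε ≤ 1) (i : Fin (p + q))
    (hτ : τ ∈ Icc (0 : ℝ) 1) :
    Real.cos (thinFst p q ε i τ) = Real.cos (thinFst p q ε (lorenzPerm p q i) (τ - 1)) ∧
    unrollHeight (thinFst p q ε i τ) (thinSnd p q ε i τ) =
      unrollHeight (thinFst p q ε (lorenzPerm p q i) (τ - 1))
        (thinSnd p q ε (lorenzPerm p q i) (τ - 1)) := by
  have h := thinDiff_glue hε hε1 i hτ
  rcases lorenzSide_cases i with hs | hs <;> rw [hs] at h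
  · have h1 : thinFst p q ε (lorenzPerm p q i) (τ - 1) = thinFst p q ε i τ := by
      rw [thinFst, thinFst, h]; ring
    have h2 : thinSnd p q ε (lorenzPerm p q i) (τ - 1) = thinSnd p q ε i τ - 2 * Real.pi := by
      rw [thinSnd, thinSnd, h]; ring
    rw [h1, h2, unrollHeight_sub_two_pi']
    exact ⟨rfl, rfl⟩
  · have h1 : thinFst p q ε (lorenzPerm p q i) (τ - 1) = thinFst p q ε i τ - 2 * Real.pi := by
      rw [thinFst, thinFst, h]; ring
    have h2 : thinSnd p q ε (lorenzPerm p q i) (τ - 1) = thinSnd p q ε i τ := by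
      rw [thinSnd, thinSnd, h]; ring
    rw [h1, h2, unrollHeight_sub_two_pi, Real.cos_sub_two_pi]
    exact ⟨rfl, rfl⟩

/-- Thin strands on the surface `unrollTorus 1` form a closed Lorenz braid. -/
theorem thin_closedBraid {p q : ℕ} (hp : 1 ≤ p) (hq : 1 ≤ q) : ∃ ε₀ : ℝ, 0 < ε₀ ∧
    ∀ ε, 0 < ε → ε ≤ ε₀ → ε ≤ 1 → SameOrientedLinkType
      (strandLink fun (i : Fin (p + q)) τ => diagPoint (unrollTorus 1) (thinDiff p q ε i τ) τ)
      (strandLink fun (i : Fin (p + q)) τ =>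
        cylPoint (2 + braidHeight p q i τ) τ (-braidRadius p q i τ)) := by
  have hn : (2 : ℝ) ≤ p + q := by
    have h1 : (1 : ℝ) ≤ p := by exact_mod_cast hp
    have h2 : (1 : ℝ) ≤ q := by exact_mod_cast hq
    linarith
  -- A strand in front and one behind approach or separate by `p + q` in total, so they stay in
  -- their initial or final order of radii as long as the transition is within `1 / (p + q)` of its
  -- end value.
  obtain ⟨σ', hσ'0, hS0, hS1⟩ := exists_smoothTransition_lt (η := 1 / ((p : ℝ) + q))
    (by positivity)
  set σ := min σ' (1 / 40) with hσdef
  have hσ0 : 0 < σ := lt_min hσ'0 (by norm_num)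
  have hσ1 : σ ≤ 1 / 40 := min_le_right _ _
  refine ⟨σ / (3 * (p + q)), by positivity, fun ε hε hεσ' hε1 => ?_⟩
  have hεσ : ε * (p + q) ≤ σ / 3 := by
    rw [le_div_iff₀ (by positivity)] at hεσ'
    linarith
  have hsec : ∀ f : ℝ → ℝ, ContDiff ℝ ∞ f → ContDiff ℝ ∞ fun z : ℝ × ℝ => f z.2 :=
    fun f hf => hf.comp contDiff_snd
  have hFst : ∀ i : Fin (p + q), ContDiff ℝ ∞ (thinFst p q ε i) := fun i =>
    contDiff_const.mul ((contDiff_id.add (contDiff_thinDiff p q ε i)).div_const 2)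
  have hSnd : ∀ i : Fin (p + q), ContDiff ℝ ∞ (thinSnd p q ε i) := fun i =>
    contDiff_const.mul ((contDiff_id.sub (contDiff_thinDiff p q ε i)).div_const 2)
  have h1t : ContDiff ℝ ∞ fun z : ℝ × ℝ => 1 - z.1 := contDiff_const.sub contDiff_fst
  -- At each `τ` one coordinate orders two strands strictly and in the same way at both ends of the
  -- homotopy, so no convex combination makes them meet: the height for strands of the same kind and
  -- near the ends of the time interval, the radius otherwise.
  have key : ∀ t ∈ Icc (0 : ℝ) 1, ∀ τ ∈ Ico (0 : ℝ) 1, ∀ i j : Fin (p + q), i < j →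
      (1 - t) * (3 - 2 * Real.cos (thinFst p q ε i τ)) + t * (2 + braidHeight p q i τ) =
        (1 - t) * (3 - 2 * Real.cos (thinFst p q ε j τ)) + t * (2 + braidHeight p q j τ) →
      (1 - t) * unrollHeight (thinFst p q ε i τ) (thinSnd p q ε i τ) +
          t * -braidRadius p q i τ =
        (1 - t) * unrollHeight (thinFst p q ε j τ) (thinSnd p q ε j τ) +
          t * -braidRadius p q j τ → False := by
    intro t ht τ hτ i j hij h1 h2
    rw [braidHeight_eq i hτ.1, braidHeight_eq j hτ.1] at h1
    rw [braidRadius_eq i hτ.1, braidRadius_eq j hτ.1] at h2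
    have S0 := Real.smoothTransition.nonneg τ
    have S1 := Real.smoothTransition.le_one τ
    by_cases hsame : (i : ℕ) < q ↔ (j : ℕ) < q
    · obtain ⟨h3, h4⟩ := thin_height_lt_of_same hε hσ1 hεσ hij hτ hsame
      have := combo_pos ht (sub_pos.2 h3) (sub_pos.2 h4)
      linarith
    have hij' : (i : ℕ) < j := hij
    have hi : (i : ℕ) < q := by
      by_contra hi
      exact hsame ⟨fun h => absurd h hi, fun h => by omega⟩
    have hj : ¬ (j : ℕ) < q := fun hj => hsame ⟨fun _ => hj, fun _ => hi⟩
    have hijr : (i : ℝ) + 1 ≤ j := by exact_mod_cast hij'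
    have hjn : (j : ℝ) + 1 ≤ p + q := by exact_mod_cast j.2
    have hi0 : (0 : ℝ) ≤ i := by positivity
    rcases le_or_gt τ σ with h | h
    · have h3 := thin_height_lt_near_zero hε hσ1 hεσ hn hi hj hτ h
      have h4 : lorenzRadius p q i τ < lorenzRadius p q j τ := by
        have h5 := hS0 τ (h.trans (min_le_left _ _))
        rw [lt_div_iff₀ (by positivity)] at h5
        rw [lorenzRadius, lorenzRadius, lorenzShift_of_lt hi, lorenzShift_of_not_lt hj]
        linarith
      have := combo_pos ht (sub_pos.2 h3) (sub_pos.2 h4)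
      linarith
    rcases le_or_gt (1 - τ) σ with h' | h'
    · have h3 := thin_height_lt_near_one hε hσ1 hεσ hn hi hj hτ h'
      have h4 : lorenzRadius p q j τ < lorenzRadius p q i τ := by
        have h5 := hS1 τ (by linarith [min_le_left σ' (1 / 40)])
        rw [sub_lt_comm, lt_div_iff₀ (by positivity)] at h5
        rw [lorenzRadius, lorenzRadius, lorenzShift_of_lt hi, lorenzShift_of_not_lt hj]
        linarith
      have := combo_pos ht (sub_pos.2 h3) (sub_pos.2 h4)
      linarith
    · have h3 := thin_radius_lt hε hσ0 hεσ hi hj hτ h h'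
      have h4 : lorenzHeight p q i τ < lorenzHeight p q j τ := by
        have h5 := Real.smoothTransition.pos_of_pos (hσ0.trans h)
        have h6 := Real.smoothTransition.lt_one_of_lt_one hτ.2
        have h7 := mul_pos h5 (sub_pos.2 h6)
        rw [lorenzHeight, lorenzHeight, lorenzSide_of_lt hi, lorenzSide_of_not_lt hj]
        linarith
      have := combo_pos ht (sub_pos.2 h3) (sub_pos.2 h4)
      linarith
  have := closedBraid_isotopy (lorenzPerm p q)
    (fun t i τ => (1 - t) * (3 - 2 * Real.cos (thinFst p q ε i τ)) +
      t * (2 + braidHeight p q i τ))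
    (fun t i τ => (1 - t) * unrollHeight (thinFst p q ε i τ) (thinSnd p q ε i τ) +
      t * -braidRadius p q i τ) (fun i => ?_) (fun i => ?_)
    ⟨1, one_pos, le_rfl, fun t _ i τ hτ => ?_⟩ (fun t ht i τ hτ => ?_)
    (fun t ht τ hτ i j h1 h2 => ?_)
  · simpa [diagPoint_unrollTorus_one] using this
  · exact (h1t.mul (hsec _ (contDiff_const.sub (contDiff_const.mul (hFst i).cos)))).add
      (contDiff_fst.mul (hsec _ (contDiff_const.add (contDiff_braidHeight p q i))))
  · exact (h1t.mul (hsec _ (((hSnd i).sin.add (((hSnd i).sin.mul (hSnd i).cos).div_const 2)).sub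
      (hFst i).sin))).add (contDiff_fst.mul (hsec _ (contDiff_braidRadius p q i).neg))
  · rw [sub_self] at hτ
    obtain ⟨h1, h2⟩ := thin_glue hε hε1 i hτ
    rw [h1, h2, braidRadius_glue i hτ, braidHeight_glue i hτ]
    exact ⟨rfl, rfl⟩
  · rw [braidHeight_eq i hτ.1]
    have hy := (abs_le.1 (abs_lorenzHeight_le i τ)).1
    exact combo_pos ht (by linarith [Real.cos_le_one (thinFst p q ε i τ)]) (by linarith)
  · rcases lt_trichotomy i j with h | h | h
    · exact (key t ht τ hτ i j h h1 h2).elim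
    · exact h
    · exact (key t ht τ hτ j i h h1.symm h2.symm).elim

/-- The closure of the Lorenz braid with parameter pair `(p, q)` is a torus link. -/
theorem braidClosure_lorenzBraid_torusLink {p q : ℕ} (hp : 1 ≤ p) (hq : 1 ≤ q) :
    SameOrientedLinkType (braidClosure (lorenzBraid [(p, q)])) (torusLink p q) := by
  obtain ⟨ε₁, hε₁, h₁⟩ := strandLink_unrollTorus p q
  obtain ⟨ε₂, hε₂, h₂⟩ := thin_closedBraid hp hq
  have hp' : (1 : ℝ) ≤ p := by exact_mod_cast hp
  have hn : (1 : ℝ) ≤ p + q := by linarith [(Nat.cast_nonneg q : (0 : ℝ) ≤ q)]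
  set ε := min (min ε₁ ε₂) (1 / ((p : ℝ) + q)) with hεdef
  have hε : 0 < ε := lt_min (lt_min hε₁ hε₂) (by positivity)
  have hεn : ε * (p + q) ≤ 1 := by
    rw [← le_div_iff₀ (by positivity)]
    exact min_le_right _ _
  have hε1 : ε ≤ 1 := by nlinarith
  have e1 : ε ≤ ε₁ := (min_le_left _ _).trans (min_le_left _ _)
  have e2 : ε ≤ ε₂ := (min_le_left _ _).trans (min_le_right _ _)
  have h3 := torusLink_thin hp hε hεn
  have h4 := h₁ ε hε e1 hεn hε1
  simp only [show unrollTorus 0 = shearTorus 1 from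
    funext fun u => funext fun v => unrollTorus_zero u v] at h4
  have h5 := ((h3.trans h4).trans (h₂ ε hε e2 hε1)).trans (closedBraid_quarterTurn p q)
  rw [braidClosure_lorenzBraid_singleton]
  have h6 : (strandLink fun (i : Fin (p + q)) τ =>
      cylPoint (lorenzRadius p q i τ) τ (lorenzHeight p q i τ)) =
      strandLink fun i τ => cylPoint (braidRadius p q i τ) τ (braidHeight p q i τ) :=
    strandLink_congr fun i τ hτ => by rw [braidRadius_eq i hτ.1, braidHeight_eq i hτ.1]
  rw [h6]
  exact h5.symm

/-! ### Lobes around the left ear -/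

/-- A smooth function that is `1 / C` for `C` near `1` and constant for smaller `C`. -/
noncomputable def lobeGain (c₁ C : ℝ) : ℝ :=
  1 + Real.smoothTransition (2 / (1 - c₁) * (C - c₁)) * (1 / C - 1)

theorem lobeGain_of_le {c₁ C : ℝ} (h1 : c₁ < 1) (h : C ≤ c₁) : lobeGain c₁ C = 1 := by
  rw [lobeGain, Real.smoothTransition.zero_of_nonpos]
  · ring
  · exact mul_nonpos_of_nonneg_of_nonpos (div_nonneg zero_le_two (by linarith)) (by linarith)

theorem lobeGain_of_ge {c₁ C : ℝ} (h1 : c₁ < 1) (h : (1 + c₁) / 2 ≤ C) :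
    lobeGain c₁ C = 1 / C := by
  rw [lobeGain, Real.smoothTransition.one_of_one_le]
  · ring
  · have : 0 < 1 - c₁ := by linarith
    rw [div_mul_eq_mul_div, le_div_iff₀ this]
    linarith

theorem lobeGain_mem {c₁ C : ℝ} (h0 : 0 < c₁) (h1 : c₁ < 1) (hC : C ≤ 1) :
    lobeGain c₁ C ∈ Icc 1 (1 / c₁) := by
  have h2 : 1 ≤ 1 / c₁ := by rw [le_div_iff₀ h0]; linarith
  rcases le_or_gt C c₁ with h | h
  · rw [lobeGain_of_le h1 h]
    exact ⟨le_rfl, h2⟩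
  · have hS0 := Real.smoothTransition.nonneg (2 / (1 - c₁) * (C - c₁))
    have hS1 := Real.smoothTransition.le_one (2 / (1 - c₁) * (C - c₁))
    have hC0 : 0 < C := h0.trans h
    have h3 : 1 ≤ 1 / C := by rw [le_div_iff₀ hC0]; linarith
    have h4 : 1 / C ≤ 1 / c₁ := one_div_le_one_div_of_le h0 h.le
    rw [lobeGain]
    constructor <;> nlinarith

/-- This keeps a lobe with `u = 0` on the near side of its vertical line: its horizontal distance
from the ear in the direction of the branch line is at most `2 + w`. -/
theorem lobeGain_mul_le {c₁ C : ℝ} (h0 : 0 < c₁) (h1 : c₁ < 1) (hC : C ≤ 1) :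
    lobeGain c₁ C * C ≤ 1 := by
  rcases le_or_gt C c₁ with h | h
  · rw [lobeGain_of_le h1 h]; linarith
  · have hS0 := Real.smoothTransition.nonneg (2 / (1 - c₁) * (C - c₁))
    have hS1 := Real.smoothTransition.le_one (2 / (1 - c₁) * (C - c₁))
    have hC0 : 0 < C := h0.trans h
    have : lobeGain c₁ C * C =
        C + Real.smoothTransition (2 / (1 - c₁) * (C - c₁)) * (1 - C) := by
      rw [lobeGain]; field_simp
    rw [this]
    nlinarith

theorem contDiff_lobeGain {c₁ : ℝ} (h0 : 0 < c₁) (h1 : c₁ < 1) : ContDiff ℝ ∞ (lobeGain c₁) := by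
  have hS : ContDiff ℝ ∞ Real.smoothTransition := Real.smoothTransition.contDiff
  rw [contDiff_iff_contDiffAt]
  intro C
  rcases lt_or_ge C c₁ with h | h
  · have : lobeGain c₁ =ᶠ[nhds C] fun _ => 1 := by
      filter_upwards [Iio_mem_nhds h] with x hx
      exact lobeGain_of_le h1 (le_of_lt hx)
    exact contDiffAt_const.congr_of_eventuallyEq this
  · have hC : C ≠ 0 := (h0.trans_le h).ne'
    refine contDiffAt_const.add (ContDiffAt.mul ?_ ?_)
    · exact hS.contDiffAt.comp C (contDiffAt_const.mul (contDiffAt_id.sub contDiffAt_const))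
    · exact (contDiffAt_const.div contDiffAt_id hC).sub contDiffAt_const

/-- The aspect of a lobe. -/
noncomputable def lobeAspect (u w : ℝ) : ℝ := (1 - u) * (2 / (2 + w)) + u

theorem lobeAspect_pos {u w : ℝ} (hu : u ∈ Icc (0 : ℝ) 1) (hw : -2 < w) : 0 < lobeAspect u w := by
  have h : 0 < 2 / (2 + w) := div_pos two_pos (by linarith)
  have := combo_pos hu h one_pos
  rw [lobeAspect]
  linarith

/-- The normalizing factor for the direction in a lobe. -/
noncomputable def lobeNorm (u τ w : ℝ) : ℝ :=
  √(Real.cos (2 * Real.pi * τ) ^ 2 + (lobeAspect u w * Real.sin (2 * Real.pi * τ)) ^ 2)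

theorem lobeNorm_sq (u τ w : ℝ) : lobeNorm u τ w ^ 2 =
    Real.cos (2 * Real.pi * τ) ^ 2 + (lobeAspect u w * Real.sin (2 * Real.pi * τ)) ^ 2 :=
  Real.sq_sqrt (by positivity)

theorem lobeNorm_arg_pos {u τ w : ℝ} (hu : u ∈ Icc (0 : ℝ) 1) (hw : -2 < w) :
    0 < Real.cos (2 * Real.pi * τ) ^ 2 + (lobeAspect u w * Real.sin (2 * Real.pi * τ)) ^ 2 := by
  have ha := lobeAspect_pos hu hw
  have hcs := Real.cos_sq_add_sin_sq (2 * Real.pi * τ)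
  rcases eq_or_ne (Real.cos (2 * Real.pi * τ)) 0 with h | h
  · have : Real.sin (2 * Real.pi * τ) ≠ 0 := by
      intro h'; rw [h, h'] at hcs; norm_num at hcs
    have := mul_ne_zero ha.ne' this
    positivity
  · positivity

theorem lobeNorm_pos {u τ w : ℝ} (hu : u ∈ Icc (0 : ℝ) 1) (hw : -2 < w) : 0 < lobeNorm u τ w :=
  Real.sqrt_pos.2 (lobeNorm_arg_pos hu hw)

/-- The direction in a lobe, seen from the ear: cosine. -/
noncomputable def lobeCos (u τ w : ℝ) : ℝ := Real.cos (2 * Real.pi * τ) / lobeNorm u τ w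

/-- The direction in a lobe, seen from the ear: sine. -/
noncomputable def lobeSin (u τ w : ℝ) : ℝ :=
  lobeAspect u w * Real.sin (2 * Real.pi * τ) / lobeNorm u τ w

theorem lobeCos_sq_add {u τ w : ℝ} (hu : u ∈ Icc (0 : ℝ) 1) (hw : -2 < w) :
    lobeCos u τ w ^ 2 + lobeSin u τ w ^ 2 = 1 := by
  have h := (lobeNorm_pos (τ := τ) hu hw).ne'
  rw [lobeCos, lobeSin, div_pow, div_pow, ← add_div, ← lobeNorm_sq]
  exact div_self (pow_ne_zero 2 h)

theorem lobeCos_le_one {u τ w : ℝ} (hu : u ∈ Icc (0 : ℝ) 1) (hw : -2 < w) :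
    lobeCos u τ w ≤ 1 := by
  nlinarith [lobeCos_sq_add (τ := τ) hu hw, sq_nonneg (lobeSin u τ w)]

/-- The distance from the ear. -/
noncomputable def lobeRadius (c₁ u τ w : ℝ) : ℝ :=
  (2 + w) * ((1 - u) * lobeGain c₁ (lobeCos u τ w) + u)

theorem lobeGain_combo_pos {c₁ u τ w : ℝ} (h0 : 0 < c₁) (h1 : c₁ < 1) (hu : u ∈ Icc (0 : ℝ) 1)
    (hw : -2 < w) : 0 < (1 - u) * lobeGain c₁ (lobeCos u τ w) + u := by
  have h := (lobeGain_mem h0 h1 (lobeCos_le_one (τ := τ) hu hw)).1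
  have := combo_pos hu (zero_lt_one.trans_le h) one_pos
  linarith

theorem lobeRadius_pos {c₁ u τ w : ℝ} (h0 : 0 < c₁) (h1 : c₁ < 1) (hu : u ∈ Icc (0 : ℝ) 1)
    (hw : -2 < w) : 0 < lobeRadius c₁ u τ w :=
  mul_pos (by linarith) (lobeGain_combo_pos h0 h1 hu hw)

/-- A loop around the left ear in the plane with the given `y`. For `u = 0` it starts and ends
vertically at `x = w`; for `u = 1` it is a round circle. -/
noncomputable def lobe (c₁ u τ w y : ℝ) : E3 :=
  !₂[-2 + lobeRadius c₁ u τ w * lobeCos u τ w, y, -(lobeRadius c₁ u τ w * lobeSin u τ w)]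

/-- Polar coordinates about the ear give the distance and the direction. The gain depends on the
direction alone, so the distance yields `w`; then the aspect is known and the direction yields `τ`.
-/
theorem lobe_inj {c₁ u τ w y τ' w' y' : ℝ} (h0 : 0 < c₁) (h1 : c₁ < 1) (hu : u ∈ Icc (0 : ℝ) 1)
    (hw : -2 < w) (hw' : -2 < w') (hτ : τ ∈ Ico (0 : ℝ) 1) (hτ' : τ' ∈ Ico (0 : ℝ) 1)
    (h : lobe c₁ u τ w y = lobe c₁ u τ' w' y') : τ = τ' ∧ w = w' ∧ y = y' := by
  obtain ⟨h2, h3, h4⟩ := vec3_inj.1 h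
  obtain ⟨h5, h6, h7⟩ := polar_inj (lobeRadius_pos h0 h1 hu hw) (lobeRadius_pos h0 h1 hu hw')
    (lobeCos_sq_add (τ := τ) hu hw) (lobeCos_sq_add (τ := τ') hu hw') (by linarith) (by linarith)
  rw [lobeRadius, lobeRadius, ← h6] at h5
  have h8 : w = w' := by
    have := mul_right_cancel₀ (lobeGain_combo_pos h0 h1 hu hw).ne' h5
    linarith
  subst h8
  have ha := (lobeAspect_pos hu hw).ne'
  have hn := lobeNorm_pos (τ := τ) hu hw
  have hn' := lobeNorm_pos (τ := τ') hu hw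
  rw [lobeCos, lobeCos] at h6
  rw [lobeSin, lobeSin, mul_div_assoc, mul_div_assoc] at h7
  have h9 := mul_left_cancel₀ ha h7
  obtain ⟨-, h10, h11⟩ := polar_inj (inv_pos.2 hn) (inv_pos.2 hn')
    (Real.cos_sq_add_sin_sq (2 * Real.pi * τ)) (Real.cos_sq_add_sin_sq (2 * Real.pi * τ'))
    (by rw [inv_mul_eq_div, inv_mul_eq_div]; exact h6)
    (by rw [inv_mul_eq_div, inv_mul_eq_div]; exact h9)
  exact ⟨two_pi_injOn hτ hτ' h10 h11, rfl, h3⟩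

theorem lobe_add_int (c₁ u τ w y : ℝ) (k : ℤ) : lobe c₁ u (τ + k) w y = lobe c₁ u τ w y := by
  have : 2 * Real.pi * (τ + k) = 2 * Real.pi * τ + k * (2 * Real.pi) := by ring
  simp only [lobe, lobeRadius, lobeCos, lobeSin, lobeNorm, this, Real.cos_add_int_mul_two_pi,
    Real.sin_add_int_mul_two_pi]

theorem lobe_one (c₁ τ w y : ℝ) : lobe c₁ 1 τ w y =
    !₂[-2 + (2 + w) * Real.cos (2 * Real.pi * τ), y,
      -((2 + w) * Real.sin (2 * Real.pi * τ))] := by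
  have ha : lobeAspect 1 w = 1 := by simp [lobeAspect]
  have hn : lobeNorm 1 τ w = 1 := by
    rw [lobeNorm, ha, one_mul, Real.cos_sq_add_sin_sq, Real.sqrt_one]
  simp [lobe, lobeRadius, lobeCos, lobeSin, ha, hn]

/-- This allows the gain to be controlled by the parameter instead of the distorted direction. As
the squared aspect is at most 2, the square of `c` times the norm is at most `c² (2 - c²) ≤ 1`. -/
theorem sq_le_lobeCos {τ w : ℝ} (hw : |w| ≤ 1 / 2) (hc : 0 < Real.cos (2 * Real.pi * τ)) :
    Real.cos (2 * Real.pi * τ) ^ 2 ≤ lobeCos 0 τ w := by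
  have hw' := abs_le.1 hw
  have hu : (0 : ℝ) ∈ Icc (0 : ℝ) 1 := by norm_num
  have hn := lobeNorm_pos (τ := τ) hu (by linarith : -2 < w)
  have hcs := Real.cos_sq_add_sin_sq (2 * Real.pi * τ)
  have ha0 := (lobeAspect_pos hu (by linarith : -2 < w)).le
  have ha : lobeAspect 0 w ^ 2 ≤ 2 := by
    have h1 : lobeAspect 0 w ≤ 4 / 3 := by
      rw [lobeAspect]
      have : 2 / (2 + w) ≤ 4 / 3 := by
        rw [div_le_div_iff₀ (by linarith) (by norm_num)]; linarith
      linarith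
    nlinarith
  have hsq := lobeNorm_sq 0 τ w
  set c := Real.cos (2 * Real.pi * τ)
  set s := Real.sin (2 * Real.pi * τ)
  rw [lobeCos, le_div_iff₀ hn]
  have h2 : (c * lobeNorm 0 τ w) ^ 2 ≤ 1 := by
    rw [mul_pow, hsq]
    have h3 : (lobeAspect 0 w * s) ^ 2 ≤ 2 * s ^ 2 := by
      rw [mul_pow]; exact mul_le_mul_of_nonneg_right ha (sq_nonneg s)
    have h4 : s ^ 2 = 1 - c ^ 2 := by linarith
    rw [h4] at h3
    nlinarith [sq_nonneg (1 - c ^ 2), sq_nonneg c]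
  have h5 : c * lobeNorm 0 τ w ≤ 1 := by nlinarith [mul_pos hc hn]
  calc c ^ 2 * lobeNorm 0 τ w = c * (c * lobeNorm 0 τ w) := by ring
    _ ≤ c * 1 := mul_le_mul_of_nonneg_left h5 hc.le
    _ = c := mul_one c

/-- Near direction 0 the gain is the reciprocal of the cosine, which makes the lobe a vertical
segment. The aspect `2 / (2 + w)` cancels the distance from the ear, so the height `-2 tan (2πτ)`
does not depend on `w`; lobes at different positions and around different ears therefore fit
together. -/
theorem lobe_vertical {c₁ τ w : ℝ} (y : ℝ) (h1 : c₁ < 1) (hw : |w| ≤ 1 / 2)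
    (hc : 0 < Real.cos (2 * Real.pi * τ)) (hcc : (1 + c₁) / 2 ≤ Real.cos (2 * Real.pi * τ) ^ 2) :
    lobe c₁ 0 τ w y =
      !₂[w, y, -(2 * Real.sin (2 * Real.pi * τ) / Real.cos (2 * Real.pi * τ))] := by
  have hw' := abs_le.1 hw
  have hn := lobeNorm_pos (τ := τ) (by norm_num : (0 : ℝ) ∈ Icc (0 : ℝ) 1) (by linarith : -2 < w)
  have hg := lobeGain_of_ge h1 (hcc.trans (sq_le_lobeCos hw hc))
  have hw2 : 2 + w ≠ 0 := by linarith
  rw [lobe, lobeRadius, hg, vec3_inj, lobeSin, lobeCos, lobeAspect]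
  set c := Real.cos (2 * Real.pi * τ)
  refine ⟨?_, rfl, ?_⟩
  · field_simp; ring
  · field_simp; ring

section ContDiff

variable {F : Type*} [NormedAddCommGroup F] [NormedSpace ℝ F] {c₁ : ℝ} {u τ w y : F → ℝ}

theorem ContDiff.lobeAspect (hu : ContDiff ℝ ∞ u) (hw : ContDiff ℝ ∞ w) (hw1 : ∀ z, -2 < w z) :
    ContDiff ℝ ∞ fun z => lobeAspect (u z) (w z) :=
  ((contDiff_const.sub hu).mul (contDiff_const.div (contDiff_const.add hw)
    fun z => by linarith [hw1 z])).add hu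

theorem ContDiff.lobeNorm (hu : ContDiff ℝ ∞ u) (hτ : ContDiff ℝ ∞ τ) (hw : ContDiff ℝ ∞ w)
    (hu1 : ∀ z, u z ∈ Icc (0 : ℝ) 1) (hw1 : ∀ z, -2 < w z) :
    ContDiff ℝ ∞ fun z => lobeNorm (u z) (τ z) (w z) :=
  (((contDiff_const.mul hτ).cos.pow 2).add (((hu.lobeAspect hw hw1).mul
    (contDiff_const.mul hτ).sin).pow 2)).sqrt fun z => (lobeNorm_arg_pos (hu1 z) (hw1 z)).ne'

theorem ContDiff.lobeCos (hu : ContDiff ℝ ∞ u) (hτ : ContDiff ℝ ∞ τ) (hw : ContDiff ℝ ∞ w)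
    (hu1 : ∀ z, u z ∈ Icc (0 : ℝ) 1) (hw1 : ∀ z, -2 < w z) :
    ContDiff ℝ ∞ fun z => lobeCos (u z) (τ z) (w z) :=
  (contDiff_const.mul hτ).cos.div (hu.lobeNorm hτ hw hu1 hw1)
    fun z => (lobeNorm_pos (hu1 z) (hw1 z)).ne'

theorem ContDiff.lobeSin (hu : ContDiff ℝ ∞ u) (hτ : ContDiff ℝ ∞ τ) (hw : ContDiff ℝ ∞ w)
    (hu1 : ∀ z, u z ∈ Icc (0 : ℝ) 1) (hw1 : ∀ z, -2 < w z) :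
    ContDiff ℝ ∞ fun z => lobeSin (u z) (τ z) (w z) :=
  ((hu.lobeAspect hw hw1).mul (contDiff_const.mul hτ).sin).div (hu.lobeNorm hτ hw hu1 hw1)
    fun z => (lobeNorm_pos (hu1 z) (hw1 z)).ne'

theorem ContDiff.lobeRadius (h0 : 0 < c₁) (h1 : c₁ < 1) (hu : ContDiff ℝ ∞ u)
    (hτ : ContDiff ℝ ∞ τ) (hw : ContDiff ℝ ∞ w)
    (hu1 : ∀ z, u z ∈ Icc (0 : ℝ) 1) (hw1 : ∀ z, -2 < w z) :
    ContDiff ℝ ∞ fun z => lobeRadius c₁ (u z) (τ z) (w z) :=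
  (contDiff_const.add hw).mul (((contDiff_const.sub hu).mul
    ((contDiff_lobeGain h0 h1).comp (hu.lobeCos hτ hw hu1 hw1))).add hu)

theorem ContDiff.lobe (h0 : 0 < c₁) (h1 : c₁ < 1) (hu : ContDiff ℝ ∞ u)
    (hτ : ContDiff ℝ ∞ τ) (hw : ContDiff ℝ ∞ w) (hy : ContDiff ℝ ∞ y)
    (hu1 : ∀ z, u z ∈ Icc (0 : ℝ) 1) (hw1 : ∀ z, -2 < w z) :
    ContDiff ℝ ∞ fun z => lobe c₁ (u z) (τ z) (w z) (y z) :=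
  (contDiff_const.add ((hu.lobeRadius h0 h1 hτ hw hu1 hw1).mul (hu.lobeCos hτ hw hu1 hw1))).vec3
    hy ((hu.lobeRadius h0 h1 hτ hw hu1 hw1).mul (hu.lobeSin hτ hw hu1 hw1)).neg

end ContDiff

/-- A curve that follows a lobe turns clockwise around the ear. -/
theorem lobe_turns {c₁ u τ w' : ℝ} {w : ℝ → ℝ} (h0 : 0 < c₁) (h1 : c₁ < 1)
    (hu : u ∈ Icc (0 : ℝ) 1) (hw : ContDiff ℝ ∞ w) (hw1 : ∀ τ, -2 < w τ)
    (hw' : HasDerivAt w w' τ) (hb : |w'| < 4 * Real.pi * (2 + w τ)) :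
    ∃ x' z' : ℝ,
      HasDerivAt (fun t => -2 + lobeRadius c₁ u t (w t) * lobeCos u t (w t)) x' τ ∧
      HasDerivAt (fun t => -(lobeRadius c₁ u t (w t) * lobeSin u t (w t))) z' τ ∧
      0 < -(lobeRadius c₁ u τ (w τ) * lobeSin u τ (w τ)) * x' -
        (-2 + lobeRadius c₁ u τ (w τ) * lobeCos u τ (w τ) + 2) * z' := by
  have hu' : ContDiff ℝ ∞ fun _ : ℝ => u := contDiff_const
  have hid : ContDiff ℝ ∞ fun t : ℝ => t := contDiff_id
  have hd : ∀ {f : ℝ → ℝ}, ContDiff ℝ ∞ f → HasDerivAt f (deriv f τ) τ :=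
    fun hf => (hf.differentiable (by simp) τ).hasDerivAt
  have hR := hd (hu'.lobeRadius h0 h1 hid hw (fun _ => hu) hw1)
  have hC := hd (hu'.lobeCos hid hw (fun _ => hu) hw1)
  have hS := hd (hu'.lobeSin hid hw (fun _ => hu) hw1)
  have hN := hd (hu'.lobeNorm hid hw (fun _ => hu) hw1)
  set R' := deriv (fun t => lobeRadius c₁ u t (w t)) τ
  set C' := deriv (fun t => lobeCos u t (w t)) τ
  set S' := deriv (fun t => lobeSin u t (w t)) τ
  set N' := deriv (fun t => lobeNorm u t (w t)) τ
  have hω : HasDerivAt (fun t : ℝ => 2 * Real.pi * t) (2 * Real.pi) τ := by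
    simpa using (hasDerivAt_id τ).const_mul (2 * Real.pi)
  have hA : HasDerivAt (fun t => lobeAspect u (w t)) (-((1 - u) * (2 * w' / (2 + w τ) ^ 2))) τ := by
    have h := (((hasDerivAt_const τ (2 : ℝ)).div (hw'.const_add 2)
      (by linarith [hw1 τ])).const_mul (1 - u)).add_const u
    refine h.congr_deriv ?_
    ring
  have hNne : ∀ t, lobeNorm u t (w t) ≠ 0 := fun t => (lobeNorm_pos hu (hw1 t)).ne'
  -- Differentiating norm times cosine and norm times sine avoids the derivative of the square root.
  have e1 : N' * lobeCos u τ (w τ) + lobeNorm u τ (w τ) * C' =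
      -Real.sin (2 * Real.pi * τ) * (2 * Real.pi) := by
    have : (fun t => lobeNorm u t (w t) * lobeCos u t (w t)) =
        fun t => Real.cos (2 * Real.pi * t) := by
      funext t; rw [lobeCos, mul_div_cancel₀ _ (hNne t)]
    have h2 := hN.mul hC
    exact h2.unique (by simpa only [Pi.mul_def, this] using hω.cos)
  have e2 : N' * lobeSin u τ (w τ) + lobeNorm u τ (w τ) * S' =
      -((1 - u) * (2 * w' / (2 + w τ) ^ 2)) * Real.sin (2 * Real.pi * τ) +
        lobeAspect u (w τ) * (Real.cos (2 * Real.pi * τ) * (2 * Real.pi)) := by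
    have : (fun t => lobeNorm u t (w t) * lobeSin u t (w t)) =
        fun t => lobeAspect u (w t) * Real.sin (2 * Real.pi * t) := by
      funext t; rw [lobeSin, mul_div_cancel₀ _ (hNne t)]
    have h2 := hN.mul hS
    exact h2.unique (by simpa only [Pi.mul_def, this] using hA.mul hω.sin)
  refine ⟨_, _, (hR.mul hC).const_add (-2), (hR.mul hS).neg, ?_⟩
  have hN0 := lobeNorm_pos (τ := τ) hu (hw1 τ)
  have hR0 := lobeRadius_pos (τ := τ) h0 h1 hu (hw1 τ)
  have ec : lobeNorm u τ (w τ) * lobeCos u τ (w τ) = Real.cos (2 * Real.pi * τ) := by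
    rw [lobeCos, mul_div_cancel₀ _ hN0.ne']
  have es : lobeNorm u τ (w τ) * lobeSin u τ (w τ) =
      lobeAspect u (w τ) * Real.sin (2 * Real.pi * τ) := by
    rw [lobeSin, mul_div_cancel₀ _ hN0.ne']
  have hcs := Real.cos_sq_add_sin_sq (2 * Real.pi * τ)
  -- This is the angular velocity up to positive factors. A change of `w` distorts the aspect; the
  -- bound on `w'` is precisely what the factor `|sin cos| ≤ 1/2` requires to keep the turn going
  -- forward.
  have hpos : 0 < 2 * Real.pi * lobeAspect u (w τ) -
      (1 - u) * (2 * w' / (2 + w τ) ^ 2) *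
        (Real.sin (2 * Real.pi * τ) * Real.cos (2 * Real.pi * τ)) := by
    set c := Real.cos (2 * Real.pi * τ)
    set s := Real.sin (2 * Real.pi * τ)
    have hsc : |s * c| ≤ 1 / 2 := by
      rw [abs_le]
      constructor <;> nlinarith [sq_nonneg (s - c), sq_nonneg (s + c)]
    have hw2 : 0 < 2 + w τ := by linarith [hw1 τ]
    have h3 : |2 * w' / (2 + w τ) ^ 2 * (s * c)| < 2 * Real.pi * (2 / (2 + w τ)) := by
      rw [abs_mul, abs_div, abs_mul, abs_of_pos (two_pos : (0 : ℝ) < 2),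
        abs_of_pos (by positivity : 0 < (2 + w τ) ^ 2)]
      calc 2 * |w'| / (2 + w τ) ^ 2 * |s * c| ≤ 2 * |w'| / (2 + w τ) ^ 2 * (1 / 2) :=
            mul_le_mul_of_nonneg_left hsc (by positivity)
        _ = |w'| / (2 + w τ) ^ 2 := by ring
        _ < 4 * Real.pi * (2 + w τ) / (2 + w τ) ^ 2 :=
            div_lt_div_of_pos_right hb (by positivity)
        _ = 2 * Real.pi * (2 / (2 + w τ)) := by field_simp; ring
    have h4 := combo_pos hu (sub_pos.2 (lt_of_abs_lt h3)) Real.two_pi_pos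
    rw [lobeAspect]
    linarith
  have e3 : lobeNorm u τ (w τ) ^ 2 * (lobeCos u τ (w τ) * S' - lobeSin u τ (w τ) * C') =
      2 * Real.pi * lobeAspect u (w τ) - (1 - u) * (2 * w' / (2 + w τ) ^ 2) *
        (Real.sin (2 * Real.pi * τ) * Real.cos (2 * Real.pi * τ)) := by
    linear_combination (lobeNorm u τ (w τ) * lobeCos u τ (w τ)) * e2 -
      (lobeNorm u τ (w τ) * lobeSin u τ (w τ)) * e1 +
      (-((1 - u) * (2 * w' / (2 + w τ) ^ 2)) * Real.sin (2 * Real.pi * τ) +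
        lobeAspect u (w τ) * (Real.cos (2 * Real.pi * τ) * (2 * Real.pi))) * ec -
      (-Real.sin (2 * Real.pi * τ) * (2 * Real.pi)) * es +
      2 * Real.pi * lobeAspect u (w τ) * hcs
  have h5 : 0 < lobeCos u τ (w τ) * S' - lobeSin u τ (w τ) * C' := by
    rw [← e3] at hpos
    exact (pos_iff_pos_of_mul_pos hpos).1 (by positivity)
  have h6 := mul_pos (pow_pos hR0 2) h5
  linarith

/-! ### Strands on the Lorenz template -/

theorem exists_deriv_smoothTransition_bound : ∃ M : ℝ, 1 ≤ M ∧
    ∀ x, |deriv Real.smoothTransition x| ≤ M := by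
  have hS : ContDiff ℝ ∞ Real.smoothTransition := Real.smoothTransition.contDiff
  obtain ⟨M, hM⟩ := isCompact_Icc.exists_bound_of_continuousOn
    ((hS.continuous_deriv (by simp)).continuousOn (s := Icc (0 : ℝ) 1))
  refine ⟨max M 1, le_max_right _ _, fun x => ?_⟩
  by_cases hx : x ∈ Icc (0 : ℝ) 1
  · exact (hM x hx).trans (le_max_left _ _)
  · have h0 : deriv Real.smoothTransition x = 0 := by
      rcases lt_or_ge x 0 with h | h
      · have : Real.smoothTransition =ᶠ[nhds x] fun _ => 0 := by
          filter_upwards [Iio_mem_nhds h] with y hy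
          exact Real.smoothTransition.zero_of_nonpos (le_of_lt hy)
        rw [this.deriv_eq, deriv_const]
      · have h' : 1 < x := by
          by_contra h'
          exact hx ⟨h, not_lt.1 h'⟩
        have : Real.smoothTransition =ᶠ[nhds x] fun _ => 1 := by
          filter_upwards [Ioi_mem_nhds h'] with y hy
          exact Real.smoothTransition.one_of_one_le (le_of_lt hy)
        rw [this.deriv_eq, deriv_const]
    rw [h0, abs_zero]
    exact zero_le_one.trans (le_max_right _ _)

/-- Sizes for a Lorenz link with parameter pair `(p, q)`: the strands cross the branch line
between `-W` and `W`, they are vertical for `|τ| ≤ c₀`, and `c₁` controls the shape of the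
lobes. -/
structure LobeParams (p q : ℕ) where
  W : ℝ
  c₁ : ℝ
  c₀ : ℝ
  size_pos : (2 : ℝ) ≤ p + q
  W_pos : 0 < W
  W_le : W ≤ 1 / 4
  c₁_eq : c₁ = 1 - W / (4 * (p + q))
  c₀_pos : 0 < c₀
  c₀_le : c₀ ≤ 1 / 16
  zone : ∀ τ : ℝ, |τ| ≤ c₀ →
    0 < Real.cos (2 * Real.pi * τ) ∧ (1 + c₁) / 2 ≤ Real.cos (2 * Real.pi * τ) ^ 2
  deriv_le : ∀ x, W * |deriv Real.smoothTransition x| ≤ 1 / 4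

/-- The choices depend on each other in this order: `W` is small against the slope of the
transition, `c₁` is close to 1 in terms of `W`, and `c₀` is small in terms of `c₁`. -/
theorem nonempty_lobeParams {p q : ℕ} (hp : 1 ≤ p) (hq : 1 ≤ q) : Nonempty (LobeParams p q) := by
  have hn : (2 : ℝ) ≤ p + q := by
    have h1 : (1 : ℝ) ≤ p := by exact_mod_cast hp
    have h2 : (1 : ℝ) ≤ q := by exact_mod_cast hq
    linarith
  obtain ⟨M, hM1, hM⟩ := exists_deriv_smoothTransition_bound
  set W : ℝ := 1 / (4 * M) with hW
  have hW0 : 0 < W := by positivity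
  set c₁ : ℝ := 1 - W / (4 * (p + q)) with hc₁
  have hc : c₁ < 1 := by
    have : 0 < W / (4 * (p + q)) := by positivity
    linarith
  have hcont : Continuous fun τ : ℝ => Real.cos (2 * Real.pi * τ) := by fun_prop
  have h1 := (hcont.tendsto 0).eventually_const_lt (u := 0) (by simp)
  have h2 := ((hcont.pow 2).tendsto 0).eventually_const_lt (u := (1 + c₁) / 2) (by
    simp; linarith)
  obtain ⟨δ, hδ, h3⟩ := Metric.eventually_nhds_iff.1 (h1.and h2)
  refine ⟨⟨W, c₁, min (δ / 2) (1 / 16), hn, hW0, ?_, rfl, by positivity, min_le_right _ _,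
    fun τ hτ => ?_, fun x => ?_⟩⟩
  · rw [hW]
    exact one_div_le_one_div_of_le (by norm_num) (by linarith)
  · have h4 := @h3 τ (by
      rw [Real.dist_eq, sub_zero]
      linarith [hτ.trans (min_le_left _ _)])
    exact ⟨h4.1, h4.2.le⟩
  · rw [hW, div_mul_eq_mul_div, one_mul, div_le_div_iff₀ (by positivity) (by norm_num)]
    linarith [hM x]

theorem lorenz_size_bounds {p q : ℕ} (i : Fin (p + q)) {S : ℝ} (h0 : 0 ≤ S) (h1 : S ≤ 1) :
    -((p : ℝ) + q) ≤ i - q + 1 / 2 + lorenzShift p q i * S ∧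
      i - q + 1 / 2 + lorenzShift p q i * S ≤ (p : ℝ) + q := by
  have h2 : (i : ℝ) + 1 ≤ p + q := by exact_mod_cast i.2
  have h3 : (0 : ℝ) ≤ i := by positivity
  have h4 : (0 : ℝ) ≤ p := by positivity
  have h5 : (0 : ℝ) ≤ q := by positivity
  rw [lorenzShift]
  split_ifs with h
  · have h6 : (i : ℝ) + 1 ≤ q := by exact_mod_cast h
    constructor <;> nlinarith
  · have h6 : (q : ℝ) ≤ i := by exact_mod_cast not_lt.1 h
    constructor <;> nlinarith

/-! ### Positions near the branch line, and the bump that separates the two kinds of strands. -/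

namespace LobeParams

variable {p q : ℕ} (P : LobeParams p q)

theorem c₁_lt_one : P.c₁ < 1 := by
  have : 0 < P.W / (4 * (p + q)) := div_pos P.W_pos (by linarith [P.size_pos])
  linarith [P.c₁_eq]

theorem le_c₁ : 15 / 16 ≤ P.c₁ := by
  have : P.W / (4 * (p + q)) ≤ 1 / 16 := by
    rw [div_le_div_iff₀ (by linarith [P.size_pos]) (by norm_num)]
    linarith [P.size_pos, P.W_le]
  linarith [P.c₁_eq]

theorem c₁_pos : 0 < P.c₁ := by linarith [P.le_c₁]

/-- The position of the strand `i` when it is near the branch line. -/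
noncomputable def pos (i : Fin (p + q)) (τ : ℝ) : ℝ :=
  P.W * ((i - q + 1 / 2 + lorenzShift p q i * Real.smoothTransition (8 * τ - 13 / 2)) / (p + q))

theorem abs_pos_le (i : Fin (p + q)) (τ : ℝ) : |P.pos i τ| ≤ P.W := by
  obtain ⟨h1, h2⟩ := lorenz_size_bounds i
    (Real.smoothTransition.nonneg (8 * τ - 13 / 2)) (Real.smoothTransition.le_one (8 * τ - 13 / 2))
  have hn : (0 : ℝ) < p + q := by linarith [P.size_pos]
  rw [pos, abs_mul, abs_of_pos P.W_pos]
  refine mul_le_of_le_one_right P.W_pos.le ?_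
  rw [abs_div, abs_of_pos hn, div_le_one hn, abs_le]
  exact ⟨h1, h2⟩

theorem contDiff_pos (i : Fin (p + q)) : ContDiff ℝ ∞ (P.pos i) := by
  have hS : ContDiff ℝ ∞ Real.smoothTransition := Real.smoothTransition.contDiff
  exact contDiff_const.mul ((contDiff_const.add (contDiff_const.mul
    (hS.comp ((contDiff_const.mul contDiff_id).sub contDiff_const)))).div_const _)

theorem pos_of_le (i : Fin (p + q)) {τ : ℝ} (hτ : τ ≤ 13 / 16) :
    P.pos i τ = P.W * ((i - q + 1 / 2) / (p + q)) := by
  rw [pos, Real.smoothTransition.zero_of_nonpos (by linarith), mul_zero, add_zero]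

theorem pos_of_ge (i : Fin (p + q)) {τ : ℝ} (hτ : 15 / 16 ≤ τ) :
    P.pos i τ = P.W * ((lorenzPerm p q i - q + 1 / 2) / (p + q)) := by
  rw [pos, Real.smoothTransition.one_of_one_le (by linarith), lorenzPerm_cast]
  ring

theorem pos_glue (i : Fin (p + q)) {τ : ℝ} (hτ : τ ∈ Icc (1 - P.c₀) 1) :
    P.pos i τ = P.pos (lorenzPerm p q i) (τ - 1) := by
  rw [pos_of_ge _ _ (by linarith [hτ.1, P.c₀_le]), pos_of_le _ _ (by linarith [hτ.2])]

theorem pos_lt_of_same {i j : Fin (p + q)} (h : i < j)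
    (hs : lorenzSide p q i = lorenzSide p q j) (τ : ℝ) : P.pos i τ < P.pos j τ := by
  have hs' : lorenzShift p q i = lorenzShift p q j := by
    simp only [lorenzSide] at hs
    simp only [lorenzShift]
    split_ifs at hs ⊢ <;> first | rfl | norm_num at hs
  have hij : (i : ℝ) < j := by exact_mod_cast h
  have hn : (0 : ℝ) < p + q := by linarith [P.size_pos]
  rw [pos, pos, hs']
  exact mul_lt_mul_of_pos_left (div_lt_div_of_pos_right (by linarith) hn) P.W_pos

theorem pos_inj_of_same {i j : Fin (p + q)} (hs : lorenzSide p q i = lorenzSide p q j) {τ : ℝ}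
    (h : P.pos i τ = P.pos j τ) : i = j := by
  rcases lt_trichotomy i j with hij | hij | hij
  · exact absurd h (P.pos_lt_of_same hij hs τ).ne
  · exact hij
  · exact absurd h (P.pos_lt_of_same hij hs.symm τ).ne'

/-- The stretching takes place between 13/16 and 15/16. Near the ends of the time interval all
strands are therefore in the `p + q` distinct slots, permuted at the later end. -/
theorem pos_inj_of_zone {i j : Fin (p + q)} {τ : ℝ} (hτ : τ ≤ P.c₀ ∨ 1 - P.c₀ ≤ τ)
    (h : P.pos i τ = P.pos j τ) : i = j := by
  have hn : (0 : ℝ) < p + q := by linarith [P.size_pos]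
  have hinj : ∀ k l : Fin (p + q), P.W * ((k - q + 1 / 2 : ℝ) / (p + q)) =
      P.W * ((l - q + 1 / 2) / (p + q)) → k = l := by
    intro k l hkl
    have h1 := mul_left_cancel₀ P.W_pos.ne' hkl
    rw [div_left_inj' hn.ne'] at h1
    have h2 : (k : ℝ) = l := by linarith
    ext
    exact_mod_cast h2
  rcases hτ with hτ | hτ
  · rw [pos_of_le _ _ (by linarith [P.c₀_le]), pos_of_le _ _ (by linarith [P.c₀_le])] at h
    exact hinj i j h
  · rw [pos_of_ge _ _ (by linarith [P.c₀_le]), pos_of_ge _ _ (by linarith [P.c₀_le])] at h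
    exact (lorenzPerm p q).injective (hinj _ _ h)

theorem side_mul_pos_ge (i : Fin (p + q)) {τ : ℝ} (hτ : τ ≤ 13 / 16) :
    P.W / (2 * (p + q)) ≤ lorenzSide p q i * P.pos i τ := by
  have hn : (0 : ℝ) < p + q := by linarith [P.size_pos]
  rw [P.pos_of_le i hτ]
  have h1 : (1 : ℝ) / 2 ≤ lorenzSide p q i * (i - q + 1 / 2) := by
    rw [lorenzSide]
    split_ifs with h
    · have h6 : (i : ℝ) + 1 ≤ q := by exact_mod_cast h
      linarith
    · have h6 : (q : ℝ) ≤ i := by exact_mod_cast not_lt.1 h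
      linarith
  calc P.W / (2 * (p + q)) = P.W / (p + q) * (1 / 2) := by field_simp
    _ ≤ P.W / (p + q) * (lorenzSide p q i * (i - q + 1 / 2)) :=
      mul_le_mul_of_nonneg_left h1 (div_pos P.W_pos hn).le
    _ = _ := by field_simp

theorem hasDerivAt_pos (i : Fin (p + q)) (τ : ℝ) :
    ∃ w', HasDerivAt (P.pos i) w' τ ∧ |w'| ≤ 2 := by
  have hn : (0 : ℝ) < p + q := by linarith [P.size_pos]
  have hS : ContDiff ℝ ∞ Real.smoothTransition := Real.smoothTransition.contDiff
  have h1 : HasDerivAt (fun τ : ℝ => 8 * τ - 13 / 2) 8 τ := by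
    simpa using ((hasDerivAt_id τ).const_mul 8).sub_const (13 / 2)
  have h2 := (hS.differentiable (by simp) (8 * τ - 13 / 2)).hasDerivAt.comp τ h1
  have h3 := (((h2.const_mul (lorenzShift p q i)).const_add
    ((i : ℝ) - q + 1 / 2)).div_const ((p : ℝ) + q)).const_mul P.W
  refine ⟨_, h3, ?_⟩
  have h4 := P.deriv_le (8 * τ - 13 / 2)
  have h5 : |lorenzShift p q i / (p + q)| ≤ 1 := by
    rw [abs_div, abs_of_pos hn, div_le_one hn, abs_le, lorenzShift]
    have h6 : (0 : ℝ) ≤ p := by positivity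
    have h7 : (0 : ℝ) ≤ q := by positivity
    split_ifs <;> constructor <;> linarith
  set d := deriv Real.smoothTransition (8 * τ - 13 / 2)
  have h8 : P.W * (lorenzShift p q i * (d * 8) / (p + q)) =
      8 * (P.W * d) * (lorenzShift p q i / (p + q)) := by ring
  rw [h8, abs_mul, abs_mul, abs_mul, abs_of_pos P.W_pos, abs_of_pos (by norm_num : (0 : ℝ) < 8)]
  have h9 : 0 ≤ 8 * (P.W * |d|) := by have := P.W_pos; positivity
  nlinarith [abs_nonneg (lorenzShift p q i / (p + q))]

/-- A bump function that vanishes where the strands are vertical. -/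
noncomputable def bump (τ : ℝ) : ℝ :=
  P.W * (Real.smoothTransition (τ - P.c₀) * Real.smoothTransition (1 - P.c₀ - τ))

theorem contDiff_bump : ContDiff ℝ ∞ P.bump := by
  have hS : ContDiff ℝ ∞ Real.smoothTransition := Real.smoothTransition.contDiff
  exact contDiff_const.mul ((hS.comp (contDiff_id.sub contDiff_const)).mul
    (hS.comp (contDiff_const.sub contDiff_id)))

theorem bump_nonneg (τ : ℝ) : 0 ≤ P.bump τ :=
  mul_nonneg P.W_pos.le (mul_nonneg (Real.smoothTransition.nonneg _)
    (Real.smoothTransition.nonneg _))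

theorem bump_le (τ : ℝ) : P.bump τ ≤ P.W :=
  mul_le_of_le_one_right P.W_pos.le (mul_le_one₀ (Real.smoothTransition.le_one _)
    (Real.smoothTransition.nonneg _) (Real.smoothTransition.le_one _))

theorem bump_eq_zero_iff (τ : ℝ) : P.bump τ = 0 ↔ τ ≤ P.c₀ ∨ 1 - P.c₀ ≤ τ := by
  rw [bump, mul_eq_zero, mul_eq_zero, Real.smoothTransition.zero_iff_nonpos,
    Real.smoothTransition.zero_iff_nonpos]
  have := P.W_pos.ne'
  constructor
  · rintro (h | h | h)
    · exact absurd h this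
    · exact Or.inl (by linarith)
    · exact Or.inr (by linarith)
  · rintro (h | h)
    · exact Or.inr (Or.inl (by linarith))
    · exact Or.inr (Or.inr (by linarith))

theorem hasDerivAt_bump (τ : ℝ) : ∃ b', HasDerivAt P.bump b' τ ∧ |b'| ≤ 1 := by
  have hS : ContDiff ℝ ∞ Real.smoothTransition := Real.smoothTransition.contDiff
  have h1 : HasDerivAt (fun τ : ℝ => τ - P.c₀) 1 τ := by
    simpa using (hasDerivAt_id τ).sub_const P.c₀
  have h2 : HasDerivAt (fun τ : ℝ => 1 - P.c₀ - τ) (-1) τ := by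
    simpa using (hasDerivAt_id τ).const_sub (1 - P.c₀)
  have h3 := (((hS.differentiable (by simp) (τ - P.c₀)).hasDerivAt.comp τ h1).mul
    ((hS.differentiable (by simp) (1 - P.c₀ - τ)).hasDerivAt.comp τ h2)).const_mul P.W
  refine ⟨_, h3, ?_⟩
  simp only [Function.comp_apply]
  have hd1 := P.deriv_le (τ - P.c₀)
  have hd2 := P.deriv_le (1 - P.c₀ - τ)
  set d1 := deriv Real.smoothTransition (τ - P.c₀)
  set d2 := deriv Real.smoothTransition (1 - P.c₀ - τ)
  have s10 := Real.smoothTransition.nonneg (τ - P.c₀)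
  have s11 := Real.smoothTransition.le_one (τ - P.c₀)
  have s20 := Real.smoothTransition.nonneg (1 - P.c₀ - τ)
  have s21 := Real.smoothTransition.le_one (1 - P.c₀ - τ)
  set s1 := Real.smoothTransition (τ - P.c₀)
  set s2 := Real.smoothTransition (1 - P.c₀ - τ)
  have e1 : |P.W * d1| ≤ 1 / 4 := by rwa [abs_mul, abs_of_pos P.W_pos]
  have e2 : |P.W * d2| ≤ 1 / 4 := by rwa [abs_mul, abs_of_pos P.W_pos]
  have e3 : P.W * (d1 * 1 * s2 + s1 * (d2 * -1)) = P.W * d1 * s2 - P.W * d2 * s1 := by ring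
  rw [e3, abs_le]
  obtain ⟨a1, a2⟩ := abs_le.1 e1
  obtain ⟨a3, a4⟩ := abs_le.1 e2
  constructor <;> nlinarith

theorem zone_cos {τ : ℝ} (hτ : |τ| ≤ P.c₀ ∨ |τ - 1| ≤ P.c₀) :
    0 < Real.cos (2 * Real.pi * τ) ∧ (1 + P.c₁) / 2 ≤ Real.cos (2 * Real.pi * τ) ^ 2 := by
  rcases hτ with h | h
  · exact P.zone τ h
  · have h1 := P.zone _ h
    have h2 : 2 * Real.pi * (τ - 1) = 2 * Real.pi * τ - 2 * Real.pi := by ring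
    rwa [h2, Real.cos_sub_two_pi] at h1

/-- A vertical strand passes each height only once. -/
theorem vertical_inj {τ τ' : ℝ} (hτ : τ ∈ Ico (0 : ℝ) 1) (hτ' : τ' ∈ Ico (0 : ℝ) 1)
    (h1 : 0 < Real.cos (2 * Real.pi * τ)) (h2 : 0 < Real.cos (2 * Real.pi * τ'))
    (h : -(2 * Real.sin (2 * Real.pi * τ) / Real.cos (2 * Real.pi * τ)) =
      -(2 * Real.sin (2 * Real.pi * τ') / Real.cos (2 * Real.pi * τ'))) : τ = τ' := by
  rw [neg_inj, div_eq_div_iff h1.ne' h2.ne'] at h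
  obtain ⟨-, h3, h4⟩ := polar_inj h2 h1 (Real.cos_sq_add_sin_sq (2 * Real.pi * τ))
    (Real.cos_sq_add_sin_sq (2 * Real.pi * τ')) (mul_comm _ _) (by linarith)
  exact two_pi_injOn hτ hτ' h3 h4

theorem zone_of_bump {τ : ℝ} (hτ : τ ∈ Ico (0 : ℝ) 1) (h : P.bump τ = 0) :
    |τ| ≤ P.c₀ ∨ |τ - 1| ≤ P.c₀ := by
  rcases (P.bump_eq_zero_iff τ).1 h with h | h
  · left; rw [abs_of_nonneg hτ.1]; exact h
  · right; rw [abs_le]; constructor <;> linarith [hτ.2, P.c₀_pos]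

end LobeParams

theorem lorenzSide_sq {p q : ℕ} (i : Fin (p + q)) : lorenzSide p q i * lorenzSide p q i = 1 := by
  rcases lorenzSide_cases i with h | h <;> rw [h] <;> norm_num

theorem abs_lorenzSide {p q : ℕ} (i : Fin (p + q)) : |lorenzSide p q i| = 1 := by
  rcases lorenzSide_cases i with h | h <;> rw [h] <;> norm_num

theorem unitInterval_zero_mem : (0 : ℝ) ∈ Icc (0 : ℝ) 1 := by norm_num

/-! ### Strands on the template, and the isotopy that flattens the bands. -/

namespace LobeParams

variable {p q : ℕ} (P : LobeParams p q)

/-- The position in the lobe that the strand `i` runs through. -/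
noncomputable def lobePos (i : Fin (p + q)) (τ : ℝ) : ℝ := -(lorenzSide p q i * P.pos i τ)

theorem abs_lobePos_le (i : Fin (p + q)) (τ : ℝ) : |P.lobePos i τ| ≤ 1 / 4 := by
  rw [lobePos, abs_neg, abs_mul, abs_lorenzSide, one_mul]
  exact (P.abs_pos_le i τ).trans P.W_le

theorem lobePos_gt (i : Fin (p + q)) (τ : ℝ) : -2 < P.lobePos i τ := by
  linarith [(abs_le.1 (P.abs_lobePos_le i τ)).1]

theorem contDiff_lobePos (i : Fin (p + q)) : ContDiff ℝ ∞ (P.lobePos i) :=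
  (contDiff_const.mul (P.contDiff_pos i)).neg

theorem hasDerivAt_lobePos (i : Fin (p + q)) (τ : ℝ) :
    ∃ w', HasDerivAt (P.lobePos i) w' τ ∧ |w'| < 4 * Real.pi * (2 + P.lobePos i τ) := by
  obtain ⟨w', h1, h2⟩ := P.hasDerivAt_pos i τ
  refine ⟨_, (h1.const_mul (lorenzSide p q i)).neg, ?_⟩
  rw [abs_neg, abs_mul, abs_lorenzSide, one_mul]
  have := (abs_le.1 (P.abs_lobePos_le i τ)).1
  nlinarith [Real.pi_gt_three]

/-- Distance of the strand `i` from its ear. -/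
noncomputable def earRadius (i : Fin (p + q)) (τ : ℝ) : ℝ :=
  lobeRadius P.c₁ 0 τ (P.lobePos i τ)

noncomputable def earCos (i : Fin (p + q)) (τ : ℝ) : ℝ := lobeCos 0 τ (P.lobePos i τ)

noncomputable def earSin (i : Fin (p + q)) (τ : ℝ) : ℝ := lobeSin 0 τ (P.lobePos i τ)

theorem earCos_sq_add (i : Fin (p + q)) (τ : ℝ) :
    P.earCos i τ ^ 2 + P.earSin i τ ^ 2 = 1 :=
  lobeCos_sq_add unitInterval_zero_mem (P.lobePos_gt i τ)

theorem earRadius_pos (i : Fin (p + q)) (τ : ℝ) : 0 < P.earRadius i τ :=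
  lobeRadius_pos P.c₁_pos P.c₁_lt_one unitInterval_zero_mem (P.lobePos_gt i τ)

/-- First coordinate of the strand `i`. -/
noncomputable def xpos (i : Fin (p + q)) (τ : ℝ) : ℝ :=
  -lorenzSide p q i * (-2 + P.earRadius i τ * P.earCos i τ)

/-- Third coordinate of the strand `i`. -/
noncomputable def height (i : Fin (p + q)) (τ : ℝ) : ℝ := -(P.earRadius i τ * P.earSin i τ)

theorem contDiff_xpos (i : Fin (p + q)) : ContDiff ℝ ∞ (P.xpos i) := by
  have hu : ContDiff ℝ ∞ fun _ : ℝ => (0 : ℝ) := contDiff_const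
  exact contDiff_const.mul (contDiff_const.add
    ((hu.lobeRadius P.c₁_pos P.c₁_lt_one contDiff_id (P.contDiff_lobePos i)
      (fun _ => unitInterval_zero_mem) (P.lobePos_gt i)).mul
    (hu.lobeCos contDiff_id (P.contDiff_lobePos i)
      (fun _ => unitInterval_zero_mem) (P.lobePos_gt i))))

theorem contDiff_height (i : Fin (p + q)) : ContDiff ℝ ∞ (P.height i) := by
  have hu : ContDiff ℝ ∞ fun _ : ℝ => (0 : ℝ) := contDiff_const
  exact ((hu.lobeRadius P.c₁_pos P.c₁_lt_one contDiff_id (P.contDiff_lobePos i)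
      (fun _ => unitInterval_zero_mem) (P.lobePos_gt i)).mul
    (hu.lobeSin contDiff_id (P.contDiff_lobePos i)
      (fun _ => unitInterval_zero_mem) (P.lobePos_gt i))).neg

theorem lobe_eq (i : Fin (p + q)) (τ y : ℝ) : lobe P.c₁ 0 τ (P.lobePos i τ) y =
    !₂[-lorenzSide p q i * P.xpos i τ, y, P.height i τ] := by
  rw [lobe, xpos, height, earRadius, earCos, earSin, vec3_inj]
  refine ⟨?_, rfl, rfl⟩
  rw [← mul_assoc, neg_mul_neg, lorenzSide_sq, one_mul]

/-- The strand turns clockwise around the left or counterclockwise around the right ear. -/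
theorem turns (i : Fin (p + q)) (τ : ℝ) : 0 < P.height i τ *
    (-lorenzSide p q i * deriv (P.xpos i) τ) -
      (-lorenzSide p q i * P.xpos i τ + 2) * deriv (P.height i) τ := by
  obtain ⟨w', h1, h2⟩ := P.hasDerivAt_lobePos i τ
  obtain ⟨x', z', h3, h4, h5⟩ := lobe_turns P.c₁_pos P.c₁_lt_one unitInterval_zero_mem
    (P.contDiff_lobePos i) (P.lobePos_gt i) h1 h2
  have hx : deriv (P.xpos i) τ = -lorenzSide p q i * x' := (h3.const_mul (-lorenzSide p q i)).deriv
  have hz : deriv (P.height i) τ = z' := h4.deriv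
  have he : ∀ x, -lorenzSide p q i * (-lorenzSide p q i * x) = x := fun x => by
    rw [← mul_assoc, neg_mul_neg, lorenzSide_sq, one_mul]
  rw [hx, hz, xpos, he, he]
  exact h5

theorem vertical (i : Fin (p + q)) {τ : ℝ} (hτ : |τ| ≤ P.c₀ ∨ |τ - 1| ≤ P.c₀) :
    P.xpos i τ = P.pos i τ ∧ P.height i τ =
      -(2 * Real.sin (2 * Real.pi * τ) / Real.cos (2 * Real.pi * τ)) := by
  obtain ⟨h1, h2⟩ := P.zone_cos hτ
  have h3 := lobe_vertical 0 P.c₁_lt_one ((P.abs_lobePos_le i τ).trans (by norm_num)) h1 h2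
  rw [lobe_eq] at h3
  obtain ⟨h4, -, h5⟩ := vec3_inj.1 h3
  refine ⟨?_, h5⟩
  rw [lobePos, neg_mul, neg_inj] at h4
  have h6 : lorenzSide p q i ≠ 0 := by
    intro h; have := lorenzSide_sq i; rw [h] at this; norm_num at this
  exact mul_left_cancel₀ h6 h4

theorem xpos_glue (i : Fin (p + q)) {τ : ℝ} (hτ : τ ∈ Icc (1 - P.c₀) 1) :
    P.xpos i τ = P.xpos (lorenzPerm p q i) (τ - 1) ∧
      P.height i τ = P.height (lorenzPerm p q i) (τ - 1) := by
  have h0 : |τ - 1| ≤ P.c₀ := by rw [abs_le]; constructor <;> linarith [hτ.1, hτ.2, P.c₀_pos]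
  obtain ⟨h1, h2⟩ := P.vertical i (Or.inr h0)
  obtain ⟨h3, h4⟩ := P.vertical (lorenzPerm p q i) (τ := τ - 1) (Or.inl h0)
  have h5 : 2 * Real.pi * (τ - 1) = 2 * Real.pi * τ - 2 * Real.pi := by ring
  rw [h1, h2, h3, h4, P.pos_glue i hτ, h5, Real.sin_sub_two_pi, Real.cos_sub_two_pi]
  exact ⟨rfl, rfl⟩

theorem height_nonpos_of_sin_nonneg {i : Fin (p + q)} {τ : ℝ} (h : 0 ≤ Real.sin (2 * Real.pi * τ)) :
    P.height i τ ≤ 0 := by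
  have h1 := lobeAspect_pos unitInterval_zero_mem (P.lobePos_gt i τ)
  have h2 := lobeNorm_pos (τ := τ) unitInterval_zero_mem (P.lobePos_gt i τ)
  rw [height, neg_nonpos, earSin, lobeSin]
  exact mul_nonneg (P.earRadius_pos i τ).le (div_nonneg (mul_nonneg h1.le h) h2.le)

theorem height_pos {i : Fin (p + q)} {τ : ℝ} (h : Real.sin (2 * Real.pi * τ) < 0) :
    0 < P.height i τ := by
  have h1 := lobeAspect_pos unitInterval_zero_mem (P.lobePos_gt i τ)
  have h2 := lobeNorm_pos (τ := τ) unitInterval_zero_mem (P.lobePos_gt i τ)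
  rw [height, earSin, lobeSin, neg_pos]
  exact mul_neg_of_pos_of_neg (P.earRadius_pos i τ) (div_neg_of_neg_of_pos
    (mul_neg_of_pos_of_neg h1 h) h2)

theorem height_nonpos_of_le_half {i : Fin (p + q)} {τ : ℝ} (h0 : 0 ≤ τ) (h1 : τ ≤ 1 / 2) :
    P.height i τ ≤ 0 :=
  P.height_nonpos_of_sin_nonneg (Real.sin_nonneg_of_nonneg_of_le_pi (by positivity)
    (by nlinarith [Real.pi_pos]))

theorem le_half_of_height_nonpos {i : Fin (p + q)} {τ : ℝ} (hτ : τ < 1)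
    (h : P.height i τ ≤ 0) : τ ≤ 1 / 2 := by
  by_contra h2
  push Not at h2
  refine absurd (P.height_pos (i := i) (τ := τ) ?_) (not_lt.2 h)
  have h3 : 2 * Real.pi * τ = 2 * Real.pi * τ - Real.pi + Real.pi := by ring
  rw [h3, Real.sin_add_pi, neg_lt_zero]
  exact Real.sin_pos_of_pos_of_lt_pi (by nlinarith [Real.pi_pos]) (by nlinarith [Real.pi_pos])

/-- Before the stretching, a strand is on its own side of the middle by at least `W / (2 (p + q))`.
The constant `c₁` is chosen such that this outweighs the maximal gain `1 / c₁`; so the strand stays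
in the disc that bounds the lower half of its band. -/
theorem earRadius_le (i : Fin (p + q)) {τ : ℝ} (hτ : τ ≤ 13 / 16) : P.earRadius i τ ≤ 2 := by
  have h1 := (lobeGain_mem P.c₁_pos P.c₁_lt_one
    (lobeCos_le_one (τ := τ) unitInterval_zero_mem (P.lobePos_gt i τ))).2
  have h2 := P.side_mul_pos_ge i hτ
  have h3 := P.lobePos_gt i τ
  have h4 : 2 + P.lobePos i τ ≤ 2 * P.c₁ := by
    have : P.W / (2 * (p + q)) = 2 * (P.W / (4 * (p + q))) := by
      have := P.size_pos; field_simp; norm_num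
    rw [lobePos, P.c₁_eq]
    linarith
  rw [earRadius, lobeRadius, sub_zero, one_mul, add_zero]
  calc (2 + P.lobePos i τ) * lobeGain P.c₁ (lobeCos 0 τ (P.lobePos i τ))
      ≤ (2 + P.lobePos i τ) * (1 / P.c₁) := mul_le_mul_of_nonneg_left h1 (by linarith)
    _ ≤ 2 * P.c₁ * (1 / P.c₁) := mul_le_mul_of_nonneg_right h4 (one_div_pos.2 P.c₁_pos).le
    _ = 2 := by have := P.c₁_pos; field_simp

theorem side_mul_xpos (i : Fin (p + q)) (τ : ℝ) :
    lorenzSide p q i * P.xpos i τ = 2 - P.earRadius i τ * P.earCos i τ := by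
  rw [xpos, neg_mul, mul_neg, ← mul_assoc, lorenzSide_sq]
  ring

theorem earRadius_mul_earCos_le (i : Fin (p + q)) (τ : ℝ) :
    P.earRadius i τ * P.earCos i τ ≤ 2 + P.lobePos i τ := by
  have h1 := lobeGain_mul_le P.c₁_pos P.c₁_lt_one
    (lobeCos_le_one (τ := τ) unitInterval_zero_mem (P.lobePos_gt i τ))
  rw [earRadius, lobeRadius, earCos, sub_zero, one_mul, add_zero, mul_assoc]
  exact mul_le_of_le_one_right (by linarith [P.lobePos_gt i τ]) h1

theorem side_mul_xpos_pos (i : Fin (p + q)) {τ : ℝ} (hτ : τ ≤ 13 / 16) :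
    0 < lorenzSide p q i * P.xpos i τ := by
  have h1 := P.earRadius_mul_earCos_le i τ
  have h2 := P.side_mul_pos_ge i hτ
  have h3 : 0 < P.W / (2 * (p + q)) := div_pos P.W_pos (by linarith [P.size_pos])
  rw [side_mul_xpos]
  rw [lobePos] at h1
  linarith

/-- The loops around one ear are already disjoint in projection to the `xz`-plane, so the depth
plays no role for them. -/
theorem planar_inj {i j : Fin (p + q)} {τ τ' : ℝ} (hs : lorenzSide p q i = lorenzSide p q j)
    (hτ : τ ∈ Ico (0 : ℝ) 1) (hτ' : τ' ∈ Ico (0 : ℝ) 1) (hx : P.xpos i τ = P.xpos j τ')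
    (hz : P.height i τ = P.height j τ') : i = j ∧ τ = τ' := by
  have h : lobe P.c₁ 0 τ (P.lobePos i τ) 0 = lobe P.c₁ 0 τ' (P.lobePos j τ') 0 := by
    rw [lobe_eq, lobe_eq, hs, hx, hz]
  obtain ⟨rfl, h2, -⟩ := lobe_inj P.c₁_pos P.c₁_lt_one unitInterval_zero_mem (P.lobePos_gt i τ)
    (P.lobePos_gt j τ') hτ hτ' h
  refine ⟨P.pos_inj_of_same hs (τ := τ) ?_, rfl⟩
  rw [lobePos, lobePos, hs, neg_inj] at h2
  have h6 : lorenzSide p q j ≠ 0 := by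
    intro h; have := lorenzSide_sq j; rw [h] at this; norm_num at this
  exact mul_left_cancel₀ h6 h2

/-- Which side the strand `i` is on, changing smoothly from that of its predecessor. -/
noncomputable def smoothSide (p q : ℕ) (i : Fin (p + q)) (τ : ℝ) : ℝ :=
  lorenzSide p q ((lorenzPerm p q).symm i) +
    (lorenzSide p q i - lorenzSide p q ((lorenzPerm p q).symm i)) *
      Real.smoothTransition (2 * τ)

theorem smoothSide_of_half_le (i : Fin (p + q)) {τ : ℝ} (hτ : 1 / 2 ≤ τ) :
    smoothSide p q i τ = lorenzSide p q i := by
  rw [smoothSide, Real.smoothTransition.one_of_one_le (by linarith)]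
  ring

theorem smoothSide_of_nonpos (i : Fin (p + q)) {τ : ℝ} (hτ : τ ≤ 0) :
    smoothSide p q i τ = lorenzSide p q ((lorenzPerm p q).symm i) := by
  rw [smoothSide, Real.smoothTransition.zero_of_nonpos (by linarith)]
  ring

/-- Second coordinate of the strand `i`: on the template for `t = 0`. -/
noncomputable def depth (t : ℝ) (i : Fin (p + q)) (τ : ℝ) : ℝ :=
  (1 - t) * (smoothSide p q i τ * expNegInvGlue (P.height i τ)) +
    t * (lorenzSide p q i * P.bump τ)

/-- Up to `τ = 1/2` the strand is at or below the branch line, where `expNegInvGlue` vanishes; so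
the smooth change of side is invisible for nonnegative `τ` and only serves the continuation to the
left. -/
theorem depth_eq (t : ℝ) (i : Fin (p + q)) {τ : ℝ} (hτ : 0 ≤ τ) : P.depth t i τ =
    lorenzSide p q i * ((1 - t) * expNegInvGlue (P.height i τ) + t * P.bump τ) := by
  have h : smoothSide p q i τ * expNegInvGlue (P.height i τ) =
      lorenzSide p q i * expNegInvGlue (P.height i τ) := by
    rcases le_total τ (1 / 2) with h | h
    · rw [expNegInvGlue.zero_of_nonpos (P.height_nonpos_of_le_half hτ h), mul_zero, mul_zero]
    · rw [smoothSide_of_half_le i h]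
  rw [depth, h]
  ring

theorem depth_glue (t : ℝ) (i : Fin (p + q)) {τ : ℝ} (hτ : τ ∈ Icc (1 - P.c₀) 1) :
    P.depth t i τ = P.depth t (lorenzPerm p q i) (τ - 1) := by
  have h1 : P.bump τ = 0 := (P.bump_eq_zero_iff τ).2 (Or.inr hτ.1)
  have h2 : P.bump (τ - 1) = 0 := (P.bump_eq_zero_iff _).2 (Or.inl (by linarith [hτ.2, P.c₀_pos]))
  rw [depth, depth, h1, h2, smoothSide_of_half_le i (by linarith [hτ.1, P.c₀_le]),
    smoothSide_of_nonpos _ (by linarith [hτ.2]), Equiv.symm_apply_apply, (P.xpos_glue i hτ).2]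
  ring

theorem contDiff_smoothSide (i : Fin (p + q)) : ContDiff ℝ ∞ (smoothSide p q i) := by
  have hS : ContDiff ℝ ∞ Real.smoothTransition := Real.smoothTransition.contDiff
  exact contDiff_const.add (contDiff_const.mul (hS.comp (contDiff_const.mul contDiff_id)))

theorem contDiff_depth (i : Fin (p + q)) :
    ContDiff ℝ ∞ fun z : ℝ × ℝ => P.depth z.1 i z.2 := by
  have hE : ContDiff ℝ ∞ expNegInvGlue := expNegInvGlue.contDiff
  have h1 : ContDiff ℝ ∞ fun τ => smoothSide p q i τ * expNegInvGlue (P.height i τ) :=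
    (contDiff_smoothSide i).mul (hE.comp (P.contDiff_height i))
  have h2 : ContDiff ℝ ∞ fun τ => lorenzSide p q i * P.bump τ := contDiff_const.mul P.contDiff_bump
  exact ((contDiff_const.sub contDiff_fst).mul (h1.comp contDiff_snd)).add
    (contDiff_fst.mul (h2.comp contDiff_snd))

/-- The strands of the Lorenz link (for `t = 0`), and the strands obtained from them by flattening
the bands. -/
noncomputable def strand (t : ℝ) (i : Fin (p + q)) (τ : ℝ) : E3 :=
  !₂[P.xpos i τ, P.depth t i τ, P.height i τ]

theorem side_eq_or {p q : ℕ} (i j : Fin (p + q)) :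
    lorenzSide p q i = lorenzSide p q j ∨ lorenzSide p q i = -lorenzSide p q j := by
  rcases lorenzSide_cases i with h | h <;> rcases lorenzSide_cases j with h' | h' <;>
    rw [h, h'] <;> norm_num

theorem hasDerivAt_strand (t : ℝ) (i : Fin (p + q)) (τ : ℝ) : HasDerivAt (P.strand t i)
    !₂[deriv (P.xpos i) τ, deriv (P.depth t i) τ, deriv (P.height i) τ] τ := by
  have hd : ∀ {f : ℝ → ℝ}, ContDiff ℝ ∞ f → HasDerivAt f (deriv f τ) τ :=
    fun hf => (hf.differentiable (by simp) τ).hasDerivAt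
  have h : ContDiff ℝ ∞ (P.depth t i) :=
    (P.contDiff_depth i).comp (by fun_prop : ContDiff ℝ ∞ fun τ : ℝ => (t, τ))
  exact (hd (P.contDiff_xpos i)).vec3 (hd h) (hd (P.contDiff_height i))

/-- Only strands around different ears could meet. Their depths have opposite signs, so at a common
point both depths vanish. For `t < 1` this happens at or below the branch line, where the two halves
are apart; at `t = 1` it happens on the vertical parts, where positions are distinct. -/
theorem strandIsotopy_strand : StrandIsotopy (lorenzPerm p q) P.strand where
  smooth i := ((P.contDiff_xpos i).comp contDiff_snd).vec3 (P.contDiff_depth i)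
    ((P.contDiff_height i).comp contDiff_snd)
  glue := by
    refine ⟨P.c₀, P.c₀_pos, by linarith [P.c₀_le], fun t _ i τ hτ => ?_⟩
    rw [strand, strand, P.depth_glue t i hτ, (P.xpos_glue i hτ).1, (P.xpos_glue i hτ).2]
  immersion := by
    intro t _ i τ _ h
    have h1 := P.turns i τ
    rw [(P.hasDerivAt_strand t i τ).deriv] at h
    have hx := congrArg (fun Q : E3 => Q 0) h
    have hz := congrArg (fun Q : E3 => Q 2) h
    simp at hx hz
    rw [hx, hz] at h1
    simp at h1
  inj := by
    intro t ht i j τ hτ τ' hτ' h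
    obtain ⟨hx, hy, hz⟩ := vec3_inj.1 h
    rcases side_eq_or i j with hs | hs
    · exact P.planar_inj hs hτ hτ' hx hz
    rw [P.depth_eq t i hτ.1, P.depth_eq t j hτ'.1, hs, ← hz] at hy
    have hE := expNegInvGlue.nonneg (P.height i τ)
    have hb := P.bump_nonneg τ
    have hb' := P.bump_nonneg τ'
    have h1t := sub_nonneg.2 ht.2
    have a1 := mul_nonneg h1t hE
    have a2 := mul_nonneg ht.1 hb
    have a3 := mul_nonneg ht.1 hb'
    -- A sum of nonnegative terms equals minus another such sum, so every term is zero.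
    have hsum : (1 - t) * expNegInvGlue (P.height i τ) = 0 ∧ t * P.bump τ = 0 ∧
        t * P.bump τ' = 0 := by
      rcases lorenzSide_cases j with hj | hj <;> rw [hj] at hy <;>
        refine ⟨?_, ?_, ?_⟩ <;> linarith
    rcases ht.2.eq_or_lt with rfl | ht1
    · rw [one_mul, one_mul] at hsum
      have z1 := P.zone_of_bump hτ hsum.2.1
      have z2 := P.zone_of_bump hτ' hsum.2.2
      obtain ⟨v1, v2⟩ := P.vertical i z1
      obtain ⟨v3, v4⟩ := P.vertical j z2
      rw [v2, v4] at hz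
      have := vertical_inj hτ hτ' (P.zone_cos z1).1 (P.zone_cos z2).1 hz
      subst this
      rw [v1, v3] at hx
      exact ⟨P.pos_inj_of_zone ((P.bump_eq_zero_iff τ).1 hsum.2.1) hx, rfl⟩
    · exfalso
      have h3 : expNegInvGlue (P.height i τ) = 0 :=
        (mul_eq_zero.1 hsum.1).resolve_left (sub_pos.2 ht1).ne'
      have h4 : P.height i τ ≤ 0 := expNegInvGlue.zero_iff_nonpos.1 h3
      have h5 := P.le_half_of_height_nonpos hτ.2 h4
      have h6 := P.le_half_of_height_nonpos (i := j) hτ'.2 (hz ▸ h4)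
      have h7 := P.side_mul_xpos_pos i (τ := τ) (by linarith)
      have h8 := P.side_mul_xpos_pos j (τ := τ') (by linarith)
      rw [hs, hx] at h7
      linarith

end LobeParams

/-! ### Turning the right ear to the left -/

/-- A lobe, turned about the `z`-axis by the angle `-μ`. -/
noncomputable def spunLobe (c₁ μ τ w y : ℝ) : E3 :=
  !₂[Real.cos μ * lobe c₁ 0 τ (Real.cos μ * w - Real.sin μ * y)
        (Real.sin μ * w + Real.cos μ * y) 0 +
      Real.sin μ * (Real.sin μ * w + Real.cos μ * y),
    -(Real.sin μ * lobe c₁ 0 τ (Real.cos μ * w - Real.sin μ * y)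
        (Real.sin μ * w + Real.cos μ * y) 0) +
      Real.cos μ * (Real.sin μ * w + Real.cos μ * y),
    lobe c₁ 0 τ (Real.cos μ * w - Real.sin μ * y) (Real.sin μ * w + Real.cos μ * y) 2]

theorem lobe_apply_one (c₁ u τ w y : ℝ) : lobe c₁ u τ w y 1 = y := rfl

theorem spunLobe_zero (c₁ τ w y : ℝ) : spunLobe c₁ 0 τ w y = lobe c₁ 0 τ w y := by
  ext k
  fin_cases k <;> simp [spunLobe, lobe]

/-- The point with coordinates `w` and `y` is expressed in a turned frame and turned back, so the
vertical part of the lobe is not affected by `μ`. Thus the strands stay glued while an ear swings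
around. -/
theorem spunLobe_vertical {c₁ μ τ w : ℝ} (y : ℝ) (h1 : c₁ < 1)
    (hw : |Real.cos μ * w - Real.sin μ * y| ≤ 1 / 2)
    (hc : 0 < Real.cos (2 * Real.pi * τ)) (hcc : (1 + c₁) / 2 ≤ Real.cos (2 * Real.pi * τ) ^ 2) :
    spunLobe c₁ μ τ w y =
      !₂[w, y, -(2 * Real.sin (2 * Real.pi * τ) / Real.cos (2 * Real.pi * τ))] := by
  have hcs := Real.cos_sq_add_sin_sq μ
  rw [spunLobe, lobe_vertical _ h1 hw hc hcc, vec3_inj]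
  refine ⟨?_, ?_, rfl⟩ <;> simp
  · linear_combination w * hcs
  · linear_combination y * hcs

theorem spunLobe_inj {c₁ μ τ w y τ' w' y' : ℝ} (h0 : 0 < c₁) (h1 : c₁ < 1)
    (hw : -2 < Real.cos μ * w - Real.sin μ * y) (hw' : -2 < Real.cos μ * w' - Real.sin μ * y')
    (hτ : τ ∈ Ico (0 : ℝ) 1) (hτ' : τ' ∈ Ico (0 : ℝ) 1)
    (h : spunLobe c₁ μ τ w y = spunLobe c₁ μ τ' w' y') : τ = τ' ∧ w = w' ∧ y = y' := by
  have hcs := Real.cos_sq_add_sin_sq μ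
  obtain ⟨hx, hy, hz⟩ := vec3_inj.1 h
  have h2 : lobe c₁ 0 τ (Real.cos μ * w - Real.sin μ * y) (Real.sin μ * w + Real.cos μ * y) =
      lobe c₁ 0 τ' (Real.cos μ * w' - Real.sin μ * y') (Real.sin μ * w' + Real.cos μ * y') := by
    ext k
    fin_cases k
    · simp only [Fin.zero_eta]
      linear_combination Real.cos μ * hx - Real.sin μ * hy -
        (lobe c₁ 0 τ (Real.cos μ * w - Real.sin μ * y) (Real.sin μ * w + Real.cos μ * y) 0 -
        lobe c₁ 0 τ' (Real.cos μ * w' - Real.sin μ * y')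
          (Real.sin μ * w' + Real.cos μ * y') 0) * hcs
    · simp only [Fin.mk_one, lobe_apply_one]
      linear_combination Real.sin μ * hx + Real.cos μ * hy -
        (Real.sin μ * w + Real.cos μ * y - (Real.sin μ * w' + Real.cos μ * y')) * hcs
    · exact hz
  obtain ⟨h3, h4, h5⟩ := lobe_inj h0 h1 unitInterval_zero_mem hw hw' hτ hτ' h2
  refine ⟨h3, ?_, ?_⟩
  · linear_combination Real.cos μ * h4 + Real.sin μ * h5 - (w - w') * hcs
  · linear_combination -Real.sin μ * h4 + Real.cos μ * h5 - (y - y') * hcs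

/-- A lobe stays on the ear's side of its vertical line (`lobeGain_mul_le`), and for angles with
nonnegative sine the ear is turned towards positive `y`, that is, backwards. -/
theorem le_spunLobe_one {c₁ μ τ w y : ℝ} (h0 : 0 < c₁) (h1 : c₁ < 1) (hμ : 0 ≤ Real.sin μ)
    (hw : -2 < Real.cos μ * w - Real.sin μ * y) : y ≤ spunLobe c₁ μ τ w y 1 := by
  have h := lobeGain_mul_le h0 h1 (lobeCos_le_one (τ := τ) unitInterval_zero_mem hw)
  have hcs := Real.cos_sq_add_sin_sq μ
  have h2 : lobe c₁ 0 τ (Real.cos μ * w - Real.sin μ * y) (Real.sin μ * w + Real.cos μ * y) 0 ≤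
      Real.cos μ * w - Real.sin μ * y := by
    have : lobe c₁ 0 τ (Real.cos μ * w - Real.sin μ * y) (Real.sin μ * w + Real.cos μ * y) 0 =
      -2 + (2 + (Real.cos μ * w - Real.sin μ * y)) *
        (lobeGain c₁ (lobeCos 0 τ (Real.cos μ * w - Real.sin μ * y)) *
          lobeCos 0 τ (Real.cos μ * w - Real.sin μ * y)) := by
      simp [lobe, lobeRadius]; ring
    rw [this]
    have := mul_le_of_le_one_right (by linarith : 0 ≤ 2 + (Real.cos μ * w - Real.sin μ * y)) h
    linarith
  have h3 : spunLobe c₁ μ τ w y 1 = y + Real.sin μ * ((Real.cos μ * w - Real.sin μ * y) -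
      lobe c₁ 0 τ (Real.cos μ * w - Real.sin μ * y) (Real.sin μ * w + Real.cos μ * y) 0) := by
    simp only [spunLobe]
    simp
    linear_combination y * hcs
  rw [h3]
  have := mul_nonneg hμ (sub_nonneg.2 h2)
  linarith

theorem ContDiff.spunLobe {F : Type*} [NormedAddCommGroup F] [NormedSpace ℝ F] {c₁ : ℝ}
    {μ τ w y : F → ℝ} (h0 : 0 < c₁) (h1 : c₁ < 1) (hμ : ContDiff ℝ ∞ μ) (hτ : ContDiff ℝ ∞ τ)
    (hw : ContDiff ℝ ∞ w) (hy : ContDiff ℝ ∞ y)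
    (hw1 : ∀ z, -2 < Real.cos (μ z) * w z - Real.sin (μ z) * y z) :
    ContDiff ℝ ∞ fun z => spunLobe c₁ (μ z) (τ z) (w z) (y z) := by
  have hu : ContDiff ℝ ∞ fun _ : F => (0 : ℝ) := contDiff_const
  have ha := (hμ.cos.mul hw).sub (hμ.sin.mul hy)
  have hb := (hμ.sin.mul hw).add (hμ.cos.mul hy)
  have hl := hu.lobe h0 h1 hτ ha hb (fun _ => unitInterval_zero_mem) hw1
  have hl' := contDiff_euclidean.1 hl
  exact ((hμ.cos.mul (hl' 0)).add (hμ.sin.mul hb)).vec3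
    ((hμ.sin.mul (hl' 0)).neg.add (hμ.cos.mul hb)) (hl' 2)

theorem deriv_spunLobe_ne_zero {c₁ μ τ : ℝ} {w y : ℝ → ℝ} (h0 : 0 < c₁) (h1 : c₁ < 1)
    (hw : ContDiff ℝ ∞ w) (hy : ContDiff ℝ ∞ y)
    (hw1 : ∀ τ, -2 < Real.cos μ * w τ - Real.sin μ * y τ)
    (hb : |Real.cos μ * deriv w τ - Real.sin μ * deriv y τ| <
      4 * Real.pi * (2 + (Real.cos μ * w τ - Real.sin μ * y τ))) :
    deriv (fun t => spunLobe c₁ μ t (w t) (y t)) τ ≠ 0 := by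
  have hd : ∀ {f : ℝ → ℝ}, ContDiff ℝ ∞ f → HasDerivAt f (deriv f τ) τ :=
    fun hf => (hf.differentiable (by simp) τ).hasDerivAt
  have ha : ContDiff ℝ ∞ fun t => Real.cos μ * w t - Real.sin μ * y t :=
    (contDiff_const.mul hw).sub (contDiff_const.mul hy)
  obtain ⟨x', z', hx, hz, hpos⟩ := lobe_turns h0 h1 unitInterval_zero_mem ha hw1
    (((hd hw).const_mul _).sub ((hd hy).const_mul _)) hb
  have hv := ((hd hw).const_mul (Real.sin μ)).add ((hd hy).const_mul (Real.cos μ))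
  set v' := Real.sin μ * deriv w τ + Real.cos μ * deriv y τ
  have h2 : HasDerivAt (fun t => spunLobe c₁ μ t (w t) (y t))
      !₂[Real.cos μ * x' + Real.sin μ * v', -(Real.sin μ * x') + Real.cos μ * v', z'] τ :=
    ((hx.const_mul _).add (hv.const_mul _)).vec3 ((hx.const_mul _).neg.add (hv.const_mul _)) hz
  intro h
  rw [h2.deriv] at h
  have e0 := congrArg (fun Q : E3 => Q 0) h
  have e1 := congrArg (fun Q : E3 => Q 1) h
  have e2 := congrArg (fun Q : E3 => Q 2) h
  simp at e0 e1 e2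
  have hcs := Real.cos_sq_add_sin_sq μ
  have hx0 : x' = 0 := by linear_combination Real.cos μ * e0 - Real.sin μ * e1 - x' * hcs
  rw [hx0, e2] at hpos
  simp at hpos

/-! ### Swinging the right ear to the left, and making the loops round. -/

namespace LobeParams

variable {p q : ℕ} (P : LobeParams p q)

/-- The angle by which the ear of the strand `i` is turned at time `t`. -/
noncomputable def flipAngle (p q : ℕ) (t : ℝ) (i : Fin (p + q)) : ℝ :=
  (1 - t) * Real.pi * ((1 + lorenzSide p q i) / 2)

/-- The second coordinate of a flattened strand. -/
noncomputable def flatDepth (i : Fin (p + q)) (τ : ℝ) : ℝ := lorenzSide p q i * P.bump τ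

theorem contDiff_flatDepth (i : Fin (p + q)) : ContDiff ℝ ∞ (P.flatDepth i) :=
  contDiff_const.mul P.contDiff_bump

theorem flatDepth_glue (i : Fin (p + q)) {τ : ℝ} (hτ : τ ∈ Icc (1 - P.c₀) 1) :
    P.flatDepth i τ = 0 ∧ P.flatDepth (lorenzPerm p q i) (τ - 1) = 0 := by
  have h1 : P.bump τ = 0 := (P.bump_eq_zero_iff τ).2 (Or.inr hτ.1)
  have h2 : P.bump (τ - 1) = 0 := (P.bump_eq_zero_iff _).2 (Or.inl (by linarith [hτ.2, P.c₀_pos]))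
  rw [flatDepth, flatDepth, h1, h2, mul_zero, mul_zero]
  exact ⟨rfl, rfl⟩

theorem abs_combo_le {μ a b A B : ℝ} (ha : |a| ≤ A) (hb : |b| ≤ B) :
    |Real.cos μ * a - Real.sin μ * b| ≤ A + B := by
  refine (abs_sub _ _).trans (add_le_add ?_ ?_)
  · rw [abs_mul]
    exact (mul_le_of_le_one_left (abs_nonneg a) (Real.abs_cos_le_one μ)).trans ha
  · rw [abs_mul]
    exact (mul_le_of_le_one_left (abs_nonneg b) (Real.abs_sin_le_one μ)).trans hb

theorem abs_flip_le (μ : ℝ) (i : Fin (p + q)) (τ : ℝ) :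
    |Real.cos μ * P.pos i τ - Real.sin μ * P.flatDepth i τ| ≤ 1 / 2 := by
  refine (abs_combo_le ((P.abs_pos_le i τ).trans P.W_le) (B := 1 / 4) ?_).trans (by norm_num)
  rw [flatDepth, abs_mul, abs_lorenzSide, one_mul, abs_of_nonneg (P.bump_nonneg τ)]
  exact (P.bump_le τ).trans P.W_le

theorem flip_gt (μ : ℝ) (i : Fin (p + q)) (τ : ℝ) :
    -2 < Real.cos μ * P.pos i τ - Real.sin μ * P.flatDepth i τ := by
  linarith [(abs_le.1 (P.abs_flip_le μ i τ)).1]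

theorem abs_deriv_flip_le (μ : ℝ) (i : Fin (p + q)) (τ : ℝ) :
    |Real.cos μ * deriv (P.pos i) τ - Real.sin μ * deriv (P.flatDepth i) τ| ≤ 3 := by
  obtain ⟨w', h1, h2⟩ := P.hasDerivAt_pos i τ
  obtain ⟨b', h3, h4⟩ := P.hasDerivAt_bump τ
  have h5 : deriv (P.flatDepth i) τ = lorenzSide p q i * b' := (h3.const_mul _).deriv
  rw [h1.deriv, h5]
  refine (abs_combo_le h2 (B := 1) ?_).trans (by norm_num)
  rwa [abs_mul, abs_lorenzSide, one_mul]

/-- The strands while the right ear is turned to the left. -/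
noncomputable def flipped (t : ℝ) (i : Fin (p + q)) (τ : ℝ) : E3 :=
  spunLobe P.c₁ (flipAngle p q t i) τ (P.pos i τ) (P.flatDepth i τ)

theorem flipped_vertical (t : ℝ) (i : Fin (p + q)) {τ : ℝ}
    (hτ : |τ| ≤ P.c₀ ∨ |τ - 1| ≤ P.c₀) : P.flipped t i τ = !₂[P.pos i τ, P.flatDepth i τ,
      -(2 * Real.sin (2 * Real.pi * τ) / Real.cos (2 * Real.pi * τ))] :=
  spunLobe_vertical _ P.c₁_lt_one (P.abs_flip_le _ i τ) (P.zone_cos hτ).1 (P.zone_cos hτ).2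

theorem strand_one_eq (i : Fin (p + q)) (τ : ℝ) : 0 ≤ τ → P.strand 1 i τ = P.flipped 0 i τ := by
  intro hτ
  rw [flipped, strand, P.depth_eq 1 i hτ, sub_self, zero_mul, zero_add, one_mul, flipAngle]
  have h := P.lobe_eq i τ (P.flatDepth i τ)
  rw [lobe, vec3_inj] at h
  rcases lorenzSide_cases i with hs | hs
  · have h0 : (1 - 0) * Real.pi * ((1 + lorenzSide p q i) / 2) = 0 := by rw [hs]; ring
    have hl : P.pos i τ = P.lobePos i τ := by rw [lobePos, hs]; ring
    rw [h0, spunLobe_zero, hl, P.lobe_eq, hs, vec3_inj]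
    refine ⟨by ring, ?_, rfl⟩
    rw [flatDepth, hs]
  · have h0 : (1 - 0) * Real.pi * ((1 + lorenzSide p q i) / 2) = Real.pi := by rw [hs]; ring
    rw [h0, spunLobe, Real.cos_pi, Real.sin_pi]
    have hl : -1 * P.pos i τ - 0 * P.flatDepth i τ = P.lobePos i τ := by rw [lobePos, hs]; ring
    rw [hl, P.lobe_eq, hs, vec3_inj]
    refine ⟨by simp, ?_, rfl⟩
    rw [flatDepth, hs]
    ring

/-- Loops around the same ear turn rigidly in their frame and stay disjoint. The left ear does not
move and has depth `-bump`, while the moving ear stays at depth at least `bump`; so the two kinds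
can only meet where both bumps vanish, on the vertical parts. -/
theorem strandIsotopy_flipped : StrandIsotopy (lorenzPerm p q) P.flipped where
  smooth i := by
    have h : ContDiff ℝ ∞ fun z : ℝ × ℝ => flipAngle p q z.1 i :=
      ((contDiff_const.sub contDiff_fst).mul contDiff_const).mul contDiff_const
    exact h.spunLobe P.c₁_pos P.c₁_lt_one contDiff_snd ((P.contDiff_pos i).comp contDiff_snd)
      ((P.contDiff_flatDepth i).comp contDiff_snd) (fun z => P.flip_gt _ i z.2)
  glue := by
    refine ⟨P.c₀, P.c₀_pos, by linarith [P.c₀_le], fun t _ i τ hτ => ?_⟩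
    have h0 : |τ - 1| ≤ P.c₀ := by rw [abs_le]; constructor <;> linarith [hτ.1, hτ.2, P.c₀_pos]
    have h5 : 2 * Real.pi * (τ - 1) = 2 * Real.pi * τ - 2 * Real.pi := by ring
    rw [P.flipped_vertical t i (Or.inr h0), P.flipped_vertical t _ (Or.inl h0),
      (P.flatDepth_glue i hτ).1, (P.flatDepth_glue i hτ).2, P.pos_glue i hτ, h5,
      Real.sin_sub_two_pi, Real.cos_sub_two_pi]
  immersion t _ i τ _ := by
    refine deriv_spunLobe_ne_zero P.c₁_pos P.c₁_lt_one (P.contDiff_pos i) (P.contDiff_flatDepth i)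
      (P.flip_gt _ i) ((P.abs_deriv_flip_le _ i τ).trans_lt ?_)
    have := (abs_le.1 (P.abs_flip_le (flipAngle p q t i) i τ)).1
    nlinarith [Real.pi_gt_three]
  inj := by
    have key : ∀ t ∈ Icc (0 : ℝ) 1, ∀ i j, lorenzSide p q i = -1 → lorenzSide p q j = 1 →
        ∀ τ ∈ Ico (0 : ℝ) 1, ∀ τ' ∈ Ico (0 : ℝ) 1, P.flipped t i τ = P.flipped t j τ' →
        i = j ∧ τ = τ' := by
      intro t ht i j hi hj τ hτ τ' hτ' h
      have h1 : P.flipped t i τ 1 = -P.bump τ := by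
        have h0 : flipAngle p q t i = 0 := by rw [flipAngle, hi]; ring
        rw [flipped, h0, spunLobe_zero, lobe_apply_one, flatDepth, hi]
        ring
      have h2 : P.bump τ' ≤ P.flipped t j τ' 1 := by
        have h0 : flipAngle p q t j = (1 - t) * Real.pi := by rw [flipAngle, hj]; ring
        have h3 : 0 ≤ Real.sin (flipAngle p q t j) := by
          rw [h0]
          exact Real.sin_nonneg_of_nonneg_of_le_pi
            (mul_nonneg (sub_nonneg.2 ht.2) Real.pi_pos.le)
            (mul_le_of_le_one_left Real.pi_pos.le (by linarith [ht.1]))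
        have h4 := le_spunLobe_one (τ := τ') P.c₁_pos P.c₁_lt_one h3 (P.flip_gt _ j τ')
        have h5 : P.flatDepth j τ' = P.bump τ' := by rw [flatDepth, hj, one_mul]
        exact h5.symm.le.trans h4
      rw [← h, h1] at h2
      have hb := P.bump_nonneg τ
      have hb' := P.bump_nonneg τ'
      have e1 : P.bump τ = 0 := by linarith
      have e2 : P.bump τ' = 0 := by linarith
      have z1 := P.zone_of_bump hτ e1
      have z2 := P.zone_of_bump hτ' e2
      rw [P.flipped_vertical t i z1, P.flipped_vertical t j z2, vec3_inj] at h
      have := vertical_inj hτ hτ' (P.zone_cos z1).1 (P.zone_cos z2).1 h.2.2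
      subst this
      exact ⟨P.pos_inj_of_zone ((P.bump_eq_zero_iff τ).1 e1) h.1, rfl⟩
    intro t ht i j τ hτ τ' hτ' h
    rcases lorenzSide_cases i with hi | hi <;> rcases lorenzSide_cases j with hj | hj
    · have h0 : flipAngle p q t i = flipAngle p q t j := by rw [flipAngle, flipAngle, hi, hj]
      rw [flipped, flipped, ← h0] at h
      obtain ⟨rfl, h2, -⟩ := spunLobe_inj P.c₁_pos P.c₁_lt_one (P.flip_gt _ i τ)
        (P.flip_gt _ j τ') hτ hτ' h
      exact ⟨P.pos_inj_of_same (hi.trans hj.symm) h2, rfl⟩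
    · exact key t ht i j hi hj τ hτ τ' hτ' h
    · obtain ⟨h1, h2⟩ := key t ht j i hj hi τ' hτ' τ hτ h.symm
      exact ⟨h1.symm, h2.symm⟩
    · have h0 : flipAngle p q t i = flipAngle p q t j := by rw [flipAngle, flipAngle, hi, hj]
      rw [flipped, flipped, ← h0] at h
      obtain ⟨rfl, h2, -⟩ := spunLobe_inj P.c₁_pos P.c₁_lt_one (P.flip_gt _ i τ)
        (P.flip_gt _ j τ') hτ hτ' h
      exact ⟨P.pos_inj_of_same (hi.trans hj.symm) h2, rfl⟩

theorem pos_flatDepth_inj {i j : Fin (p + q)} {τ : ℝ}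
    (h1 : P.pos i τ = P.pos j τ) (h2 : P.flatDepth i τ = P.flatDepth j τ) : i = j := by
  rcases side_eq_or i j with hs | hs
  · exact P.pos_inj_of_same hs h1
  · rw [flatDepth, flatDepth, hs] at h2
    have hb : P.bump τ = 0 := by
      rcases lorenzSide_cases j with hj | hj <;> rw [hj] at h2 <;> linarith
    exact P.pos_inj_of_zone ((P.bump_eq_zero_iff τ).1 hb) h1

/-- The strands around the left ear, becoming round. -/
noncomputable def rounded (t : ℝ) (i : Fin (p + q)) (τ : ℝ) : E3 :=
  lobe P.c₁ (Real.smoothTransition t) τ (P.pos i τ) (P.flatDepth i τ)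

theorem smoothTransition_mem (t : ℝ) : Real.smoothTransition t ∈ Icc (0 : ℝ) 1 :=
  ⟨Real.smoothTransition.nonneg t, Real.smoothTransition.le_one t⟩

theorem pos_gt (i : Fin (p + q)) (τ : ℝ) : -2 < P.pos i τ := by
  linarith [(abs_le.1 (P.abs_pos_le i τ)).1, P.W_le]

theorem flipped_one (i : Fin (p + q)) (τ : ℝ) : P.flipped 1 i τ = P.rounded 0 i τ := by
  have h0 : flipAngle p q 1 i = 0 := by rw [flipAngle]; ring
  rw [flipped, rounded, h0, spunLobe_zero, Real.smoothTransition.zero]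

/-- Now all strands are loops around one ear, and at a given `τ` they are told apart by position and
depth; `lobe_inj` holds for every shape `u` between 0 and 1. -/
theorem strandIsotopy_rounded : StrandIsotopy (lorenzPerm p q) P.rounded where
  smooth i := by
    have hS : ContDiff ℝ ∞ Real.smoothTransition := Real.smoothTransition.contDiff
    exact ContDiff.lobe P.c₁_pos P.c₁_lt_one (hS.comp contDiff_fst) contDiff_snd
      ((P.contDiff_pos i).comp contDiff_snd)
      ((P.contDiff_flatDepth i).comp contDiff_snd) (fun z => smoothTransition_mem z.1)
      (fun z => P.pos_gt i z.2)
  glue := by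
    refine ⟨P.c₀, P.c₀_pos, by linarith [P.c₀_le], fun t _ i τ hτ => ?_⟩
    have h := lobe_add_int P.c₁ (Real.smoothTransition t) τ (P.pos i τ) (P.flatDepth i τ) (-1)
    rw [rounded, rounded, ← h, (P.flatDepth_glue i hτ).1, (P.flatDepth_glue i hτ).2,
      P.pos_glue i hτ]
    push_cast
    rfl
  immersion t _ i τ _ := by
    obtain ⟨w', h1, h2⟩ := P.hasDerivAt_pos i τ
    obtain ⟨x', z', hx, hz, hpos⟩ := lobe_turns P.c₁_pos P.c₁_lt_one (smoothTransition_mem t)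
      (P.contDiff_pos i) (P.pos_gt i) h1 (h2.trans_lt (by
        nlinarith [Real.pi_gt_three, (abs_le.1 (P.abs_pos_le i τ)).1, P.W_le]))
    have hy := ((P.contDiff_flatDepth i).differentiable (by simp) τ).hasDerivAt
    have h3 : HasDerivAt (P.rounded t i) _ τ := hx.vec3 hy hz
    intro h
    rw [h3.deriv] at h
    have e0 := congrArg (fun Q : E3 => Q 0) h
    have e2 := congrArg (fun Q : E3 => Q 2) h
    simp at e0 e2
    rw [e0, e2] at hpos
    simp at hpos
  inj := by
    intro t _ i j τ hτ τ' hτ' h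
    obtain ⟨rfl, h1, h2⟩ := lobe_inj P.c₁_pos P.c₁_lt_one (smoothTransition_mem t)
      (P.pos_gt i τ) (P.pos_gt j τ') hτ hτ' h
    exact ⟨P.pos_flatDepth_inj h1 h2, rfl⟩

theorem rounded_one (i : Fin (p + q)) (τ : ℝ) : P.rounded 1 i τ =
    !₂[-2 + (2 + P.pos i τ) * Real.cos (2 * Real.pi * τ), P.flatDepth i τ,
      -((2 + P.pos i τ) * Real.sin (2 * Real.pi * τ))] := by
  rw [rounded, Real.smoothTransition.one, lobe_one]

end LobeParams

/-! ### Turning the axis -/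

/-- A translation followed by a rotation by a right angle about the `x`-axis. -/
noncomputable def turnAxis (a : ℝ) : E3 ≃ₘ[ℝ] E3 where
  toFun P := !₂[P 0 + a, -P 2, P 1]
  invFun P := !₂[P 0 - a, P 2, -P 1]
  left_inv P := by ext k; fin_cases k <;> simp
  right_inv P := by ext k; fin_cases k <;> simp
  contMDiff_toFun := by
    have h := contDiff_euclidean.1 (contDiff_id : ContDiff ℝ ∞ (id : E3 → E3))
    exact (((h 0).add contDiff_const).vec3 (h 2).neg (h 1)).contMDiff
  contMDiff_invFun := by
    have h := contDiff_euclidean.1 (contDiff_id : ContDiff ℝ ∞ (id : E3 → E3))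
    exact (((h 0).sub contDiff_const).vec3 (h 2) (h 1).neg).contMDiff

theorem turnAxis_apply (a : ℝ) (P : E3) : turnAxis a P = !₂[P 0 + a, -P 2, P 1] := rfl

theorem det_fderiv_turnAxis (a : ℝ) (P : E3) : (fderiv ℝ (turnAxis a) P).det = 1 := by
  set M : Matrix (Fin 3) (Fin 3) ℝ := !![1, 0, 0; 0, 0, -1; 0, 1, 0] with hM
  set A : E3 →L[ℝ] E3 := LinearMap.toContinuousLinearMap (Matrix.toLpLin 2 2 M) with hA
  have h1 : ⇑(turnAxis a) = fun Q => A Q + !₂[a, 0, 0] := by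
    funext Q
    rw [turnAxis_apply]
    ext k
    fin_cases k <;> simp [hA, hM, Matrix.toLpLin_apply, dotProduct,
      Fin.sum_univ_three]
  have h2 : fderiv ℝ (turnAxis a) P = A := by
    rw [h1, fderiv_add_const, A.fderiv]
  rw [h2, hA, LinearMap.det_toContinuousLinearMap, Matrix.toLpLin_eq_toLin,
    LinearMap.det_toLin, hM, Matrix.det_fin_three]
  simp

theorem sameOrientedLinkType_turnAxis (a : ℝ) (K : Set E3) :
    SameOrientedLinkType K (turnAxis a '' K) :=
  ⟨turnAxis a, fun P => by rw [det_fderiv_turnAxis]; exact one_pos, rfl⟩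

theorem image_strandLink {ι : Type*} (f : E3 → E3) (γ : ι → ℝ → E3) :
    f '' strandLink γ = strandLink fun i τ => f (γ i τ) := by
  simp only [strandLink, image_iUnion, image_image]

/-- Strands around a parallel to the `y`-axis. -/
theorem sameOrientedLinkType_cylPoint {ι : Type*} (a : ℝ) (r y : ι → ℝ → ℝ) :
    SameOrientedLinkType
      (strandLink fun i τ => !₂[-a + r i τ * Real.cos (2 * Real.pi * τ), y i τ,
        -(r i τ * Real.sin (2 * Real.pi * τ))])
      (strandLink fun i τ => cylPoint (r i τ) τ (y i τ)) := by
  have h := sameOrientedLinkType_turnAxis a (strandLink fun i τ =>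
    (!₂[-a + r i τ * Real.cos (2 * Real.pi * τ), y i τ,
        -(r i τ * Real.sin (2 * Real.pi * τ))] : E3))
  rw [image_strandLink] at h
  convert h using 4 with i τ
  rw [turnAxis_apply, cylPoint, vec3_inj]
  simp

namespace LobeParams

variable {p q : ℕ} (P : LobeParams p q)

/-- A linear homotopy suffices: strands of the same kind have the same order of radii in both
braids, and strands of different kinds have heights of opposite sign in both. Heights can only agree
when they vanish, and then the positions are distinct. -/
theorem closedBraid_rounded :
    SameOrientedLinkType
      (strandLink fun i τ => cylPoint (2 + P.pos i τ) τ (P.flatDepth i τ))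
      (strandLink fun i τ => cylPoint (braidRadius p q i τ) τ (braidHeight p q i τ)) := by
  have hsec : ∀ f : ℝ → ℝ, ContDiff ℝ ∞ f → ContDiff ℝ ∞ fun z : ℝ × ℝ => f z.2 :=
    fun f hf => hf.comp contDiff_snd
  have h1t : ContDiff ℝ ∞ fun z : ℝ × ℝ => 1 - z.1 := contDiff_const.sub contDiff_fst
  have key : ∀ t ∈ Icc (0 : ℝ) 1, ∀ τ ∈ Ico (0 : ℝ) 1, ∀ i j : Fin (p + q), i < j →
      (1 - t) * (2 + P.pos i τ) + t * braidRadius p q i τ =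
        (1 - t) * (2 + P.pos j τ) + t * braidRadius p q j τ →
      (1 - t) * P.flatDepth i τ + t * braidHeight p q i τ =
        (1 - t) * P.flatDepth j τ + t * braidHeight p q j τ → False := by
    intro t ht τ hτ i j hij h1 h2
    rw [braidRadius_eq i hτ.1, braidRadius_eq j hτ.1] at h1
    rw [braidHeight_eq i hτ.1, braidHeight_eq j hτ.1] at h2
    rcases side_eq_or i j with hs | hs
    · have h3 := P.pos_lt_of_same hij hs τ
      have h4 : lorenzRadius p q i τ < lorenzRadius p q j τ := by
        have hs' : lorenzShift p q i = lorenzShift p q j := by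
          simp only [lorenzSide] at hs
          simp only [lorenzShift]
          split_ifs at hs ⊢ <;> first | rfl | norm_num at hs
        have hij : (i : ℝ) < j := by exact_mod_cast hij
        rw [lorenzRadius, lorenzRadius, hs']
        linarith
      have := combo_pos ht (sub_pos.2 h3) (sub_pos.2 h4)
      linarith
    · have S0 := Real.smoothTransition.nonneg τ
      have S1 := Real.smoothTransition.lt_one_of_lt_one hτ.2
      rw [flatDepth, flatDepth, lorenzHeight, lorenzHeight, hs] at h2
      have hb := P.bump_nonneg τ
      have a1 := mul_nonneg (sub_nonneg.2 ht.2) hb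
      have a2 := mul_nonneg ht.1 (mul_nonneg S0 (sub_nonneg.2 S1.le))
      have hsum : (1 - t) * P.bump τ = 0 ∧
          t * (Real.smoothTransition τ * (1 - Real.smoothTransition τ)) = 0 := by
        rcases lorenzSide_cases j with hj | hj <;> rw [hj] at h2 <;> constructor <;> linarith
      rcases ht.1.eq_or_lt with rfl | ht0
      · refine hij.ne (P.pos_inj_of_zone ((P.bump_eq_zero_iff τ).1 ?_) (τ := τ) ?_) <;> linarith
      · have h3 : Real.smoothTransition τ = 0 := by
          have := (mul_eq_zero.1 hsum.2).resolve_left ht0.ne'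
          exact (mul_eq_zero.1 this).resolve_right (by linarith)
        have h4 : τ ≤ 13 / 16 := by
          rw [Real.smoothTransition.zero_iff_nonpos] at h3; linarith
        have hij' : (i : ℝ) < j := by exact_mod_cast hij
        have hn : (0 : ℝ) < p + q := by linarith [P.size_pos]
        have h5 : P.pos i τ < P.pos j τ := by
          rw [P.pos_of_le i h4, P.pos_of_le j h4]
          exact mul_lt_mul_of_pos_left (div_lt_div_of_pos_right (by linarith) hn) P.W_pos
        have h6 : lorenzRadius p q i τ < lorenzRadius p q j τ := by
          rw [lorenzRadius, lorenzRadius, h3]; linarith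
        have := combo_pos ht (sub_pos.2 h5) (sub_pos.2 h6)
        linarith
  have := closedBraid_isotopy (lorenzPerm p q)
    (fun t i τ => (1 - t) * (2 + P.pos i τ) + t * braidRadius p q i τ)
    (fun t i τ => (1 - t) * P.flatDepth i τ + t * braidHeight p q i τ) (fun i => ?_) (fun i => ?_)
    ⟨P.c₀, P.c₀_pos, by linarith [P.c₀_le], fun t _ i τ hτ => ?_⟩ (fun t ht i τ hτ => ?_)
    (fun t ht τ hτ i j h1 h2 => ?_)
  · simpa using this
  · exact (h1t.mul (hsec _ (contDiff_const.add (P.contDiff_pos i)))).add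
      (contDiff_fst.mul (hsec _ (contDiff_braidRadius p q i)))
  · exact (h1t.mul (hsec _ (P.contDiff_flatDepth i))).add
      (contDiff_fst.mul (hsec _ (contDiff_braidHeight p q i)))
  · have hτ' : τ ∈ Icc (0 : ℝ) 1 := ⟨by linarith [hτ.1, P.c₀_le], hτ.2⟩
    rw [braidRadius_glue i hτ', braidHeight_glue i hτ', P.pos_glue i hτ, (P.flatDepth_glue i hτ).1,
      (P.flatDepth_glue i hτ).2]
    exact ⟨rfl, rfl⟩
  · rw [braidRadius_eq i hτ.1]
    exact combo_pos ht (by linarith [P.pos_gt i τ]) (lorenzRadius_pos i τ)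
  · rcases lt_trichotomy i j with h | h | h
    · exact (key t ht τ hτ i j h h1 h2).elim
    · exact h
    · exact (key t ht τ hτ j i h h1.symm h2.symm).elim

/-- Both links are deformed to the same closed Lorenz braid: one by the moves on the template, the
other by those on the torus. -/
theorem torusLink_strand (hp : 1 ≤ p) (hq : 1 ≤ q) :
    SameOrientedLinkType (torusLink p q) (strandLink (P.strand 0)) := by
  have h1 := P.strandIsotopy_strand.sameOrientedLinkType
  have h2 := P.strandIsotopy_flipped.sameOrientedLinkType
  have h3 := P.strandIsotopy_rounded.sameOrientedLinkType
  rw [strandLink_congr fun i τ hτ => P.strand_one_eq i τ hτ.1] at h1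
  rw [strandLink_congr fun i τ _ => P.flipped_one i τ] at h2
  rw [strandLink_congr fun i τ _ => P.rounded_one i τ] at h3
  have h4 := (((h1.trans h2).trans h3).trans (sameOrientedLinkType_cylPoint 2 _ _)).trans
    P.closedBraid_rounded
  have h5 := braidClosure_lorenzBraid_torusLink hp hq
  have h6 : (strandLink fun (i : Fin (p + q)) τ =>
      cylPoint (lorenzRadius p q i τ) τ (lorenzHeight p q i τ)) =
      strandLink fun i τ => cylPoint (braidRadius p q i τ) τ (braidHeight p q i τ) :=
    strandLink_congr fun i τ hτ => by rw [braidRadius_eq i hτ.1, braidHeight_eq i hτ.1]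
  rw [braidClosure_lorenzBraid_singleton, h6] at h5
  exact (h4.trans h5).symm

end LobeParams

/-! ### Closing up strands to curves -/

theorem vec3_mem_leftBand {x y z : ℝ} : (!₂[x, y, z] : E3) ∈ leftBand ↔
    y = -expNegInvGlue z ∧ 0 ≤ (x + 3) * (x + 1) + z ^ 2 ∧
      ((z ≤ 0 ∧ (x + 4) * x + z ^ 2 ≤ 0) ∨ (0 ≤ z ∧ (x + 4) * (x - 1) + z ^ 2 ≤ 0)) :=
  Iff.rfl

theorem vec3_mem_rightBand {x y z : ℝ} : (!₂[x, y, z] : E3) ∈ rightBand ↔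
    y = expNegInvGlue z ∧ 0 ≤ (x - 3) * (x - 1) + z ^ 2 ∧
      ((z ≤ 0 ∧ (x - 4) * x + z ^ 2 ≤ 0) ∨ (0 ≤ z ∧ (x - 4) * (x + 1) + z ^ 2 ≤ 0)) :=
  Iff.rfl

/-- The curve that runs through the strands of a cycle one after another. -/
noncomputable def strandTrack {ι : Type*} (π : Equiv.Perm ι) (γ : ι → ℝ → E3) (i : ι) (t : ℝ) :
    E3 :=
  γ ((π ^ ⌊t⌋) i) (Int.fract t)

section StrandTrack

variable {ι : Type*} {π : Equiv.Perm ι} {γ : ι → ℝ → E3} {c : ℝ}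

/-- Gluing on an interval, not just at a point, makes the formula of one strand valid slightly
before its start; this gives smoothness at integer times. -/
theorem strandTrack_eq (hc1 : c ≤ 1)
    (hg : ∀ i, ∀ τ ∈ Icc (1 - c) 1, γ i τ = γ (π i) (τ - 1)) (i : ι) (k : ℤ) {t : ℝ}
    (ht : t ∈ Ioo (k - c) (k + 1 : ℝ)) : strandTrack π γ i t = γ ((π ^ k) i) (t - k) := by
  rcases le_or_gt (k : ℝ) t with h | h
  · have hf : ⌊t⌋ = k := Int.floor_eq_iff.2 ⟨h, ht.2⟩
    rw [strandTrack, Int.fract, hf]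
  · have hf : ⌊t⌋ = k - 1 := Int.floor_eq_iff.2 (by push_cast; constructor <;> linarith [ht.1])
    rw [strandTrack, Int.fract, hf, hg _ _ (by push_cast; constructor <;> linarith [ht.1]),
      ← Equiv.Perm.mul_apply, ← zpow_one_add]
    congr 1
    · congr 2; ring
    · push_cast; ring

theorem strandTrack_eventuallyEq (hc0 : 0 < c) (hc1 : c ≤ 1)
    (hg : ∀ i, ∀ τ ∈ Icc (1 - c) 1, γ i τ = γ (π i) (τ - 1)) (i : ι) (t : ℝ) :
    strandTrack π γ i =ᶠ[nhds t] fun s => γ ((π ^ ⌊t⌋) i) (s - ⌊t⌋) := by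
  filter_upwards [Ioo_mem_nhds (a := ⌊t⌋ - c) (b := ⌊t⌋ + 1) (by linarith [Int.floor_le t])
    (Int.lt_floor_add_one t)] with s hs
  exact strandTrack_eq hc1 hg i ⌊t⌋ hs

theorem contDiff_strandTrack (hs : ∀ i, ContDiff ℝ ∞ (γ i)) (hc0 : 0 < c) (hc1 : c ≤ 1)
    (hg : ∀ i, ∀ τ ∈ Icc (1 - c) 1, γ i τ = γ (π i) (τ - 1)) (i : ι) :
    ContDiff ℝ ∞ (strandTrack π γ i) := by
  rw [contDiff_iff_contDiffAt]
  intro t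
  exact ((hs _).comp (contDiff_id.sub contDiff_const)).contDiffAt.congr_of_eventuallyEq
    (strandTrack_eventuallyEq hc0 hc1 hg i t)

theorem deriv_strandTrack (hc0 : 0 < c) (hc1 : c ≤ 1)
    (hg : ∀ i, ∀ τ ∈ Icc (1 - c) 1, γ i τ = γ (π i) (τ - 1)) (i : ι) (t : ℝ) :
    deriv (strandTrack π γ i) t = deriv (γ ((π ^ ⌊t⌋) i)) (Int.fract t) := by
  rw [(strandTrack_eventuallyEq hc0 hc1 hg i t).deriv_eq]
  exact deriv_comp_sub_const (f := γ ((π ^ ⌊t⌋) i)) (a := (⌊t⌋ : ℝ)) (x := t)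

theorem strandTrack_add_minimalPeriod (i : ι) (t : ℝ) :
    strandTrack π γ i (t + Function.minimalPeriod π i) = strandTrack π γ i t := by
  have h : (π ^ (Function.minimalPeriod π i)) i = i := by
    rw [← Equiv.Perm.iterate_eq_pow]
    exact Function.isPeriodicPt_minimalPeriod π i
  rw [strandTrack, strandTrack, Int.fract_add_natCast, Int.floor_add_natCast, zpow_add,
    Equiv.Perm.mul_apply, zpow_natCast, h]

theorem strandTrack_injOn
    (hinj : ∀ i j, ∀ τ ∈ Ico (0 : ℝ) 1, ∀ τ' ∈ Ico (0 : ℝ) 1, γ i τ = γ j τ' → i = j ∧ τ = τ')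
    (i : ι) : InjOn (strandTrack π γ i) (Ico 0 (Function.minimalPeriod π i)) := by
  intro x hx y hy h
  obtain ⟨h1, h2⟩ := hinj _ _ _ ⟨Int.fract_nonneg x, Int.fract_lt_one x⟩ _
    ⟨Int.fract_nonneg y, Int.fract_lt_one y⟩ h
  have hfl : ∀ z ∈ Ico (0 : ℝ) (Function.minimalPeriod π i), ∃ a : ℕ, ⌊z⌋ = a ∧
      a < Function.minimalPeriod π i := by
    intro z hz
    obtain ⟨a, ha⟩ := Int.eq_ofNat_of_zero_le (Int.floor_nonneg.2 hz.1)
    refine ⟨a, ha, ?_⟩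
    have : ⌊z⌋ < (Function.minimalPeriod π i : ℤ) := Int.floor_lt.2 (by exact_mod_cast hz.2)
    rw [ha] at this
    exact_mod_cast this
  obtain ⟨a, ha, ha'⟩ := hfl x hx
  obtain ⟨b, hb, hb'⟩ := hfl y hy
  rw [ha, hb, zpow_natCast, zpow_natCast, ← Equiv.Perm.iterate_eq_pow,
    ← Equiv.Perm.iterate_eq_pow] at h1
  have hab : a = b := Function.iterate_injOn_Iio_minimalPeriod ha' hb' h1
  rw [← Int.floor_add_fract x, ← Int.floor_add_fract y, ha, hb, hab, h2]

theorem range_strandTrack (i : ι) : range (strandTrack π γ i) =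
    {Q | ∃ j, ∃ τ ∈ Ico (0 : ℝ) 1, π.SameCycle i j ∧ γ j τ = Q} := by
  ext Q
  constructor
  · rintro ⟨t, rfl⟩
    exact ⟨_, _, ⟨Int.fract_nonneg t, Int.fract_lt_one t⟩, ⟨⌊t⌋, rfl⟩, rfl⟩
  · rintro ⟨j, τ, hτ, ⟨k, rfl⟩, rfl⟩
    refine ⟨k + τ, ?_⟩
    have h1 : ⌊τ⌋ = 0 := Int.floor_eq_zero_iff.2 hτ
    have h2 : ⌊(k : ℝ) + τ⌋ = k := by rw [Int.floor_intCast_add, h1, add_zero]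
    rw [strandTrack, h2, Int.fract_intCast_add, Int.fract_eq_self.2 hτ]

/-- Strands on the Lorenz template that close up to curves form a Lorenz link. -/
theorem isLorenzLink_strandLink [Finite ι] [Nonempty ι] (hs : ∀ i, ContDiff ℝ ∞ (γ i))
    (hc0 : 0 < c) (hc1 : c ≤ 1) (hg : ∀ i, ∀ τ ∈ Icc (1 - c) 1, γ i τ = γ (π i) (τ - 1))
    (himm : ∀ i, ∀ τ ∈ Ico (0 : ℝ) 1, deriv (γ i) τ ≠ 0)
    (hinj : ∀ i j, ∀ τ ∈ Ico (0 : ℝ) 1, ∀ τ' ∈ Ico (0 : ℝ) 1, γ i τ = γ j τ' → i = j ∧ τ = τ')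
    (hmem : ∀ i, ∀ τ ∈ Ico (0 : ℝ) 1, γ i τ ∈ lorenzTemplate)
    (hleft : ∀ i, ∀ τ ∈ Ico (0 : ℝ) 1, γ i τ ∈ leftBand →
      0 < (γ i τ) 2 * (deriv (γ i) τ) 0 - ((γ i τ) 0 + 2) * (deriv (γ i) τ) 2)
    (hright : ∀ i, ∀ τ ∈ Ico (0 : ℝ) 1, γ i τ ∈ rightBand →
      0 < ((γ i τ) 0 - 2) * (deriv (γ i) τ) 2 - (γ i τ) 2 * (deriv (γ i) τ) 0) :
    IsLorenzLink (strandLink γ) := by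
  -- The components correspond to the cycles of the permutation; a representative of each is run
  -- through as often as its cycle is long, rescaled to period 1.
  have hfin : Finite (Quotient (Equiv.Perm.SameCycle.setoid π)) := inferInstance
  obtain ⟨m, ⟨e⟩⟩ := Finite.exists_equiv_fin (Quotient (Equiv.Perm.SameCycle.setoid π))
  set N : ι → ℕ := fun i => Function.minimalPeriod π i with hN
  have hN0 : ∀ i, 0 < (N i : ℝ) := by
    intro i
    have h : 0 < N i := Function.minimalPeriod_pos_of_mem_periodicPts
      (Function.Injective.mem_periodicPts π.injective i)
    exact_mod_cast h
  set Γ : ι → ℝ → E3 := fun i t => strandTrack π γ i (N i * t) with hΓ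
  have hd : ∀ i t, deriv (Γ i) t =
      (N i : ℝ) • deriv (γ ((π ^ ⌊N i * t⌋) i)) (Int.fract (N i * t)) := by
    intro i t
    have h1 : HasDerivAt (fun t : ℝ => N i * t) (N i) t := by
      simpa using (hasDerivAt_id t).const_mul (N i : ℝ)
    have h2 := (((contDiff_strandTrack hs hc0 hc1 hg i).differentiable (by simp)
      (N i * t)).hasDerivAt).scomp t h1
    rw [← deriv_strandTrack hc0 hc1 hg]
    exact h2.deriv
  have hfr : ∀ x : ℝ, Int.fract x ∈ Ico (0 : ℝ) 1 :=
    fun x => ⟨Int.fract_nonneg x, Int.fract_lt_one x⟩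
  have hrange : ∀ i, range (Γ i) = range (strandTrack π γ i) := by
    intro i
    refine Subset.antisymm ?_ ?_
    · rintro _ ⟨t, rfl⟩
      exact ⟨_, rfl⟩
    · rintro _ ⟨t, rfl⟩
      refine ⟨t / N i, ?_⟩
      simp only [hΓ]
      rw [mul_div_cancel₀ _ (hN0 i).ne']
  refine ⟨m, fun k => Γ (e.symm k).out, ?_, fun k => ⟨⟨?_, ?_, ?_, ?_⟩, ⟨?_, ?_, ?_⟩⟩, ?_, ?_⟩
  · have : 0 < m := Fin.pos (e ⟦Classical.arbitrary ι⟧)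
    exact this
  · exact (contDiff_strandTrack hs hc0 hc1 hg _).comp (contDiff_const.mul contDiff_id)
  · intro t
    simp only [hΓ]
    rw [mul_add, mul_one]
    exact strandTrack_add_minimalPeriod _ _
  · intro x hx y hy hxy
    set i := (e.symm k).out
    have hmem' : ∀ z ∈ Ico (0 : ℝ) 1, N i * z ∈ Ico (0 : ℝ) (N i) := fun z hz =>
      ⟨mul_nonneg (hN0 i).le hz.1, mul_lt_of_lt_one_right (hN0 i) hz.2⟩
    exact mul_left_cancel₀ (hN0 i).ne'
      (strandTrack_injOn hinj i (hmem' x hx) (hmem' y hy) hxy)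
  · intro t
    rw [hd]
    exact smul_ne_zero (hN0 _).ne' (himm _ _ (hfr _))
  · exact fun t => hmem _ _ (hfr _)
  · intro t ht
    have h := mul_pos (hN0 (e.symm k).out) (hleft _ _ (hfr _) ht)
    rw [hd]
    simp only [PiLp.smul_apply, smul_eq_mul]
    simp only [hΓ, strandTrack]
    linarith
  · intro t ht
    have h := mul_pos (hN0 (e.symm k).out) (hright _ _ (hfr _) ht)
    rw [hd]
    simp only [PiLp.smul_apply, smul_eq_mul]
    simp only [hΓ, strandTrack]
    linarith
  · intro k l hkl
    rw [disjoint_left]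
    intro Q h1 h2
    rw [hrange, range_strandTrack] at h1 h2
    obtain ⟨j, τ, hτ, hj, rfl⟩ := h1
    obtain ⟨j', τ', hτ', hj', heq⟩ := h2
    obtain ⟨rfl, -⟩ := hinj _ _ _ hτ' _ hτ heq
    apply hkl
    apply e.symm.injective
    rw [← Quotient.out_eq (e.symm k), ← Quotient.out_eq (e.symm l)]
    exact Quotient.sound (hj.trans hj'.symm)
  · ext Q
    rw [mem_strandLink, mem_iUnion]
    constructor
    · rintro ⟨i, τ, hτ, rfl⟩
      refine ⟨e ⟦i⟧, ?_⟩
      rw [hrange, range_strandTrack, Equiv.symm_apply_apply]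
      exact ⟨i, τ, hτ, Quotient.mk_out (s := Equiv.Perm.SameCycle.setoid π) i, rfl⟩
    · rintro ⟨k, hk⟩
      rw [hrange, range_strandTrack] at hk
      obtain ⟨j, τ, hτ, -, rfl⟩ := hk
      exact ⟨j, τ, hτ, rfl⟩

end StrandTrack

/-! ### The strands lie on the template and follow the semiflow. -/

namespace LobeParams

variable {p q : ℕ} (P : LobeParams p q)

theorem one_le_earRadius (i : Fin (p + q)) (τ : ℝ) : 1 ≤ P.earRadius i τ := by
  have h1 := (lobeGain_mem P.c₁_pos P.c₁_lt_one
    (lobeCos_le_one (τ := τ) unitInterval_zero_mem (P.lobePos_gt i τ))).1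
  have h2 := (abs_le.1 (P.abs_lobePos_le i τ)).1
  rw [earRadius, lobeRadius, sub_zero, one_mul, add_zero]
  nlinarith

theorem earRadius_le' (i : Fin (p + q)) (τ : ℝ) : P.earRadius i τ ≤ 12 / 5 := by
  have h1 := (lobeGain_mem P.c₁_pos P.c₁_lt_one
    (lobeCos_le_one (τ := τ) unitInterval_zero_mem (P.lobePos_gt i τ))).2
  have h2 := abs_le.1 (P.abs_lobePos_le i τ)
  have h3 : 1 / P.c₁ ≤ 16 / 15 := by
    rw [div_le_div_iff₀ P.c₁_pos (by norm_num)]; linarith [P.le_c₁]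
  rw [earRadius, lobeRadius, sub_zero, one_mul, add_zero]
  nlinarith

/-- In polar coordinates about the ear the conditions read `R² ≥ 1`, then `R² ≤ 4` below the branch
line and `R² - R C ≤ 6` above it. The last one follows from `R ≤ 2` before the stretching, and from
`R ≤ 12/5` and `C ≥ 0` after it has begun. -/
theorem band_bounds (i : Fin (p + q)) {τ : ℝ} (hτ : τ ∈ Ico (0 : ℝ) 1) :
    0 ≤ (-(lorenzSide p q i * P.xpos i τ) + 3) * (-(lorenzSide p q i * P.xpos i τ) + 1) +
        P.height i τ ^ 2 ∧
      ((P.height i τ ≤ 0 ∧ (-(lorenzSide p q i * P.xpos i τ) + 4) *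
          -(lorenzSide p q i * P.xpos i τ) + P.height i τ ^ 2 ≤ 0) ∨
        (0 ≤ P.height i τ ∧ (-(lorenzSide p q i * P.xpos i τ) + 4) *
          (-(lorenzSide p q i * P.xpos i τ) - 1) + P.height i τ ^ 2 ≤ 0)) := by
  have h1 := P.one_le_earRadius i τ
  have h2 := P.earRadius_le' i τ
  have hcs := P.earCos_sq_add i τ
  rw [P.side_mul_xpos, height]
  set R := P.earRadius i τ with hR
  set C := P.earCos i τ with hC
  set S := P.earSin i τ
  have e : (R * C) ^ 2 + (R * S) ^ 2 = R ^ 2 := by linear_combination R ^ 2 * hcs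
  refine ⟨by nlinarith, ?_⟩
  rcases le_or_gt (-(R * S)) 0 with h | h
  · left
    have h3 := P.earRadius_le i (τ := τ)
      ((P.le_half_of_height_nonpos (i := i) hτ.2 h).trans (by norm_num))
    exact ⟨h, by nlinarith⟩
  · right
    refine ⟨h.le, ?_⟩
    rcases le_or_gt τ (13 / 16) with h' | h'
    · have h3 := P.earRadius_le i h'
      have h4 : -1 ≤ C := by nlinarith [sq_nonneg S]
      nlinarith
    · have h4 : 0 ≤ C := by
        have h5 : 0 ≤ Real.cos (2 * Real.pi * τ) := by
          have h6 : 2 * Real.pi * τ = 2 * Real.pi * τ - 2 * Real.pi + 2 * Real.pi := by ring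
          rw [h6, Real.cos_add_two_pi]
          apply Real.cos_nonneg_of_neg_pi_div_two_le_of_le <;> nlinarith [Real.pi_pos, hτ.2]
        exact div_nonneg h5 (lobeNorm_pos unitInterval_zero_mem (P.lobePos_gt i τ)).le
      have h5 : 0 ≤ R * C := mul_nonneg (by linarith) h4
      nlinarith

theorem depth_zero (i : Fin (p + q)) {τ : ℝ} (hτ : 0 ≤ τ) :
    P.depth 0 i τ = lorenzSide p q i * expNegInvGlue (P.height i τ) := by
  rw [P.depth_eq 0 i hτ]
  ring

theorem strand_mem_lorenzTemplate (i : Fin (p + q)) {τ : ℝ} (hτ : τ ∈ Ico (0 : ℝ) 1) :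
    P.strand 0 i τ ∈ lorenzTemplate := by
  obtain ⟨h1, h2⟩ := P.band_bounds i hτ
  have hy := P.depth_zero i hτ.1
  rcases lorenzSide_cases i with hs | hs <;> rw [hs] at h1 h2 hy
  · rw [neg_one_mul, neg_neg] at h1 h2
    rw [neg_one_mul] at hy
    exact Or.inl (vec3_mem_leftBand.2 ⟨hy, h1, h2⟩)
  · rw [one_mul] at h1 h2 hy
    refine Or.inr (vec3_mem_rightBand.2 ⟨hy, by linarith, ?_⟩)
    exact h2.imp (fun h => ⟨h.1, by linarith [h.2]⟩) (fun h => ⟨h.1, by linarith [h.2]⟩)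

/-- The condition is also imposed at points of the left band that belong to a strand around the
right ear. Such points can only lie on the branch line, where turning around either ear means
running downwards. -/
theorem strand_left (i : Fin (p + q)) {τ : ℝ} (hτ : τ ∈ Ico (0 : ℝ) 1)
    (h : P.strand 0 i τ ∈ leftBand) :
    0 < P.height i τ * deriv (P.xpos i) τ - (P.xpos i τ + 2) * deriv (P.height i) τ := by
  have ht := P.turns i τ
  obtain ⟨h1, -, h3⟩ := vec3_mem_leftBand.1 h
  rw [P.depth_zero i hτ.1] at h1
  rcases lorenzSide_cases i with hs | hs <;> rw [hs] at ht h1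
  · linarith
  have hE := expNegInvGlue.nonneg (P.height i τ)
  have h4 : P.height i τ ≤ 0 := expNegInvGlue.zero_iff_nonpos.1 (by linarith)
  have h5 := P.side_mul_xpos_pos i (τ := τ)
    ((P.le_half_of_height_nonpos (i := i) hτ.2 h4).trans (by norm_num))
  rw [hs, one_mul] at h5
  rcases h3 with ⟨-, h3⟩ | ⟨h6, h3⟩
  · have := mul_pos (by linarith : 0 < P.xpos i τ + 4) h5
    linarith [sq_nonneg (P.height i τ)]
  · have h7 : P.height i τ = 0 := le_antisymm h4 h6
    rw [h7] at ht h3 ⊢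
    have h8 : P.xpos i τ ≤ 1 := by
      by_contra h8
      have := mul_pos (by linarith : 0 < P.xpos i τ + 4) (sub_pos.2 (not_le.1 h8))
      linarith
    have h9 : deriv (P.height i) τ < 0 := by
      by_contra h9
      have := mul_nonneg (by linarith : 0 ≤ 2 - P.xpos i τ) (not_lt.1 h9)
      linarith
    have := mul_pos (by linarith : 0 < P.xpos i τ + 2) (neg_pos.2 h9)
    linarith

theorem strand_right (i : Fin (p + q)) {τ : ℝ} (hτ : τ ∈ Ico (0 : ℝ) 1)
    (h : P.strand 0 i τ ∈ rightBand) :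
    0 < (P.xpos i τ - 2) * deriv (P.height i) τ - P.height i τ * deriv (P.xpos i) τ := by
  have ht := P.turns i τ
  obtain ⟨h1, -, h3⟩ := vec3_mem_rightBand.1 h
  rw [P.depth_zero i hτ.1] at h1
  rcases lorenzSide_cases i with hs | hs <;> rw [hs] at ht h1
  swap
  · linarith
  have hE := expNegInvGlue.nonneg (P.height i τ)
  have h4 : P.height i τ ≤ 0 := expNegInvGlue.zero_iff_nonpos.1 (by linarith)
  have h5 := P.side_mul_xpos_pos i (τ := τ)
    ((P.le_half_of_height_nonpos (i := i) hτ.2 h4).trans (by norm_num))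
  rw [hs, neg_one_mul] at h5
  rcases h3 with ⟨-, h3⟩ | ⟨h6, h3⟩
  · have := mul_pos (by linarith : 0 < 4 - P.xpos i τ) h5
    linarith [sq_nonneg (P.height i τ)]
  · have h7 : P.height i τ = 0 := le_antisymm h4 h6
    rw [h7] at ht h3 ⊢
    have h8 : -1 ≤ P.xpos i τ := by
      by_contra h8
      have := mul_pos (by linarith : 0 < 4 - P.xpos i τ) (sub_pos.2 (not_le.1 h8))
      linarith
    have h9 : deriv (P.height i) τ < 0 := by
      by_contra h9
      have := mul_nonneg (by linarith : 0 ≤ P.xpos i τ + 2) (not_lt.1 h9)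
      linarith
    have := mul_pos (by linarith : 0 < 2 - P.xpos i τ) (neg_pos.2 h9)
    linarith

theorem isLorenzLink_strand : IsLorenzLink (strandLink (P.strand 0)) := by
  have hne : Nonempty (Fin (p + q)) := by
    have h : 0 < p + q := by
      have := P.size_pos
      by_contra h
      have h0 : p + q = 0 := by omega
      have h1 : ((p + q : ℕ) : ℝ) = 0 := by rw [h0]; simp
      push_cast at h1
      linarith
    exact ⟨⟨0, h⟩⟩
  have hI := P.strandIsotopy_strand
  have h0 : (0 : ℝ) ∈ Icc (0 : ℝ) 1 := by norm_num
  obtain ⟨c, hc0, hc1, hg⟩ := hI.glue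
  refine isLorenzLink_strandLink (π := lorenzPerm p q) (γ := P.strand 0) (c := c)
    (fun i => ?_) hc0 hc1 (fun i τ hτ => hg 0 h0 i τ hτ) (fun i τ hτ => hI.immersion 0 h0 i τ hτ)
    (fun i j τ hτ τ' hτ' h => hI.inj 0 h0 i j τ hτ τ' hτ' h)
    (fun i τ hτ => P.strand_mem_lorenzTemplate i hτ) (fun i τ hτ h => ?_) (fun i τ hτ h => ?_)
  · have h1 : ContDiff ℝ ∞ fun τ : ℝ => P.depth 0 i τ :=
      (P.contDiff_depth i).comp (contDiff_const.prodMk contDiff_id)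
    exact (P.contDiff_xpos i).vec3 h1 (P.contDiff_height i)
  · rw [(P.hasDerivAt_strand 0 i τ).deriv]
    exact P.strand_left i hτ h
  · rw [(P.hasDerivAt_strand 0 i τ).deriv]
    exact P.strand_right i hτ h

end LobeParams

/-- Torus links of positive type are Lorenz links. -/
theorem exists_isLorenzLink_torusLink {p q : ℕ} (hp : 1 ≤ p) (hq : 1 ≤ q) :
    ∃ L : Set E3, IsLorenzLink L ∧ SameOrientedLinkType (torusLink p q) L := by
  obtain ⟨P⟩ := nonempty_lobeParams hp hq
  exact ⟨_, P.isLorenzLink_strand, P.torusLink_strand hp hq⟩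

/-! ### Unlinks -/

/-- Radii of concentric circles, strictly between `1` and `2`. -/
noncomputable def unlinkRadius (d : ℕ) (i : Fin d) : ℝ := 2 - (i + 1) / (d + 1)

theorem unlinkRadius_mem {d : ℕ} (i : Fin d) : unlinkRadius d i ∈ Ioo (1 : ℝ) 2 := by
  have h1 : (i : ℝ) + 1 ≤ d := by exact_mod_cast i.2
  have h2 : ((i : ℝ) + 1) / (d + 1) < 1 := by
    rw [div_lt_one (by positivity)]; linarith
  have h3 : 0 < ((i : ℝ) + 1) / (d + 1) := by positivity
  rw [unlinkRadius]
  constructor <;> linarith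

theorem unlinkRadius_lt {d : ℕ} {i j : Fin d} (h : i < j) :
    unlinkRadius d j < unlinkRadius d i := by
  have : (i : ℝ) < j := by exact_mod_cast h
  rw [unlinkRadius, unlinkRadius]
  have : ((i : ℝ) + 1) / (d + 1) < (j + 1) / (d + 1) :=
    div_lt_div_of_pos_right (by linarith) (by positivity)
  linarith

theorem unlinkRadius_injective (d : ℕ) : Function.Injective (unlinkRadius d) := by
  intro i j h
  rcases lt_trichotomy i j with hij | hij | hij
  · exact absurd h (unlinkRadius_lt hij).ne'
  · exact hij
  · exact absurd h (unlinkRadius_lt hij).ne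

/-- Isotopy of links that consist of parallel circles. -/
theorem parallelCircles_isotopy {ι : Type*} [Finite ι] (r h : ℝ → ι → ℝ)
    (hr : ∀ i, ContDiff ℝ ∞ fun t => r t i) (hh : ∀ i, ContDiff ℝ ∞ fun t => h t i)
    (hpos : ∀ t ∈ Icc (0 : ℝ) 1, ∀ i, 0 < r t i)
    (hne : ∀ t ∈ Icc (0 : ℝ) 1, ∀ i j, r t i = r t j → h t i = h t j → i = j) :
    SameOrientedLinkType (strandLink fun i τ => cylPoint (r 0 i) τ (h 0 i))
      (strandLink fun i τ => cylPoint (r 1 i) τ (h 1 i)) :=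
  closedBraid_isotopy (Equiv.refl ι) (fun t i _ => r t i) (fun t i _ => h t i)
    (fun i => (hr i).comp contDiff_fst) (fun i => (hh i).comp contDiff_fst)
    ⟨1, one_pos, le_rfl, fun _ _ _ _ _ => ⟨rfl, rfl⟩⟩ (fun t ht i _ _ => hpos t ht i)
    (fun t ht _ _ i j => hne t ht i j)

/-- Concentric circles in the plane. -/
noncomputable def concentricCircles (d : ℕ) : Set E3 :=
  strandLink fun (i : Fin d) τ => cylPoint (unlinkRadius d i) τ 0

/-- Circles around the left ear of the Lorenz template. -/
noncomputable def earCircle (d : ℕ) (i : Fin d) (τ : ℝ) : E3 :=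
  !₂[-2 + unlinkRadius d i * Real.cos (2 * Real.pi * τ),
    -expNegInvGlue (-(unlinkRadius d i * Real.sin (2 * Real.pi * τ))),
    -(unlinkRadius d i * Real.sin (2 * Real.pi * τ))]

theorem contDiff_earDepth (r : ℝ) :
    ContDiff ℝ ∞ fun τ : ℝ => -expNegInvGlue (-(r * Real.sin (2 * Real.pi * τ))) := by
  have hE : ContDiff ℝ ∞ expNegInvGlue := expNegInvGlue.contDiff
  exact (hE.comp (by fun_prop : ContDiff ℝ ∞ fun τ : ℝ =>
    -(r * Real.sin (2 * Real.pi * τ)))).neg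

/-- After the axis is turned, the heights are shrunk to 0; the distinct constant radii keep the
circles apart. -/
theorem earCircle_concentric (d : ℕ) :
    SameOrientedLinkType (strandLink (earCircle d)) (concentricCircles d) := by
  refine (sameOrientedLinkType_cylPoint 2 (fun i _ => unlinkRadius d i) (fun i τ =>
    -expNegInvGlue (-(unlinkRadius d i * Real.sin (2 * Real.pi * τ))))).trans ?_
  have := closedBraid_isotopy (Equiv.refl (Fin d)) (fun _ i _ => unlinkRadius d i)
    (fun t i τ => (1 - t) * -expNegInvGlue (-(unlinkRadius d i * Real.sin (2 * Real.pi * τ))))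
    (fun i => contDiff_const) (fun i => (contDiff_const.sub contDiff_fst).mul
      ((contDiff_earDepth _).comp contDiff_snd))
    ⟨1, one_pos, le_rfl, fun t _ i τ _ => ⟨rfl, ?_⟩⟩
    (fun t _ i τ _ => by linarith [(unlinkRadius_mem i).1])
    (fun t _ τ _ i j h _ => unlinkRadius_injective d h)
  · simpa [concentricCircles] using this
  · have h5 : 2 * Real.pi * (τ - 1) = 2 * Real.pi * τ - 2 * Real.pi := by ring
    simp only [Equiv.refl_apply, h5, Real.sin_sub_two_pi]

theorem hasDerivAt_earCircle (d : ℕ) (i : Fin d) (τ : ℝ) : ∃ y', HasDerivAt (earCircle d i)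
    !₂[-(unlinkRadius d i * (2 * Real.pi) * Real.sin (2 * Real.pi * τ)), y',
      -(unlinkRadius d i * (2 * Real.pi) * Real.cos (2 * Real.pi * τ))] τ := by
  have hω : HasDerivAt (fun t : ℝ => 2 * Real.pi * t) (2 * Real.pi) τ := by
    simpa using (hasDerivAt_id τ).const_mul (2 * Real.pi)
  have hy := ((contDiff_earDepth (unlinkRadius d i)).differentiable (by simp) τ).hasDerivAt
  refine ⟨_, HasDerivAt.vec3 (((hω.cos.const_mul _).const_add (-2)).congr_deriv ?_) hy
    ((hω.sin.const_mul _).neg.congr_deriv ?_)⟩ <;> ring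

theorem earCircle_turns (d : ℕ) (i : Fin d) (τ : ℝ) :
    0 < (earCircle d i τ) 2 * (deriv (earCircle d i) τ) 0 -
      ((earCircle d i τ) 0 + 2) * (deriv (earCircle d i) τ) 2 := by
  obtain ⟨y', h⟩ := hasDerivAt_earCircle d i τ
  have hcs := Real.cos_sq_add_sin_sq (2 * Real.pi * τ)
  have hr : 0 < unlinkRadius d i := by linarith [(unlinkRadius_mem i).1]
  rw [h.deriv]
  have e : (earCircle d i τ) 2 *
      -(unlinkRadius d i * (2 * Real.pi) * Real.sin (2 * Real.pi * τ)) -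
      ((earCircle d i τ) 0 + 2) *
        -(unlinkRadius d i * (2 * Real.pi) * Real.cos (2 * Real.pi * τ)) =
      unlinkRadius d i ^ 2 * (2 * Real.pi) := by
    simp only [earCircle]
    simp
    linear_combination unlinkRadius d i ^ 2 * (2 * Real.pi) * hcs
  have : 0 < unlinkRadius d i ^ 2 * (2 * Real.pi) := by positivity
  rw [← e] at this
  exact this

/-- The radii lie between 1 and 2, so the circles stay in the part of the left band that is not
stretched, and each crosses the left half of the branch line. -/
theorem isLorenzLink_earCircle {d : ℕ} (hd : 1 ≤ d) :
    IsLorenzLink (strandLink (earCircle d)) := by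
  have hne : Nonempty (Fin d) := ⟨⟨0, hd⟩⟩
  refine isLorenzLink_strandLink (π := Equiv.refl _) (γ := earCircle d) (c := 1) (fun i => ?_)
    one_pos le_rfl (fun i τ _ => ?_) (fun i τ _ h => ?_) (fun i j τ hτ τ' hτ' h => ?_)
    (fun i τ _ => ?_) (fun i τ _ _ => earCircle_turns d i τ) (fun i τ _ h => ?_)
  · exact ContDiff.vec3 (by fun_prop) (contDiff_earDepth _) (by fun_prop)
  · have h5 : 2 * Real.pi * (τ - 1) = 2 * Real.pi * τ - 2 * Real.pi := by ring
    simp only [earCircle, Equiv.refl_apply, h5, Real.sin_sub_two_pi, Real.cos_sub_two_pi]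
  · have := earCircle_turns d i τ
    rw [h] at this
    simp at this
  · obtain ⟨h1, -, h3⟩ := vec3_inj.1 h
    have hi := (unlinkRadius_mem i).1
    have hj := (unlinkRadius_mem j).1
    obtain ⟨h4, h5, h6⟩ := polar_inj (by linarith) (by linarith)
      (Real.cos_sq_add_sin_sq (2 * Real.pi * τ)) (Real.cos_sq_add_sin_sq (2 * Real.pi * τ'))
      (by linarith) (neg_inj.1 h3)
    exact ⟨unlinkRadius_injective d h4, two_pi_injOn hτ hτ' h5 h6⟩
  · obtain ⟨h1, h2⟩ := unlinkRadius_mem i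
    have hcs := Real.cos_sq_add_sin_sq (2 * Real.pi * τ)
    have hc := Real.neg_one_le_cos (2 * Real.pi * τ)
    set R := unlinkRadius d i
    set C := Real.cos (2 * Real.pi * τ)
    set S := Real.sin (2 * Real.pi * τ)
    have e : (R * C) ^ 2 + (R * S) ^ 2 = R ^ 2 := by linear_combination R ^ 2 * hcs
    have hRC : -R ≤ R * C := by
      linarith [mul_nonneg (by linarith : 0 ≤ R) (by linarith : 0 ≤ C + 1)]
    refine Or.inl (vec3_mem_leftBand.2 ⟨rfl, ?_, ?_⟩)
    · nlinarith
    · rcases le_total (-(R * S)) 0 with h | h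
      · exact Or.inl ⟨h, by nlinarith⟩
      · exact Or.inr ⟨h, by nlinarith⟩
  · obtain ⟨h1, h2⟩ := unlinkRadius_mem i
    have hcs := Real.cos_sq_add_sin_sq (2 * Real.pi * τ)
    obtain ⟨hy, -, h3⟩ := vec3_mem_rightBand.1 h
    have ht := earCircle_turns d i τ
    have hc1 := Real.cos_le_one (2 * Real.pi * τ)
    have e0 : (earCircle d i τ) 0 = -2 + unlinkRadius d i * Real.cos (2 * Real.pi * τ) := rfl
    have e2 : (earCircle d i τ) 2 = -(unlinkRadius d i * Real.sin (2 * Real.pi * τ)) := rfl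
    have hE := expNegInvGlue.nonneg (-(unlinkRadius d i * Real.sin (2 * Real.pi * τ)))
    have hz : -(unlinkRadius d i * Real.sin (2 * Real.pi * τ)) ≤ 0 :=
      expNegInvGlue.zero_iff_nonpos.1 (by linarith)
    rw [← e0, ← e2] at h3
    rw [← e2] at hz
    have hx : (earCircle d i τ) 0 < 0 := by rw [e0]; nlinarith
    rcases h3 with ⟨-, h3⟩ | ⟨h4, h3⟩
    · have := mul_pos (by linarith : 0 < 4 - (earCircle d i τ) 0) (neg_pos.2 hx)
      linarith [sq_nonneg ((earCircle d i τ) 2)]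
    · have h5 : (earCircle d i τ) 2 = 0 := le_antisymm hz h4
      rw [h5] at ht h3 ⊢
      have h6 : -1 ≤ (earCircle d i τ) 0 := by
        by_contra h6
        have := mul_pos (by linarith : 0 < 4 - (earCircle d i τ) 0) (sub_pos.2 (not_le.1 h6))
        linarith
      have h7 : (deriv (earCircle d i) τ) 2 < 0 := by
        by_contra h7
        have := mul_nonneg (by linarith : 0 ≤ (earCircle d i τ) 0 + 2) (not_lt.1 h7)
        linarith
      have := mul_pos (by linarith : 0 < 2 - (earCircle d i τ) 0) (neg_pos.2 h7)
      linarith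

/-! ### Degenerate torus links -/

theorem Circle.exp_two_pi_zpow_eq_one {d : ℕ} (hd : 1 ≤ d) (v : Circle) :
    v ^ (d : ℤ) = 1 ↔ ∃ i : Fin d, v = Circle.exp (2 * Real.pi * (i / d)) := by
  have hd0 : (d : ℝ) ≠ 0 := by positivity
  constructor
  · intro h
    obtain ⟨x, hx, rfl⟩ := Circle.exists_exp_two_pi v
    rw [Circle.exp_two_pi_zpow] at h
    have h1 : Circle.exp (2 * Real.pi * ((d : ℤ) * x)) = Circle.exp (2 * Real.pi * 0) := by
      rw [h]; simp
    obtain ⟨k, hk⟩ := Circle.exp_two_pi_inj h1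
    rw [zero_add, Int.cast_natCast] at hk
    have hk0 : 0 ≤ k := by
      have : (0 : ℝ) ≤ k := by rw [← hk]; exact mul_nonneg (by positivity) hx.1
      exact_mod_cast this
    have hk1 : k < d := by
      have : (k : ℝ) < d := by
        rw [← hk]; exact mul_lt_of_lt_one_right (by positivity) hx.2
      exact_mod_cast this
    have hkN : ((k.toNat : ℕ) : ℝ) = k := by
      have : ((k.toNat : ℕ) : ℤ) = k := Int.toNat_of_nonneg hk0
      exact_mod_cast this
    refine ⟨⟨k.toNat, by omega⟩, ?_⟩
    simp only [hkN, ← hk]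
    rw [mul_div_cancel_left₀ _ hd0]
  · rintro ⟨i, rfl⟩
    rw [Circle.exp_two_pi_zpow, Int.cast_natCast, mul_div_cancel₀ _ hd0]
    have := Circle.exp_two_pi_add_int 0 i
    simpa using this

theorem fin_div_mem {d : ℕ} (i : Fin d) : (i / d : ℝ) ∈ Ico (0 : ℝ) 1 := by
  have h1 : (i : ℝ) < d := by exact_mod_cast i.2
  exact ⟨by positivity, (div_lt_one (lt_of_le_of_lt (by positivity) h1)).2 h1⟩

theorem fin_div_lt {d : ℕ} {i j : Fin d} (h : i < j) : (i / d : ℝ) < j / d := by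
  have h0 : (j : ℝ) < d := by exact_mod_cast j.2
  have h1 : (i : ℝ) < j := by exact_mod_cast h
  exact div_lt_div_of_pos_right h1 (lt_of_le_of_lt (by positivity) h0)

theorem fin_div_injective (d : ℕ) : Function.Injective fun i : Fin d => (i / d : ℝ) := by
  intro i j h
  rcases lt_trichotomy i j with hij | hij | hij
  · exact absurd h (fin_div_lt hij).ne
  · exact hij
  · exact absurd h (fin_div_lt hij).ne'

theorem torusLink_left_eq {d : ℕ} (hd : 1 ≤ d) : torusLink d 0 =
    strandLink fun (i : Fin d) τ => cylPoint (2 + Real.cos (2 * Real.pi * (i / d))) τ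
      (Real.sin (2 * Real.pi * (i / d))) := by
  ext P
  rw [mem_strandLink]
  constructor
  · rintro ⟨u, v, huv, rfl⟩
    rw [zpow_zero] at huv
    obtain ⟨i, rfl⟩ := (Circle.exp_two_pi_zpow_eq_one hd v).1 huv.symm
    obtain ⟨τ, hτ, rfl⟩ := Circle.exists_exp_two_pi u
    exact ⟨i, τ, hτ, by simp only [torusPoint, cylPoint, Circle.exp_re, Circle.exp_im]⟩
  · rintro ⟨i, τ, -, rfl⟩
    refine ⟨Circle.exp (2 * Real.pi * τ), Circle.exp (2 * Real.pi * (i / d)), ?_,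
      by simp only [torusPoint, cylPoint, Circle.exp_re, Circle.exp_im]⟩
    rw [zpow_zero]
    exact ((Circle.exp_two_pi_zpow_eq_one hd _).2 ⟨i, rfl⟩).symm

theorem torusLink_left_concentric {d : ℕ} (hd : 1 ≤ d) :
    SameOrientedLinkType (torusLink d 0) (concentricCircles d) := by
  rw [torusLink_left_eq hd]
  -- The meridional angles are squeezed from `[0, 2π)` into `[0, π)`, where the cosine, hence the
  -- radius, separates the circles.
  have h1 := parallelCircles_isotopy
    (fun t (i : Fin d) => 2 + Real.cos (2 * Real.pi * ((1 - t / 2) * (i / d))))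
    (fun t (i : Fin d) => Real.sin (2 * Real.pi * ((1 - t / 2) * (i / d))))
    (fun i => by fun_prop) (fun i => by fun_prop)
    (fun t _ i => by linarith [Real.neg_one_le_cos (2 * Real.pi * ((1 - t / 2) * (i / d)))])
    (fun t ht i j hc hs => by
      have hm : ∀ k : Fin d, (1 - t / 2) * (k / d : ℝ) ∈ Ico (0 : ℝ) 1 := fun k => by
        obtain ⟨a, b⟩ := fin_div_mem k
        have h0 : 0 ≤ 1 - t / 2 := by linarith [ht.2]
        exact ⟨mul_nonneg h0 a, lt_of_le_of_lt (mul_le_of_le_one_left a (by linarith [ht.1])) b⟩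
      have h := two_pi_injOn (hm i) (hm j) (by linarith) hs
      exact fin_div_injective d (mul_left_cancel₀ (by linarith [ht.2]) h))
  -- Now the radii decrease with the index at both ends, so the heights may be flattened at will.
  have h2 := parallelCircles_isotopy
    (fun t (i : Fin d) => (1 - t) * (2 + Real.cos (Real.pi * (i / d))) + t * unlinkRadius d i)
    (fun t (i : Fin d) => (1 - t) * Real.sin (Real.pi * (i / d)))
    (fun i => by fun_prop) (fun i => by fun_prop)
    (fun t ht i => combo_pos ht (by linarith [Real.neg_one_le_cos (Real.pi * (i / d))])
      (by linarith [(unlinkRadius_mem i).1]))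
    (fun t ht i j hr _ => by
      have hlt : ∀ i j : Fin d, i < j →
          (1 - t) * (2 + Real.cos (Real.pi * (j / d))) + t * unlinkRadius d j <
          (1 - t) * (2 + Real.cos (Real.pi * (i / d))) + t * unlinkRadius d i := by
        intro i j hij
        have h3 : Real.cos (Real.pi * (j / d)) < Real.cos (Real.pi * (i / d)) :=
          Real.cos_lt_cos_of_nonneg_of_le_pi (mul_nonneg Real.pi_pos.le (fin_div_mem i).1)
            (mul_le_of_le_one_right Real.pi_pos.le (fin_div_mem j).2.le)
            (mul_lt_mul_of_pos_left (fin_div_lt hij) Real.pi_pos)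
        have := combo_pos ht (sub_pos.2 h3) (sub_pos.2 (unlinkRadius_lt hij))
        linarith
      rcases lt_trichotomy i j with hij | hij | hij
      · exact absurd hr (hlt i j hij).ne'
      · exact hij
      · exact absurd hr (hlt j i hij).ne)
  have e1 : ∀ x : ℝ, 2 * Real.pi * ((1 - 1 / 2) * x) = Real.pi * x := fun x => by ring
  simp only [zero_div, sub_zero, one_mul, zero_mul, add_zero, sub_self, zero_add, e1] at h1 h2
  exact h1.trans h2

/-- Isotopy of links that consist of meridian circles. -/
theorem meridians_isotopy {ι : Type*} [Finite ι] (a b e : ℝ → ι → ℝ)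
    (ha : ∀ i, ContDiff ℝ ∞ fun t => a t i) (hb : ∀ i, ContDiff ℝ ∞ fun t => b t i)
    (he : ∀ i, ContDiff ℝ ∞ fun t => e t i)
    (h0 : ∀ t ∈ Icc (0 : ℝ) 1, ∀ i, 0 < a t i ^ 2 + b t i ^ 2)
    (hne : ∀ t ∈ Icc (0 : ℝ) 1, ∀ i j, ∀ ρ ρ' : ℝ, 0 < ρ → 0 < ρ' → ρ * a t i = ρ' * a t j →
      ρ * b t i + e t i = ρ' * b t j + e t j → i = j) :
    SameOrientedLinkType
      (strandLink fun i τ => !₂[(2 + Real.cos (2 * Real.pi * τ)) * a 0 i,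
        (2 + Real.cos (2 * Real.pi * τ)) * b 0 i + e 0 i, -Real.sin (2 * Real.pi * τ)])
      (strandLink fun i τ => !₂[(2 + Real.cos (2 * Real.pi * τ)) * a 1 i,
        (2 + Real.cos (2 * Real.pi * τ)) * b 1 i + e 1 i, -Real.sin (2 * Real.pi * τ)]) := by
  have hpos : ∀ x : ℝ, 0 < 2 + Real.cos x := fun x => by linarith [Real.neg_one_le_cos x]
  refine StrandIsotopy.sameOrientedLinkType (π := Equiv.refl ι)
    (H := fun t i τ => !₂[(2 + Real.cos (2 * Real.pi * τ)) * a t i,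
        (2 + Real.cos (2 * Real.pi * τ)) * b t i + e t i, -Real.sin (2 * Real.pi * τ)])
    ⟨fun i => ?_, ⟨1, one_pos, le_rfl, fun t _ i τ _ => ?_⟩, fun t ht i τ _ h => ?_,
      fun t ht i j τ hτ τ' hτ' h => ?_⟩
  · have ha' := (ha i).comp (contDiff_fst : ContDiff ℝ ∞ (Prod.fst : ℝ × ℝ → ℝ))
    have hb' := (hb i).comp (contDiff_fst : ContDiff ℝ ∞ (Prod.fst : ℝ × ℝ → ℝ))
    have he' := (he i).comp (contDiff_fst : ContDiff ℝ ∞ (Prod.fst : ℝ × ℝ → ℝ))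
    have hc : ContDiff ℝ ∞ fun z : ℝ × ℝ => 2 + Real.cos (2 * Real.pi * z.2) := by fun_prop
    exact (hc.mul ha').vec3 ((hc.mul hb').add he') (by fun_prop)
  · have h5 : 2 * Real.pi * (τ - 1) = 2 * Real.pi * τ - 2 * Real.pi := by ring
    simp only [Equiv.refl_apply, h5, Real.sin_sub_two_pi, Real.cos_sub_two_pi]
  · have hω : HasDerivAt (fun t : ℝ => 2 * Real.pi * t) (2 * Real.pi) τ := by
      simpa using (hasDerivAt_id τ).const_mul (2 * Real.pi)
    have hd := ((hω.cos.const_add 2).mul_const (a t i)).vec3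
      (((hω.cos.const_add 2).mul_const (b t i)).add_const (e t i)) hω.sin.neg
    replace h := hd.deriv.symm.trans h
    have e0 := congrArg (fun Q : E3 => Q 0) h
    have e1 := congrArg (fun Q : E3 => Q 1) h
    have e2 := congrArg (fun Q : E3 => Q 2) h
    simp only [PiLp.zero_apply] at e0 e1 e2
    have hcs := Real.cos_sq_add_sin_sq (2 * Real.pi * τ)
    set c := Real.cos (2 * Real.pi * τ)
    set s := Real.sin (2 * Real.pi * τ)
    have e0' : -s * (2 * Real.pi) * a t i = 0 := e0
    have e1' : -s * (2 * Real.pi) * b t i = 0 := e1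
    have e2' : -(c * (2 * Real.pi)) = 0 := e2
    have hc : c = 0 := by
      have := neg_eq_zero.1 e2'
      exact (mul_eq_zero.1 this).resolve_right (by positivity)
    have hs : s * (a t i ^ 2 + b t i ^ 2) = 0 := by
      have h1 : 2 * Real.pi * (s * (a t i ^ 2 + b t i ^ 2)) = 0 := by
        linear_combination -(a t i) * e0' - b t i * e1'
      exact (mul_eq_zero.1 h1).resolve_left (by positivity)
    have hs0 := (mul_eq_zero.1 hs).resolve_right (h0 t ht i).ne'
    rw [hc, hs0] at hcs
    norm_num at hcs
  · obtain ⟨h1, h2, h3⟩ := vec3_inj.1 h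
    have hij := hne t ht i j _ _ (hpos _) (hpos _) h1 h2
    subst hij
    refine ⟨rfl, two_pi_injOn hτ hτ' ?_ (neg_inj.1 h3)⟩
    have h4 : (Real.cos (2 * Real.pi * τ) - Real.cos (2 * Real.pi * τ')) *
        (a t i ^ 2 + b t i ^ 2) = 0 := by linear_combination a t i * h1 + b t i * h2
    linarith [(mul_eq_zero.1 h4).resolve_right (h0 t ht i).ne']

/-- The meridians are traversed backwards, so that the third coordinate has the sign required by
`sameOrientedLinkType_cylPoint`. -/
theorem torusLink_right_eq {d : ℕ} (hd : 1 ≤ d) : torusLink 0 d =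
    strandLink fun (i : Fin d) τ =>
      !₂[(2 + Real.cos (2 * Real.pi * τ)) * Real.cos (2 * Real.pi * (i / d)),
        (2 + Real.cos (2 * Real.pi * τ)) * Real.sin (2 * Real.pi * (i / d)) + 0,
        -Real.sin (2 * Real.pi * τ)] := by
  have key : ∀ (i : Fin d) (τ : ℝ),
      (!₂[(2 + Real.cos (2 * Real.pi * τ)) * Real.cos (2 * Real.pi * (i / d)),
        (2 + Real.cos (2 * Real.pi * τ)) * Real.sin (2 * Real.pi * (i / d)) + 0,
        -Real.sin (2 * Real.pi * τ)] : E3) =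
      torusPoint (Circle.exp (2 * Real.pi * (i / d))) (Circle.exp (2 * Real.pi * τ))⁻¹ := by
    intro i τ
    rw [torusPoint, ← Circle.exp_neg]
    simp only [Circle.exp_re, Circle.exp_im, Real.cos_neg, Real.sin_neg, add_zero]
  ext P
  rw [mem_strandLink]
  simp only [key]
  constructor
  · rintro ⟨u, v, huv, rfl⟩
    rw [zpow_zero] at huv
    obtain ⟨i, rfl⟩ := (Circle.exp_two_pi_zpow_eq_one hd u).1 huv
    obtain ⟨τ, hτ, h⟩ := Circle.exists_exp_two_pi v⁻¹
    exact ⟨i, τ, hτ, by rw [h, inv_inv]⟩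
  · rintro ⟨i, τ, -, rfl⟩
    refine ⟨_, _, ?_, rfl⟩
    rw [zpow_zero]
    exact (Circle.exp_two_pi_zpow_eq_one hd _).2 ⟨i, rfl⟩

theorem torusLink_right_concentric {d : ℕ} (hd : 1 ≤ d) :
    SameOrientedLinkType (torusLink 0 d) (concentricCircles d) := by
  rw [torusLink_right_eq hd]
  -- The longitudinal angles are squeezed into the first quadrant.
  have h1 := meridians_isotopy
    (fun t (i : Fin d) => Real.cos (2 * Real.pi * ((1 - 3 * t / 4) * (i / d))))
    (fun t (i : Fin d) => Real.sin (2 * Real.pi * ((1 - 3 * t / 4) * (i / d))))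
    (fun _ _ => 0) (fun i => by fun_prop) (fun i => by fun_prop) (fun i => contDiff_const)
    (fun t _ i => by rw [Real.cos_sq_add_sin_sq]; exact one_pos)
    (fun t ht i j ρ ρ' hρ hρ' hc hs => by
      have hm : ∀ k : Fin d, (1 - 3 * t / 4) * (k / d : ℝ) ∈ Ico (0 : ℝ) 1 := fun k => by
        obtain ⟨a, b⟩ := fin_div_mem k
        have h0 : 0 ≤ 1 - 3 * t / 4 := by linarith [ht.2]
        exact ⟨mul_nonneg h0 a, lt_of_le_of_lt (mul_le_of_le_one_left a (by linarith [ht.1])) b⟩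
      obtain ⟨-, h3, h4⟩ := polar_inj hρ hρ' (Real.cos_sq_add_sin_sq _)
        (Real.cos_sq_add_sin_sq _) hc (by linarith)
      have h := two_pi_injOn (hm i) (hm j) h3 h4
      exact fin_div_injective d (mul_left_cancel₀ (by linarith [ht.2]) h))
  have hq : ∀ i : Fin d, Real.pi / 2 * (i / d) ∈ Ico 0 (Real.pi / 2) := fun i =>
    ⟨mul_nonneg (by positivity) (fin_div_mem i).1,
      mul_lt_of_lt_one_right (by positivity) (fin_div_mem i).2⟩
  have hcos : ∀ i : Fin d, 0 < Real.cos (Real.pi / 2 * (i / d)) := fun i =>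
    Real.cos_pos_of_mem_Ioo ⟨by linarith [(hq i).1, Real.pi_pos], (hq i).2⟩
  have hA : ∀ t ∈ Icc (0 : ℝ) 1, ∀ i : Fin d,
      0 < (1 - t) * Real.cos (Real.pi / 2 * (i / d)) + t := fun t ht i => by
    have := combo_pos ht (hcos i) one_pos
    linarith
  -- The planes of the meridians become parallel while the circles are moved apart along the
  -- `y`-axis. If two points have the same first coordinate, the one with larger index is at least
  -- as far out, so its second coordinate is strictly larger.
  have h2 := meridians_isotopy
    (fun t (i : Fin d) => (1 - t) * Real.cos (Real.pi / 2 * (i / d)) + t)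
    (fun t (i : Fin d) => (1 - t) * Real.sin (Real.pi / 2 * (i / d)))
    (fun t i => t * i) (fun i => by fun_prop) (fun i => by fun_prop) (fun i => by fun_prop)
    (fun t ht i => by have := hA t ht i; positivity)
    (fun t ht i j ρ ρ' hρ hρ' hx hy => by
      have key : ∀ i j : Fin d, i < j → ∀ ρ ρ' : ℝ, 0 < ρ → 0 < ρ' →
          ρ * ((1 - t) * Real.cos (Real.pi / 2 * (i / d)) + t) =
            ρ' * ((1 - t) * Real.cos (Real.pi / 2 * (j / d)) + t) →
          ρ * ((1 - t) * Real.sin (Real.pi / 2 * (i / d))) + t * i <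
            ρ' * ((1 - t) * Real.sin (Real.pi / 2 * (j / d))) + t * j := by
        intro i j hij ρ ρ' hρ hρ' hx
        have hlt : Real.pi / 2 * (i / d) < Real.pi / 2 * (j / d) :=
          mul_lt_mul_of_pos_left (fin_div_lt hij) (by positivity)
        have hc : Real.cos (Real.pi / 2 * (j / d)) < Real.cos (Real.pi / 2 * (i / d)) :=
          Real.cos_lt_cos_of_nonneg_of_le_pi_div_two (hq i).1 (hq j).2.le hlt
        have hs : Real.sin (Real.pi / 2 * (i / d)) < Real.sin (Real.pi / 2 * (j / d)) :=
          Real.sin_lt_sin_of_lt_of_le_pi_div_two (by linarith [(hq i).1, Real.pi_pos])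
            (hq j).2.le hlt
        have hs0 : 0 ≤ Real.sin (Real.pi / 2 * (i / d)) :=
          Real.sin_nonneg_of_nonneg_of_le_pi (hq i).1 (by linarith [(hq i).2, Real.pi_pos])
        have hρρ : ρ ≤ ρ' := by
          have h3 : ρ * ((1 - t) * Real.cos (Real.pi / 2 * (i / d)) + t) ≤
              ρ' * ((1 - t) * Real.cos (Real.pi / 2 * (i / d)) + t) := by
            rw [hx]
            refine mul_le_mul_of_nonneg_left ?_ hρ'.le
            have := mul_le_mul_of_nonneg_left hc.le (sub_nonneg.2 ht.2)
            linarith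
          exact le_of_mul_le_mul_right h3 (hA t ht i)
        have h4 : ρ * Real.sin (Real.pi / 2 * (i / d)) < ρ' * Real.sin (Real.pi / 2 * (j / d)) :=
          (mul_le_mul_of_nonneg_right hρρ hs0).trans_lt (mul_lt_mul_of_pos_left hs hρ')
        have h5 : (i : ℝ) < j := by exact_mod_cast hij
        have := combo_pos ht (sub_pos.2 h4) (sub_pos.2 h5)
        linarith
      rcases lt_trichotomy i j with hij | hij | hij
      · exact absurd hy (key i j hij ρ ρ' hρ hρ' hx).ne
      · exact hij
      · exact absurd hy (key j i hij ρ' ρ hρ' hρ hx.symm).ne')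
  -- The result is a stack of unit circles around a common axis; their radii are spread apart while
  -- the stack is pressed flat.
  have h3 := sameOrientedLinkType_cylPoint (-2) (fun (_ : Fin d) _ => 1) (fun i _ => (i : ℝ))
  have h4 := parallelCircles_isotopy (fun t (i : Fin d) => (1 - t) * 1 + t * unlinkRadius d i)
    (fun t i => (1 - t) * (i : ℝ)) (fun i => by fun_prop) (fun i => by fun_prop)
    (fun t ht i => combo_pos ht one_pos (by linarith [(unlinkRadius_mem i).1]))
    (fun t ht i j hr hh => by
      rcases ht.1.eq_or_lt with rfl | ht0
      · have : (i : ℝ) = j := by linarith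
        ext
        exact_mod_cast this
      · have h5 : t * unlinkRadius d i = t * unlinkRadius d j := by linarith
        exact unlinkRadius_injective d (mul_left_cancel₀ ht0.ne' h5))
  have e1 : ∀ x : ℝ, 2 * Real.pi * ((1 - 3 / 4) * x) = Real.pi / 2 * x := fun x => by ring
  simp only [mul_zero, zero_div, sub_zero, one_mul, zero_mul, add_zero, sub_self, zero_add, e1,
    mul_one, neg_neg] at h1 h2 h3 h4
  simp only [add_zero]
  exact ((h1.trans h2).trans h3).trans h4

/-! ### Signs of the parameters -/

theorem torusLink_neg_neg (p q : ℤ) : torusLink (-p) (-q) = torusLink p q := by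
  simp only [torusLink, zpow_neg, inv_inj]

/-- The reflection in the `xy`-plane. -/
noncomputable def reflectZ : E3 ≃ₘ[ℝ] E3 where
  toFun P := !₂[P 0, P 1, -P 2]
  invFun P := !₂[P 0, P 1, -P 2]
  left_inv P := by ext k; fin_cases k <;> simp
  right_inv P := by ext k; fin_cases k <;> simp
  contMDiff_toFun := by
    have h := contDiff_euclidean.1 (contDiff_id : ContDiff ℝ ∞ (id : E3 → E3))
    exact ((h 0).vec3 (h 1) (h 2).neg).contMDiff
  contMDiff_invFun := by
    have h := contDiff_euclidean.1 (contDiff_id : ContDiff ℝ ∞ (id : E3 → E3))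
    exact ((h 0).vec3 (h 1) (h 2).neg).contMDiff

theorem reflectZ_torusPoint (u v : Circle) : reflectZ (torusPoint u v) = torusPoint u v⁻¹ := by
  change !₂[_, _, _] = !₂[_, _, _]
  rw [vec3_inj]
  simp [torusPoint]

/-- The reflection inverts the meridional angle, which amounts to changing the sign of `p`. -/
theorem sameLinkType_torusLink_neg (p q : ℤ) :
    SameLinkType (torusLink p q) (torusLink (-p) q) := by
  refine ⟨reflectZ, ?_⟩
  ext P
  constructor
  · rintro ⟨_, ⟨u, v, h, rfl⟩, rfl⟩
    exact ⟨u, v⁻¹, by rw [h, inv_zpow, zpow_neg, inv_inv], reflectZ_torusPoint u v⟩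
  · rintro ⟨u, v, h, rfl⟩
    exact ⟨_, ⟨u, v⁻¹, by rw [h, inv_zpow, zpow_neg], rfl⟩, by
      rw [reflectZ_torusPoint, inv_inv]⟩

/-! ### Torus links are Lorenz links -/

theorem exists_isLorenzLink_of_concentric {K : Set E3} {d : ℕ} (hd : 1 ≤ d)
    (h : SameOrientedLinkType K (concentricCircles d)) :
    ∃ L, IsLorenzLink L ∧ SameOrientedLinkType K L :=
  ⟨_, isLorenzLink_earCircle hd, h.trans (earCircle_concentric d).symm⟩

theorem exists_isLorenzLink_of_nat (p q : ℕ) (h : p ≠ 0 ∨ q ≠ 0) :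
    ∃ L, IsLorenzLink L ∧ SameOrientedLinkType (torusLink p q) L := by
  rcases Nat.eq_zero_or_pos p with rfl | hp
  · exact exists_isLorenzLink_of_concentric (by omega)
      (torusLink_right_concentric (by omega : 1 ≤ q))
  rcases Nat.eq_zero_or_pos q with rfl | hq
  · exact exists_isLorenzLink_of_concentric hp (torusLink_left_concentric hp)
  · exact exists_isLorenzLink_torusLink hp hq

theorem exists_isLorenzLink_of_mul_nonneg (p q : ℤ) (h : (p, q) ≠ (0, 0)) (hpq : 0 ≤ p * q) :
    ∃ L, IsLorenzLink L ∧ SameOrientedLinkType (torusLink p q) L := by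
  have h' : p ≠ 0 ∨ q ≠ 0 := by
    by_contra! h0
    exact h (by rw [h0.1, h0.2])
  rcases mul_nonneg_iff.1 hpq with ⟨hp, hq⟩ | ⟨hp, hq⟩
  · lift p to ℕ using hp
    lift q to ℕ using hq
    exact exists_isLorenzLink_of_nat p q (by exact_mod_cast h')
  · obtain ⟨a, rfl⟩ : ∃ a : ℕ, p = -a := ⟨p.natAbs, by omega⟩
    obtain ⟨b, rfl⟩ : ∃ b : ℕ, q = -b := ⟨q.natAbs, by omega⟩
    rw [torusLink_neg_neg]
    exact exists_isLorenzLink_of_nat a b (by omega)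

theorem exists_isLorenzLink_sameLinkType (p q : ℤ) (h : (p, q) ≠ (0, 0)) :
    ∃ L, IsLorenzLink L ∧ SameLinkType (torusLink p q) L := by
  rcases le_total 0 (p * q) with hpq | hpq
  · obtain ⟨L, hL, hs⟩ := exists_isLorenzLink_of_mul_nonneg p q h hpq
    exact ⟨L, hL, hs.sameLinkType⟩
  · obtain ⟨L, hL, hs⟩ := exists_isLorenzLink_of_mul_nonneg (-p) q
      (fun h0 => h (by simpa using h0)) (by linarith [neg_mul p q])
    exact ⟨L, hL, (sameLinkType_torusLink_neg p q).trans hs.sameLinkType⟩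
-- The main theorem.
theorem mainTheorem1 :
    (∀ p q : ℤ, (p, q) ≠ (0, 0) →
      ∃ L : Set E3, IsLorenzLink L ∧ SameLinkType (torusLink p q) L) ∧
    (∀ p q : ℤ, (p, q) ≠ (0, 0) → 0 ≤ p * q →
      ∃ L : Set E3, IsLorenzLink L ∧ SameOrientedLinkType (torusLink p q) L) ∧
    (∀ p q : ℕ, 1 ≤ p → 1 ≤ q →
      SameOrientedLinkType (braidClosure (lorenzBraid [(p, q)])) (torusLink p q)) := by
  exact ⟨exists_isLorenzLink_sameLinkType, exists_isLorenzLink_of_mul_nonneg,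
    fun p q hp hq => braidClosure_lorenzBraid_torusLink hp hq⟩
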